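/- Let $\Sigma\subset\mathbb{C}$ be a finite set with $0\in\Sigma$ and $\Sigma\cap(0,\infty)\neq\emptyset$, and let $\tau=\min(\Sigma\cap(0,\infty))$. Let $T(\Sigma)$ be the $\mathbb{Q}$-vector space spanned by all words over $\Sigma$, with the shuffle product $\sqcup\!\sqcup$, and write $\omega_\sigma$ for the letter $\sigma$. *Hyperlogarithms.* $L_{\omega_0^n}(z)=\frac{\log^n z}{n!}$ and otherwise $L_{\omega_\sigma w'}(z)=\int_0^z\frac{dz'}{z'-\sigma}L_{w'}(z')$ (along the straight segment), extended linearly to $T(\Sigma)$. *Regularization.* $\mathrm{reg}^\tau:T(\Sigma)\to T(\Sigma)$ is the unique linear map that is multiplicative for $\sqcup\!\sqcup$, fixes all words that do not begin with $\omega_\tau$, and annihilates $\omega_\tau^n$ for $n>0$. *Paths.* Let $z>\tau$ be real, and suppose it is fixed for every letter in $\Sigma\cap(0,z)$ whether it is passed above or below. For $a\in\{0,\tau\}$, a path $\gamma:[0,1]\to\mathbb{C}$ from $a$ to $z$ is called admissible if it is homotopic, through paths from $a$ to $z$ that do not meet $\Sigma$ at any time $t>0$, to a graph $t\mapsto a+t(z-a)+i\,h(t)$,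 $h:[0,1]\to\mathbb{R}$ continuous with $h(0)=h(1)=0$, that passes each letter in $\Sigma\cap(a,z)$ on the prescribed side and such that none of the curves $t\mapsto a+t(z-a)+i\,s\,h(t)$, $0<s\le1$, meets $\Sigma$ at any time $t>0$. Let $w=\omega_{\sigma_1}\cdots\omega_{\sigma_n}$ be a word over $\Sigma$ which is empty or has $\sigma_n\neq0$, let $\gamma$ be an admissible path from $0$ to $z$ and let $\delta$ be an admissible $C^1$ path from $\tau$ to $z$ (for the same choice of sides). Define $\int_\tau^z(\omega_{\rho_1}\cdots\omega_{\rho_k})$ as the iterated integral $$\int_{\delta}\omega_{\rho_1}\cdots\omega_{\rho_k}=\int_0^1\frac{d\delta(t)}{\delta(t)-\rho_1}\int_{\delta|_{[0,t]}}\omega_{\rho_2}\cdots\omega_{\rho_k}$$ for the words that are empty or have $\rho_k\neq\tau$, and extend it to a linear map $\int_\tau^z:T(\Sigma)\to\mathbb{C}$ by requiring $\int_\tau^z(u\sqcup\!\sqcup v)=\int_\tau^z(u)\cdot\int_\tau^z(v)$ and $$\int_\tau^z\omega_\tau=\pm i\pi+\log\frac{z-\tau}{\tau},$$ with the sign $+$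 if $\gamma$ passes below $\tau$ and $-$ if it passes above $\tau$. Then $\mathrm{reg}^\tau$ and $\int_\tau^z$ exist and are uniquely determined by these requirements, the germ of $L_w$ at $0$ can be continued analytically along $\gamma$, the analytic continuation of $L_{\omega_\tau}$ along $\gamma$ has the value $\int_\tau^z\omega_\tau$ at $z$, and the analytic continuation of $L_w$ along $\gamma$ has at $z$ the value $$\sum_{k=0}^n\int_\tau^z(\omega_{\sigma_1}\cdots\omega_{\sigma_k})\cdot L_{\mathrm{reg}^\tau(\omega_{\sigma_{k+1}}\cdots\omega_{\sigma_n})}(\tau).$$ -/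

import Mathlib

noncomputable section

namespace Hyperlogs

open Set Filter Topology

/-- The rational vector space spanned by all words over the alphabet `α`. -/
abbrev WordSpace (α : Type) : Type := List α →₀ ℚ

/-- A word, as a basis vector. -/
abbrev word {α : Type} (w : List α) : WordSpace α := Finsupp.single w 1

/-- The shuffle product of two words. -/
def shuffleWords {α : Type} : List α → List α → WordSpace α
  | [], v => word v
  | a :: u, [] => word (a :: u)
  | a :: u, b :: v =>
      (shuffleWords u (b :: v)).mapDomain (a :: ·) + (shuffleWords (a :: u) v).mapDomain (b :: ·)
termination_by u v => u.length + v.length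

/-- The shuffle product, extended bilinearly. -/
def shuffle {α : Type} (x y : WordSpace α) : WordSpace α :=
  x.sum fun u a => y.sum fun v b => (a * b) • shuffleWords u v

/-- The defining requirements on the shuffle regularization `reg_A^B`: it is linear and
multiplicative for the shuffle product, it fixes every word that neither begins with a letter of
`B` nor ends in a letter of `A`, and it annihilates the nonempty words all of whose letters lie in
`A`, or all of whose letters lie in `B`. -/
structure IsWordReg {α : Type} (A B : Set α) (reg : WordSpace α →ₗ[ℚ] WordSpace α) : Prop where
  map_shuffle : ∀ u v : List α, reg (shuffleWords u v) = shuffle (reg (word u)) (reg (word v))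
  map_regular : ∀ w : List α, (∀ σ ∈ w.head?, σ ∉ B) → (∀ σ ∈ w.getLast?, σ ∉ A) →
    reg (word w) = word w
  map_singular : ∀ w : List α, w ≠ [] → ((∀ σ ∈ w, σ ∈ A) ∨ (∀ σ ∈ w, σ ∈ B)) →
    reg (word w) = 0

open Classical in
/-- The hyperlogarithm `L_w(z)`: it is `(log z)^n / n!` for the word `0^n`, and otherwise
`L_{σ w'}(z) = ∫_0^z L_{w'}(z') dz' / (z' - σ)`, where the integral runs along the straight
segment `z' = s z`, `0 ≤ s ≤ 1`. -/
def hyperlog : List ℂ → ℂ → ℂ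
  | [], _ => 1
  | σ :: w, z =>
      if ∀ ρ ∈ σ :: w, ρ = 0 then
        Complex.log z ^ (w.length + 1) / ((w.length + 1).factorial : ℂ)
      else ∫ s in (0 : ℝ)..1, z / (s * z - σ) * hyperlog w (s * z)

/-- `w ↦ L_w(z)`, extended linearly. -/
def hyperlogLin {S : Finset ℂ} (x : WordSpace S) (z : ℂ) : ℂ :=
  x.sum fun w a => (a : ℂ) * hyperlog (w.map Subtype.val) z

/-- The iterated integral of the forms `dz / (z - σ_i)`, for the letters `σ_1, …, σ_n` of a word,
along the restriction of the path `γ` to `[0, t]`; the form of the first letter is integrated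
last. -/
def iterInt (γ : ℝ → ℂ) : List ℂ → ℝ → ℂ
  | [], _ => 1
  | σ :: w, t => ∫ s in (0 : ℝ)..t, deriv γ s / (γ s - σ) * iterInt γ w s

/-- The path `γ : [0, 1] → ℂ` from `a` to `z` is a deformation of the real segment `[a, z]` that
avoids the letters of `S` (except that it may start at one), passing above the letters in
`above` and below the other letters on the open segment. That is: `γ` is homotopic, through paths
from `a` to `z` that do not meet `S` after their start, to a graph
`t ↦ (a + t (z - a)) + i h(t)` over the segment, where `h` is positive at the letters in `above`
and negative at the other ones, and no letter off the segment lies on or between the graph and the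
segment. -/
def IsDeformedSegment (S : Finset ℂ) (above : Set ℝ) (a z : ℝ) (γ : ℝ → ℂ) : Prop :=
  ∃ (h : ℝ → ℝ) (H : ℝ × ℝ → ℂ),
    ContinuousOn h (Icc 0 1) ∧ h 0 = 0 ∧ h 1 = 0 ∧
    (∀ s ∈ Ioc (0 : ℝ) 1, ∀ t ∈ Ioc (0 : ℝ) 1,
      (⟨a + t * (z - a), s * h t⟩ : ℂ) ∉ S) ∧
    (∀ t ∈ Ioo (0 : ℝ) 1, ((a + t * (z - a) : ℝ) : ℂ) ∈ S →
      (a + t * (z - a) ∈ above → 0 < h t) ∧ (a + t * (z - a) ∉ above → h t < 0)) ∧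
    ContinuousOn H (Icc 0 1 ×ˢ Icc 0 1) ∧
    (∀ t ∈ Icc (0 : ℝ) 1, H (0, t) = γ t) ∧
    (∀ t ∈ Icc (0 : ℝ) 1, H (1, t) = ⟨a + t * (z - a), h t⟩) ∧
    (∀ s ∈ Icc (0 : ℝ) 1, H (s, 0) = a ∧ H (s, 1) = z) ∧
    (∀ s ∈ Icc (0 : ℝ) 1, ∀ t ∈ Ioc (0 : ℝ) 1, H (s, t) ∉ S)

/-- The function elements `F t`, `0 ≤ t ≤ 1`, form an analytic continuation of (the germ at `γ 0`
of) `f` along the path `γ : [0, 1] → ℂ`. -/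
structure IsAnalyticContinuation (f : ℂ → ℂ) (γ : ℝ → ℂ) (F : ℝ → ℂ → ℂ) : Prop where
  start : F 0 =ᶠ[𝓝 (γ 0)] f
  analytic : ∀ t ∈ Icc (0 : ℝ) 1, AnalyticAt ℂ (F t) (γ t)
  compatible : ∀ t ∈ Icc (0 : ℝ) 1, ∀ᶠ s in 𝓝[Icc 0 1] t, F s =ᶠ[𝓝 (γ s)] F t

/-- The value `± i π + log ((z - τ) / τ)`, with the sign `-` if `τ` is passed above and the sign
`+` if it is passed below. -/
def branchValue (above : Set ℝ) (τ z : ℝ) : ℂ :=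
  open Classical in
  (if τ ∈ above then -1 else 1) * (Complex.I * (Real.pi : ℂ)) + (Real.log ((z - τ) / τ) : ℂ)

/-- The defining requirements on the extension to all words of the iterated integrals along a path
`δ` that starts at the letter `τ`: they are the iterated integrals for the words that do not end
in `τ`, the map is linear and multiplicative for the shuffle product, and `τ ↦ c`. -/
structure IsExtendedIntegral {S : Finset ℂ} (τ : S) (δ : ℝ → ℂ) (c : ℂ)
    (I : WordSpace S →ₗ[ℚ] ℂ) : Prop where
  eq_iterInt : ∀ w : List S, τ ∉ w.getLast? → I (word w) = iterInt δ (w.map Subtype.val) 1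
  map_shuffle : ∀ u v : List S, I (shuffleWords u v) = I (word u) * I (word v)
  map_letter : I (word [τ]) = c

end Hyperlogs

end

/-! Near `τ` two families solve the same triangular system `f_{σu}' = f_u / (p - σ)`. One consists
of the hyperlogarithms `hlog w`, normalised at `0`. The other consists of iterated primitives `E u`
with tangential normalisation at `τ`: `E (τ^n) = K^n / n!` for a branch `K` of `log (1 - p/τ)`,
while `E u` tends to `0` at `τ` for every other word. Hence `hlog w` is a sum of `E (take k)` with
constant coefficients depending on `drop k`, and the task is to identify these constants.

This is where the regularization enters. Deletion `del τ` of a leading `τ` is a derivation of the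
shuffle product, and `delReg τ` is formally `exp (-τ · del τ)`, a multiplicative projection onto the
words that do not begin with `τ`. It yields the Taylor formula `word_eq_sum_shL_delReg`. Applying
the shuffle character `hlog` writes `hlog w` as a polynomial in `K` whose coefficients have limits
at `τ`, with errors that beat every power of `K` (`hlog_letter`). So `hlog w` and the sum of `E
(take k) · L_{reg (drop k)}(τ)` differ by something tending to `0` at `τ`. By induction on `w` the
difference is also constant, and therefore zero (`hlog_eq_sum`).

The local identity is then continued to `z`. By `monodromy` the path may be replaced by a graph that
hugs the segment up to `τ`, passes `τ` inside the disc, and afterwards follows a height function for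
`δ`. The cut of `K` lies on the side where `τ` is not passed. For `u` not ending in `τ`, `E u` is
analytic at `τ` and its continuation is the iterated integral along `δ` (`iterInt_cons_eq`).
Multiplicativity continues along the path, and `K` acquires the prescribed value at `z`. Thus the
continued `E` is an extended integral, and `character_ext` shows that it is the only one. -/

noncomputable section

namespace Hyperlogs

open Set Filter Topology

/-! ### Shuffle algebra and deletion of the leading letter -/

section Algebra

variable {α : Type}

/-- The shuffle product as a bilinear map. -/
def shL : WordSpace α →ₗ[ℚ] WordSpace α →ₗ[ℚ] WordSpace α :=
  Finsupp.linearCombination ℚ fun u => Finsupp.linearCombination ℚ fun v => shuffleWords u v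

lemma shL_word (u v : List α) : shL (word u) (word v) = shuffleWords u v := by
  simp [shL]

lemma shuffle_eq_shL (x y : WordSpace α) : shuffle x y = shL x y := by
  unfold shuffle shL
  rw [Finsupp.linearCombination_apply, Finsupp.sum, Finsupp.sum, LinearMap.sum_apply]
  refine Finset.sum_congr rfl fun u _ => ?_
  rw [LinearMap.smul_apply, Finsupp.linearCombination_apply, Finsupp.smul_sum]
  simp only [mul_smul]

lemma shuffleWords_nil_left (v : List α) : shuffleWords [] v = word v := by
  simp [shuffleWords]

lemma shuffleWords_nil_right (u : List α) : shuffleWords u [] = word u := by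
  cases u <;> simp [shuffleWords]

lemma shuffleWords_cons_cons (a b : α) (u v : List α) :
    shuffleWords (a :: u) (b :: v) =
      (shuffleWords u (b :: v)).mapDomain (a :: ·) +
        (shuffleWords (a :: u) v).mapDomain (b :: ·) := by
  rw [shuffleWords]

lemma shL_nil_left (x : WordSpace α) : shL (word []) x = x := by
  induction x using Finsupp.induction_linear with
  | zero => simp
  | add f g hf hg => rw [map_add, hf, hg]
  | single u c =>
    have : (Finsupp.single u c : WordSpace α) = c • word u := by simp
    rw [this, map_smul, shL_word, shuffleWords_nil_left]

lemma shL_nil_right (x : WordSpace α) : shL x (word []) = x := by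
  induction x using Finsupp.induction_linear with
  | zero => simp
  | add f g hf hg => rw [map_add, LinearMap.add_apply, hf, hg]
  | single u c =>
    have : (Finsupp.single u c : WordSpace α) = c • word u := by simp
    rw [this, map_smul, LinearMap.smul_apply, shL_word, shuffleWords_nil_right]

/-- Linear maps on the word space are determined by their values on words. -/
lemma wordSpace_hom_ext {M : Type*} [AddCommMonoid M] [Module ℚ M] {f g : WordSpace α →ₗ[ℚ] M}
    (h : ∀ w, f (word w) = g (word w)) : f = g :=
  Finsupp.lhom_ext' fun w => LinearMap.ext_ring (h w)

lemma cons_injective (a : α) : Function.Injective (a :: · : List α → List α) :=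
  fun _ _ h => by simpa using h

/-- Deletion of a leading letter `a`; words not beginning with `a` are sent to `0`. -/
def del (a : α) : WordSpace α →ₗ[ℚ] WordSpace α :=
  Finsupp.lcomapDomain (a :: ·) (cons_injective a)

lemma del_apply (a : α) (x : WordSpace α) (u : List α) : del a x u = x (a :: u) := rfl

lemma del_nil (a : α) : del a (word []) = 0 := by
  ext u; simp [del_apply]

lemma del_cons_self (a : α) (u : List α) : del a (word (a :: u)) = word u := by
  classical
  ext v; simp [del_apply, Finsupp.single_apply]

lemma del_cons_of_ne {a b : α} (h : b ≠ a) (u : List α) : del a (word (b :: u)) = 0 := by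
  ext v; simp [del_apply, h]

lemma del_mapDomain_self (a : α) (x : WordSpace α) : del a (x.mapDomain (a :: ·)) = x := by
  ext v; rw [del_apply, Finsupp.mapDomain_apply (cons_injective a)]

lemma del_mapDomain_of_ne {a b : α} (h : b ≠ a) (x : WordSpace α) :
    del a (x.mapDomain (b :: ·)) = 0 := by
  ext v
  rw [del_apply, Finsupp.mapDomain_of_notMem_range]
  · rfl
  · rintro ⟨u, hu⟩; simp at hu; exact h hu.1

/-- The analogue of comparing constant terms and all first derivatives. Together with `del_shL` it
reduces commutativity and associativity of the shuffle to inductions that never unfold the product.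
-/
lemma ext_del {x y : WordSpace α} (h0 : x [] = y []) (h : ∀ a, del a x = del a y) : x = y := by
  ext u
  cases u with
  | nil => exact h0
  | cons a u => exact DFunLike.congr_fun (h a) u

lemma del_shuffleWords (a : α) (u v : List α) :
    del a (shuffleWords u v) = shL (del a (word u)) (word v) + shL (word u) (del a (word v)) := by
  cases u with
  | nil => rw [shuffleWords_nil_left, del_nil, shL_nil_left]; simp
  | cons b u =>
    cases v with
    | nil => rw [shuffleWords_nil_right, del_nil, shL_nil_right]; simp
    | cons c v =>
      rw [shuffleWords_cons_cons, map_add]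
      congr 1
      · by_cases h : b = a
        · subst h; rw [del_mapDomain_self, del_cons_self, shL_word]
        · rw [del_mapDomain_of_ne h, del_cons_of_ne h]; simp
      · by_cases h : c = a
        · subst h; rw [del_mapDomain_self, del_cons_self, shL_word]
        · rw [del_mapDomain_of_ne h, del_cons_of_ne h]; simp

/-- Deletion of a leading letter is a derivation of the shuffle product. -/
lemma del_shL (a : α) (x y : WordSpace α) :
    del a (shL x y) = shL (del a x) y + shL x (del a y) := by
  have : (shL (α := α)).compr₂ (del a) = shL.comp (del a) + shL.compl₂ (del a) := by
    refine wordSpace_hom_ext fun u => wordSpace_hom_ext fun v => ?_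
    simpa [shL_word] using del_shuffleWords a u v
  simpa using DFunLike.congr_fun (DFunLike.congr_fun this x) y

lemma shuffleWords_apply_nil (u v : List α) :
    shuffleWords u v [] = word u [] * word v [] := by
  cases u with
  | nil => simp [shuffleWords_nil_left]
  | cons b u =>
    cases v with
    | nil => simp [shuffleWords_nil_right]
    | cons c v =>
      rw [shuffleWords_cons_cons, Finsupp.add_apply, Finsupp.mapDomain_of_notMem_range,
        Finsupp.mapDomain_of_notMem_range] <;> simp

lemma shL_apply_nil (x y : WordSpace α) : shL x y [] = x [] * y [] := by
  have : (shL (α := α)).compr₂ (Finsupp.lapply []) =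
      (LinearMap.mul ℚ ℚ).compl₁₂ (Finsupp.lapply []) (Finsupp.lapply []) := by
    refine wordSpace_hom_ext fun u => wordSpace_hom_ext fun v => ?_
    simpa [shL_word] using shuffleWords_apply_nil u v
  simpa using DFunLike.congr_fun (DFunLike.congr_fun this x) y

lemma del_cons (a b : α) (u : List α) :
    del a (word (b :: u)) = 0 ∨ del a (word (b :: u)) = word u := by
  by_cases h : b = a
  · subst h; exact Or.inr (del_cons_self _ _)
  · exact Or.inl (del_cons_of_ne h _)

lemma shL_comm (x y : WordSpace α) : shL x y = shL y x := by
  suffices h : shL (α := α) = shL.flip by simpa using DFunLike.congr_fun (DFunLike.congr_fun h x) y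
  refine wordSpace_hom_ext fun u => wordSpace_hom_ext fun v => ?_
  rw [LinearMap.flip_apply]
  induction u generalizing v with
  | nil => rw [shL_nil_left, shL_nil_right]
  | cons b u ihu =>
    induction v with
    | nil => rw [shL_nil_left, shL_nil_right]
    | cons c v ihv =>
      refine ext_del (by rw [shL_apply_nil, shL_apply_nil, mul_comm]) fun a => ?_
      rw [del_shL, del_shL, add_comm]
      congr 1
      · rcases del_cons a c v with h | h <;> rw [h]
        · simp
        · exact ihv
      · rcases del_cons a b u with h | h <;> rw [h]
        · simp
        · exact ihu _

lemma shL_assoc (x y z : WordSpace α) : shL (shL x y) z = shL x (shL y z) := by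
  suffices h : ∀ u v w : List α,
      shL (shL (word u) (word v)) (word w) = shL (word u) (shL (word v) (word w)) by
    have h' : (shL (α := α)).compr₂ shL =
        ((LinearMap.llcomp ℚ (WordSpace α) (WordSpace α) (WordSpace α)).flip.comp shL).flip.comp
          shL := by
      refine wordSpace_hom_ext fun u => wordSpace_hom_ext fun v => wordSpace_hom_ext fun w => ?_
      simpa using h u v w
    simpa using DFunLike.congr_fun (DFunLike.congr_fun (DFunLike.congr_fun h' x) y) z
  intro u
  induction u with
  | nil => intro v w; rw [shL_nil_left, shL_nil_left]
  | cons b u ihu =>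
    intro v
    induction v with
    | nil => intro w; rw [shL_nil_left, shL_nil_right]
    | cons c v ihv =>
      intro w
      induction w with
      | nil => rw [shL_nil_right, shL_nil_right]
      | cons d w ihw =>
        refine ext_del (by simp only [shL_apply_nil, mul_assoc]) fun a => ?_
        simp only [del_shL, map_add, LinearMap.add_apply, add_assoc]
        congr 1
        · rcases del_cons a b u with h | h <;> rw [h]
          · simp
          · exact ihu _ _
        · congr 1
          · rcases del_cons a c v with h | h <;> rw [h]
            · simp
            · exact ihv _
          · rcases del_cons a d w with h | h <;> rw [h]
            · simp
            · exact ihw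

/-- Powers of a single letter, as words. -/
abbrev rep (τ : α) (n : ℕ) : WordSpace α := word (List.replicate n τ)

/-- The words `rep τ n` are the divided powers `τ^n / n!`; the recursion of the shuffle product
becomes Pascal's rule. -/
lemma shL_rep_rep (τ : α) (m n : ℕ) :
    shL (rep τ m) (rep τ n) = ((m + n).choose m : ℚ) • rep τ (m + n) := by
  induction m generalizing n with
  | zero => simp [rep, shL_nil_left]
  | succ m ihm =>
    induction n with
    | zero => simp [rep, shL_nil_right]
    | succ n ihn =>
      have h1 := ihm (n + 1)
      rw [shL_word, List.replicate_succ (n := n)] at h1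
      rw [shL_word, List.replicate_succ (n := m)] at ihn
      rw [shL_word, List.replicate_succ (n := m), List.replicate_succ (n := n),
        shuffleWords_cons_cons, h1, ihn, Finsupp.mapDomain_smul, Finsupp.mapDomain_smul]
      simp only [rep, word, Finsupp.mapDomain_single, ← List.replicate_succ]
      rw [show m + (n + 1) + 1 = m + 1 + (n + 1) by omega, show m + 1 + n + 1 = m + 1 + (n + 1) by
        omega, ← add_smul, show m + 1 + (n + 1) = (m + n + 1) + 1 by omega,
        Nat.choose_succ_succ, show m + (n + 1) = m + n + 1 by omega,
        show m + 1 + n = m + n + 1 by omega]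
      push_cast; rfl

lemma del_rep_succ (τ : α) (n : ℕ) : del τ (rep τ (n + 1)) = rep τ n := by
  rw [rep, List.replicate_succ, del_cons_self]

lemma del_pow_word_of_length_lt (τ : α) (w : List α) {n : ℕ} (h : w.length < n) :
    (del τ ^ n) (word w) = 0 := by
  induction n generalizing w with
  | zero => omega
  | succ n ih =>
    rw [pow_succ, Module.End.mul_apply]
    cases w with
    | nil => rw [del_nil, map_zero]
    | cons b w =>
      rcases del_cons τ b w with h' | h' <;> rw [h']
      · simp
      · exact ih w (by simpa using h)

lemma del_pow_word (τ : α) [DecidableEq α] (w : List α) (n : ℕ) (hn : n ≤ w.length) :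
    (del τ ^ n) (word w) =
      if w.take n = List.replicate n τ then word (w.drop n) else 0 := by
  induction n generalizing w with
  | zero => simp
  | succ n ih =>
    rw [pow_succ, Module.End.mul_apply]
    cases w with
    | nil => simp at hn
    | cons b w =>
      by_cases h : b = τ
      · subst h
        rw [del_cons_self, ih w (by simpa using hn)]
        simp [List.replicate_succ]
      · rw [del_cons_of_ne h]
        simp [List.replicate_succ, h]

lemma del_del_pow (τ : α) (n : ℕ) (x : WordSpace α) :
    del τ ((del τ ^ n) x) = (del τ ^ (n + 1)) x := by
  rw [pow_succ', Module.End.mul_apply]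

lemma del_pow_shL (τ : α) (n : ℕ) (x y : WordSpace α) :
    (del τ ^ n) (shL x y) = ∑ p ∈ Finset.HasAntidiagonal.antidiagonal n,
      (n.choose p.1 : ℚ) • shL ((del τ ^ p.1) x) ((del τ ^ p.2) y) := by
  induction n with
  | zero => simp
  | succ n ih =>
    rw [← del_del_pow, ih, map_sum]
    simp only [map_smul, del_shL, del_del_pow]
    simp only [smul_add, Finset.sum_add_distrib]
    have := Finset.sum_antidiagonal_choose_succ_nsmul
      (fun i j => shL ((del τ ^ i) x) ((del τ ^ j) y)) n
    simp only [← Nat.cast_smul_eq_nsmul ℚ] at this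
    rw [this, add_comm]
    congr 1
    refine Finset.sum_congr rfl fun p hp => ?_
    rw [Finset.HasAntidiagonal.mem_antidiagonal] at hp
    rw [Nat.choose_symm_of_eq_add (n := n) (a := p.1) (b := p.2) hp.symm]

/-! ### The regularization: existence, uniqueness and Taylor formula -/

/-- The shuffle regularization of words with respect to the leading letter `τ`. -/
def delReg (τ : α) : WordSpace α →ₗ[ℚ] WordSpace α :=
  Finsupp.linearCombination ℚ fun w => ∑ n ∈ Finset.range (w.length + 1),
    (-1 : ℚ) ^ n • shL (rep τ n) ((del τ ^ n) (word w))

/-- The freedom in `N` allows one common summation range for all the words occurring in a shuffle.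
-/
lemma delReg_word (τ : α) (w : List α) {N : ℕ} (h : w.length < N) :
    delReg τ (word w) = ∑ n ∈ Finset.range N,
      (-1 : ℚ) ^ n • shL (rep τ n) ((del τ ^ n) (word w)) := by
  rw [delReg, Finsupp.linearCombination_single, one_smul]
  refine Finset.sum_subset (by intro n; simp; omega) fun n _ hn => ?_
  rw [del_pow_word_of_length_lt _ _ (by simpa using hn)]
  simp

/-- Serves twice: it gives the length of every term of a shuffle, and it shows that a letter other
than `τ` in either factor survives in every term. -/
lemma shuffleWords_mem_perm (u v : List α) :
    shuffleWords u v ∈ Finsupp.supported ℚ ℚ {w : List α | w.Perm (u ++ v)} := by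
  classical
  induction u generalizing v with
  | nil => rw [shuffleWords_nil_left]; exact Finsupp.single_mem_supported _ _ (List.Perm.refl _)
  | cons a u ihu =>
    induction v with
    | nil => rw [shuffleWords_nil_right]; exact Finsupp.single_mem_supported _ _ (by simp)
    | cons b v ihv =>
      rw [shuffleWords_cons_cons]
      refine Submodule.add_mem _ ?_ ?_
      · refine fun x hx => ?_
        obtain ⟨y, hy, rfl⟩ := Finset.mem_image.1 (Finsupp.mapDomain_support hx)
        exact (ihu (b :: v) hy).cons a
      · refine fun x hx => ?_
        obtain ⟨y, hy, rfl⟩ := Finset.mem_image.1 (Finsupp.mapDomain_support hx)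
        exact ((ihv hy).cons b).trans List.perm_middle.symm

lemma shuffleWords_mem_length (u v : List α) :
    shuffleWords u v ∈ Finsupp.supported ℚ ℚ {w : List α | w.length = u.length + v.length} :=
  fun _ hx => (shuffleWords_mem_perm u v hx).length_eq.trans List.length_append

/-- A linear map that agrees with another one on a set of words agrees on its span. -/
lemma eq_of_mem_supported {M : Type*} [AddCommGroup M] [Module ℚ M] {f g : WordSpace α →ₗ[ℚ] M}
    {P : Set (List α)} (h : ∀ w ∈ P, f (word w) = g (word w)) {x : WordSpace α}
    (hx : x ∈ Finsupp.supported ℚ ℚ P) : f x = g x := by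
  rw [Finsupp.supported_eq_span_single] at hx
  exact LinearMap.eqOn_span (by rintro _ ⟨w, hw, rfl⟩; exact h w hw) hx

/-- An exponential of a derivation is multiplicative. The binomial coefficient from the Leibniz rule
on one side matches the one from the product of divided powers on the other. -/
lemma delReg_shuffleWords (τ : α) (u v : List α) :
    delReg τ (shuffleWords u v) = shL (delReg τ (word u)) (delReg τ (word v)) := by
  set N := u.length + v.length + 1 with hN
  have h1 : delReg τ (shuffleWords u v) = (∑ n ∈ Finset.range N,
      (-1 : ℚ) ^ n • (shL (rep τ n)).comp (del τ ^ n)) (shuffleWords u v) := by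
    refine eq_of_mem_supported (fun w hw => ?_) (shuffleWords_mem_length u v)
    rw [delReg_word τ w (N := N) (by simp at hw; omega)]
    simp [LinearMap.sum_apply]
  rw [h1, delReg_word τ u (N := u.length + 1) (by omega),
    delReg_word τ v (N := v.length + 1) (by omega), map_sum, LinearMap.sum_apply]
  simp_rw [map_sum shL, LinearMap.sum_apply]
  rw [Finset.sum_comm]
  rw [← Finset.sum_product']
  rw [← Finset.sum_fiberwise_of_maps_to (t := Finset.range N) (g := fun p : ℕ × ℕ => p.1 + p.2)
    (by rintro ⟨i, j⟩; simp; omega)]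
  refine Finset.sum_congr rfl fun n _ => ?_
  rw [LinearMap.smul_apply, LinearMap.comp_apply, ← shL_word, del_pow_shL, map_sum,
    Finset.smul_sum]
  symm
  -- The antidiagonal also contains pairs exceeding the lengths of `u` or `v`; there a power of `del
  -- τ` annihilates the word.
  refine Finset.sum_subset_zero_on_sdiff (fun p hp => ?_) (fun p hp => ?_) (fun p hp => ?_)
  · simp at hp; simp [hp]
  · simp only [Finset.mem_sdiff, Finset.HasAntidiagonal.mem_antidiagonal, Finset.mem_filter, Finset.mem_product,
      Finset.mem_range, not_and] at hp
    have : u.length < p.1 ∨ v.length < p.2 := by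
      by_contra! h; exact hp.2 ⟨by omega, by omega⟩ hp.1
    rcases this with h | h <;> rw [del_pow_word_of_length_lt _ _ h] <;> simp
  · simp only [Finset.mem_filter] at hp
    obtain ⟨-, rfl⟩ := hp
    obtain ⟨i, j⟩ := p
    simp only [map_smul, LinearMap.smul_apply]
    have hsw : ∀ a b c d : WordSpace α,
        shL (shL a b) (shL c d) = shL (shL a c) (shL b d) := by
      intro a b c d
      rw [shL_assoc, ← shL_assoc b, shL_comm b c, shL_assoc c, ← shL_assoc]
    rw [hsw, shL_rep_rep, map_smul, LinearMap.smul_apply, smul_smul, smul_smul, smul_smul, pow_add,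
      mul_comm ((-1 : ℚ) ^ j)]

lemma delReg_shL (τ : α) (x y : WordSpace α) :
    delReg τ (shL x y) = shL (delReg τ x) (delReg τ y) := by
  have : (shL (α := α)).compr₂ (delReg τ) = shL.compl₁₂ (delReg τ) (delReg τ) := by
    refine wordSpace_hom_ext fun u => wordSpace_hom_ext fun v => ?_
    simpa [shL_word] using delReg_shuffleWords τ u v
  simpa using DFunLike.congr_fun (DFunLike.congr_fun this x) y

/-- The sum telescopes, since `del τ` lowers `rep τ (n + 1)` to `rep τ n`; the last remaining term
contains more deletions than the word has letters. -/
lemma del_delReg (τ : α) (x : WordSpace α) : del τ (delReg τ x) = 0 := by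
  suffices h : (del τ).comp (delReg τ) = 0 by simpa using DFunLike.congr_fun h x
  refine wordSpace_hom_ext fun w => ?_
  rw [LinearMap.comp_apply, delReg_word τ w (Nat.lt_succ_self _), map_sum]
  have key : ∀ N : ℕ, ∑ n ∈ Finset.range (N + 1),
      del τ ((-1 : ℚ) ^ n • shL (rep τ n) ((del τ ^ n) (word w))) =
        (-1 : ℚ) ^ N • shL (rep τ N) ((del τ ^ (N + 1)) (word w)) := by
    intro N
    induction N with
    | zero => simp [rep, shL_nil_left]
    | succ N ih =>
      rw [Finset.sum_range_succ, ih, map_smul, del_shL, del_rep_succ, del_del_pow, smul_add,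
        ← add_assoc, ← add_smul, pow_succ]
      simp
  rw [key, del_pow_word_of_length_lt τ w (by simp)]
  simp

lemma delReg_of_del_eq_zero (τ : α) (w : List α) (h : del τ (word w) = 0) :
    delReg τ (word w) = word w := by
  rw [delReg_word τ w (Nat.lt_succ_self _), Finset.sum_range_succ',
    Finset.sum_eq_zero, zero_add]
  · simp [rep, shL_nil_left]
  · intro n _
    rw [pow_succ (del τ), Module.End.mul_apply, h]; simp

lemma del_eq_zero_of_head {τ : α} {w : List α} (h : τ ∉ w.head?) : del τ (word w) = 0 := by
  cases w with
  | nil => exact del_nil τ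
  | cons b w => exact del_cons_of_ne (by simpa using h) w

lemma delReg_rep_succ (τ : α) (n : ℕ) : delReg τ (rep τ (n + 1)) = 0 := by
  rw [delReg_word τ _ (N := n + 2) (by simp)]
  have h : ∀ m k : ℕ, (del τ ^ m) (rep τ (m + k)) = rep τ k := by
    intro m
    induction m with
    | zero => simp
    | succ m ih =>
      intro k
      rw [pow_succ, Module.End.mul_apply, show m + 1 + k = (m + k) + 1 by omega, del_rep_succ, ih]
  have h2 : ∀ m ∈ Finset.range (n + 2), (-1 : ℚ) ^ m • shL (rep τ m)
      ((del τ ^ m) (rep τ (n + 1))) = ((-1) ^ m * ((n + 1).choose m : ℚ)) • rep τ (n + 1) := by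
    intro m hm
    obtain ⟨k, hk⟩ : ∃ k, n + 1 = m + k := ⟨n + 1 - m, by simp at hm; omega⟩
    rw [hk, h, shL_rep_rep, smul_smul]
  rw [Finset.sum_congr rfl h2, ← Finset.sum_smul]
  have := Int.alternating_sum_range_choose_of_ne (n := n + 1) (by omega)
  have h3 : (∑ m ∈ Finset.range (n + 2), (-1 : ℚ) ^ m * ((n + 1).choose m : ℚ)) = 0 := by
    exact_mod_cast congrArg (Int.cast (R := ℚ)) this
  rw [h3, zero_smul]

lemma isWordReg_delReg (τ : α) : IsWordReg ∅ {τ} (delReg τ) where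
  map_shuffle u v := by rw [shuffle_eq_shL, delReg_shuffleWords]
  map_regular w h _ := delReg_of_del_eq_zero τ w (del_eq_zero_of_head fun h' => h _ h' rfl)
  map_singular w hw h := by
    have hall : ∀ σ ∈ w, σ = τ := by
      rcases h with h | h
      · obtain ⟨σ, hσ⟩ := List.exists_mem_of_ne_nil w hw
        exact (h σ hσ).elim
      · exact h
    rw [List.eq_replicate_of_mem hall]
    obtain ⟨n, hn⟩ := Nat.exists_eq_succ_of_ne_zero (List.length_pos_iff.2 hw).ne'
    rw [hn]
    exact delReg_rep_succ τ n

lemma IsWordReg.map_shL {A B : Set α} {reg : WordSpace α →ₗ[ℚ] WordSpace α}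
    (h : IsWordReg A B reg) (x y : WordSpace α) : reg (shL x y) = shL (reg x) (reg y) := by
  have : (shL (α := α)).compr₂ reg = shL.compl₁₂ reg reg := by
    refine wordSpace_hom_ext fun u => wordSpace_hom_ext fun v => ?_
    simpa [shL_word, shuffle_eq_shL] using h.map_shuffle u v
  simpa using DFunLike.congr_fun (DFunLike.congr_fun this x) y

lemma mem_supported_of_del_eq_zero {τ : α} {x : WordSpace α} (h : del τ x = 0) :
    x ∈ Finsupp.supported ℚ ℚ {w : List α | τ ∉ w.head?} := by
  intro w hw
  cases w with
  | nil => simp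
  | cons b w =>
    intro hb
    have hb : b = τ := by simpa using hb
    subst hb
    have := DFunLike.congr_fun h w
    rw [del_apply] at this
    simp [this] at hw

lemma IsWordReg.apply_of_del_eq_zero {τ : α} {reg : WordSpace α →ₗ[ℚ] WordSpace α}
    (h : IsWordReg ∅ {τ} reg) {x : WordSpace α} (hx : del τ x = 0) : reg x = x := by
  refine eq_of_mem_supported (f := reg) (g := LinearMap.id) (fun w hw => ?_)
    (mem_supported_of_del_eq_zero hx)
  exact h.map_regular w (fun σ hσ hσ' => hw (by rwa [← show σ = τ from hσ'])) (by simp)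

lemma IsWordReg.map_rep_succ {τ : α} {reg : WordSpace α →ₗ[ℚ] WordSpace α}
    (h : IsWordReg ∅ {τ} reg) (n : ℕ) : reg (rep τ (n + 1)) = 0 :=
  h.map_singular _ (by simp) (Or.inr fun _ hσ => List.eq_of_mem_replicate hσ)

/-- The shuffle regularization is uniquely determined. -/
lemma IsWordReg.eq_delReg {τ : α} {reg : WordSpace α →ₗ[ℚ] WordSpace α}
    (h : IsWordReg ∅ {τ} reg) : reg = delReg τ := by
  refine wordSpace_hom_ext fun w => ?_
  -- `reg` fixes `delReg τ w`, since no word in it begins with `τ`. By multiplicativity `reg` also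
  -- kills all terms of its defining sum except `n = 0`, which contributes `reg w`.
  have h1 := h.apply_of_del_eq_zero (del_delReg τ (word w))
  rw [← h1]
  rw [delReg_word τ w (Nat.lt_succ_self _), Finset.sum_range_succ', map_add, map_sum,
    Finset.sum_eq_zero, zero_add]
  · simp [rep, shL_nil_left]
  · intro n _
    rw [map_smul, h.map_shL, h.map_rep_succ]; simp

/-- Every word is a polynomial in the letter `τ` with coefficients in the image of the
regularization. -/
lemma word_eq_sum_shL_delReg (τ : α) (w : List α) {N : ℕ} (hN : w.length < N) :
    word w = ∑ k ∈ Finset.range N, shL (rep τ k) (delReg τ ((del τ ^ k) (word w))) := by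
  have hreg := isWordReg_delReg τ
  -- By the induction hypothesis for `del τ x`, the difference of both sides is killed by `del τ`
  -- and hence fixed by `delReg τ`. But `delReg τ` sends it to zero, because the terms with `k > 0`
  -- die and the term `k = 0` cancels `x`.
  have key : ∀ N : ℕ, ∀ x : WordSpace α, (del τ ^ N) x = 0 →
      x = ∑ k ∈ Finset.range N, shL (rep τ k) (delReg τ ((del τ ^ k) x)) := by
    intro N
    induction N with
    | zero => intro x hx; simpa using hx
    | succ N ih =>
      intro x hx
      have h1 : del τ (x - ∑ k ∈ Finset.range (N + 1),
          shL (rep τ k) (delReg τ ((del τ ^ k) x))) = 0 := by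
        rw [map_sub, map_sum, Finset.sum_range_succ']
        simp only [del_shL, del_delReg, del_rep_succ, map_zero, add_zero]
        rw [show rep τ 0 = word [] from rfl, del_nil]
        have := ih (del τ x) (by rwa [← Module.End.mul_apply, ← pow_succ])
        simp only [← Module.End.mul_apply, ← pow_succ] at this ⊢
        rw [← this]; simp
      have h2 := hreg.apply_of_del_eq_zero h1
      rw [map_sub, map_sum, Finset.sum_range_succ', Finset.sum_eq_zero (fun n _ => by
        rw [delReg_shL, delReg_rep_succ]; simp), zero_add, delReg_shL,
        hreg.apply_of_del_eq_zero (del_delReg τ _)] at h2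
      rw [show rep τ 0 = word [] from rfl, delReg_of_del_eq_zero τ [] (del_nil τ),
        shL_nil_left, pow_zero, Module.End.one_apply, sub_self] at h2
      exact (sub_eq_zero.1 h2.symm)
  refine key N _ ?_
  exact del_pow_word_of_length_lt τ w hN

/-! ### Last letters, and characters determined by few values -/

/-- The words that do not end in the letter `a`. -/
def endsOff (a : α) : Set (List α) := {w | a ∉ w.getLast?}

lemma nil_mem_endsOff (a : α) : [] ∈ endsOff a := by simp [endsOff]

lemma tail_mem_endsOff {a b : α} {u : List α} (h : b :: u ∈ endsOff a) : u ∈ endsOff a := by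
  cases u with
  | nil => exact nil_mem_endsOff a
  | cons c u => simpa [endsOff, List.getLast?_cons_cons] using h

lemma cons_mem_endsOff {a b : α} {u : List α} (hu : u ≠ []) (h : u ∈ endsOff a) :
    b :: u ∈ endsOff a := by
  cases u with
  | nil => exact (hu rfl).elim
  | cons c u => simpa [endsOff, List.getLast?_cons_cons] using h

lemma shuffleWords_mem_endsOff {a : α} {u v : List α} (hu : u ∈ endsOff a) (hv : v ∈ endsOff a) :
    shuffleWords u v ∈ Finsupp.supported ℚ ℚ (endsOff a) := by
  classical
  induction u generalizing v with
  | nil => rw [shuffleWords_nil_left]; exact Finsupp.single_mem_supported _ _ hv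
  | cons b u ihu =>
    induction v with
    | nil => rw [shuffleWords_nil_right]; exact Finsupp.single_mem_supported _ _ hu
    | cons c v ihv =>
      rw [shuffleWords_cons_cons]
      refine Submodule.add_mem _ ?_ ?_
      · refine fun x hx => ?_
        obtain ⟨y, hy, rfl⟩ := Finset.mem_image.1 (Finsupp.mapDomain_support hx)
        have h1 := shuffleWords_mem_length u (c :: v) hy
        -- The empty word lies in `endsOff a` but `[a]` does not, so prepending a letter needs a
        -- nonempty tail; the length count provides it.
        refine cons_mem_endsOff (fun h => ?_) (ihu (tail_mem_endsOff hu) hv hy)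
        simp [h] at h1
      · refine fun x hx => ?_
        obtain ⟨y, hy, rfl⟩ := Finset.mem_image.1 (Finsupp.mapDomain_support hx)
        have h1 := shuffleWords_mem_length (b :: u) v hy
        refine cons_mem_endsOff (fun h => ?_) (ihv (tail_mem_endsOff hv) hy)
        simp [h] at h1
        omega

lemma shL_mem_endsOff {a : α} {x y : WordSpace α} (hx : x ∈ Finsupp.supported ℚ ℚ (endsOff a))
    (hy : y ∈ Finsupp.supported ℚ ℚ (endsOff a)) :
    shL x y ∈ Finsupp.supported ℚ ℚ (endsOff a) := by
  have hx' := hx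
  have hy' := hy
  rw [Finsupp.supported_eq_span_single] at hx' hy'
  refine LinearMap.BilinMap.apply_apply_mem_of_mem_span (Finsupp.supported ℚ ℚ (endsOff a)) _ _
    shL ?_ x y hx' hy'
  rintro _ ⟨u, hu, rfl⟩ _ ⟨v, hv, rfl⟩
  change shL (word u) (word v) ∈ _
  rw [shL_word]
  exact shuffleWords_mem_endsOff hu hv

lemma del_pow_word_mem_endsOff {a τ : α} {w : List α} (hw : w ∈ endsOff a) (n : ℕ) :
    (del τ ^ n) (word w) ∈ Finsupp.supported ℚ ℚ (endsOff a) := by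
  induction n generalizing w with
  | zero => exact Finsupp.single_mem_supported _ _ hw
  | succ n ih =>
    rw [pow_succ, Module.End.mul_apply]
    cases w with
    | nil => rw [del_nil, map_zero]; exact Submodule.zero_mem _
    | cons b w =>
      rcases del_cons τ b w with h' | h' <;> rw [h']
      · rw [map_zero]; exact Submodule.zero_mem _
      · exact ih (tail_mem_endsOff hw)

lemma replicate_mem_endsOff {a τ : α} (h : τ ≠ a) (n : ℕ) :
    List.replicate n τ ∈ endsOff a := by
  intro h'
  exact h (List.eq_of_mem_replicate (List.mem_of_getLast? h')).symm

/-- With `a = 0` this keeps regularized words among those whose hyperlogarithms are analytic at the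
origin. -/
lemma delReg_word_mem_endsOff {a τ : α} (h : τ ≠ a) {w : List α} (hw : w ∈ endsOff a) :
    delReg τ (word w) ∈ Finsupp.supported ℚ ℚ (endsOff a) := by
  rw [delReg_word τ w (Nat.lt_succ_self _)]
  refine Submodule.sum_mem _ fun n _ => Submodule.smul_mem _ _ (shL_mem_endsOff ?_ ?_)
  · exact Finsupp.single_mem_supported _ _ (replicate_mem_endsOff h n)
  · exact del_pow_word_mem_endsOff hw n

/-- Shuffling with the letter `τ`: the number of trailing letters `τ` of the word is raised in a
single term. -/
lemma shL_letter_append_replicate (τ : α) {u : List α} (hu : u ≠ []) (hu' : u ∈ endsOff τ)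
    (n : ℕ) :
    shL (word [τ]) (word (u ++ List.replicate n τ)) -
        ((n : ℚ) + 1) • word (u ++ List.replicate (n + 1) τ) ∈
      Finsupp.supported ℚ ℚ {w | ∃ v, v ≠ [] ∧ v ∈ endsOff τ ∧ w = v ++ List.replicate n τ} := by
  induction u with
  | nil => exact (hu rfl).elim
  | cons b u ih =>
    have hstep : shL (word [τ]) (word (b :: u ++ List.replicate n τ)) =
        word (τ :: b :: (u ++ List.replicate n τ)) +
          (shL (word [τ]) (word (u ++ List.replicate n τ))).mapDomain (b :: ·) := by
      rw [shL_word, shL_word, List.cons_append, shuffleWords_cons_cons, shuffleWords_nil_left,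
        Finsupp.mapDomain_single]
    have h1 : word (τ :: b :: (u ++ List.replicate n τ)) ∈
        Finsupp.supported ℚ ℚ {w | ∃ v, v ≠ [] ∧ v ∈ endsOff τ ∧ w = v ++ List.replicate n τ} :=
      Finsupp.single_mem_supported _ _
        ⟨τ :: b :: u, by simp, cons_mem_endsOff (by simp) hu', by simp⟩
    rw [hstep, add_sub_assoc]
    refine Submodule.add_mem _ h1 ?_
    by_cases hnil : u = []
    · subst hnil
      have h2 := shL_rep_rep τ 1 n
      rw [show rep τ 1 = word [τ] from rfl] at h2
      rw [List.nil_append, h2, Finsupp.mapDomain_smul, Finsupp.mapDomain_single,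
        Nat.choose_one_right, add_comm 1 n]
      simp
    · have h3 := ih hnil (tail_mem_endsOff hu')
      have h4 : (shL (word [τ]) (word (u ++ List.replicate n τ))).mapDomain (b :: ·) -
          ((n : ℚ) + 1) • word (b :: u ++ List.replicate (n + 1) τ) =
          (shL (word [τ]) (word (u ++ List.replicate n τ)) -
            ((n : ℚ) + 1) • word (u ++ List.replicate (n + 1) τ)).mapDomain (b :: ·) := by
        have := (Finsupp.lmapDomain ℚ ℚ (b :: · : List α → List α)).map_sub
          (shL (word [τ]) (word (u ++ List.replicate n τ)))
          (((n : ℚ) + 1) • word (u ++ List.replicate (n + 1) τ))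
        simp only [Finsupp.lmapDomain_apply, Finsupp.mapDomain_smul, word,
          Finsupp.mapDomain_single] at this
        rw [this]; simp
      rw [h4]
      classical
      intro x hx
      obtain ⟨y, hy, rfl⟩ := Finset.mem_image.1 (Finsupp.mapDomain_support hx)
      obtain ⟨v, hvn, hv, rfl⟩ := h3 hy
      exact ⟨b :: v, by simp, cons_mem_endsOff hvn hv, by simp⟩

lemma exists_eq_append_replicate (τ : α) (w : List α) :
    ∃ v ∈ endsOff τ, ∃ n, w = v ++ List.replicate n τ := by
  classical
  induction w using List.reverseRecOn with
  | nil => exact ⟨[], nil_mem_endsOff τ, 0, by simp⟩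
  | append_singleton w b ih =>
    by_cases h : b = τ
    · obtain ⟨v, hv, n, rfl⟩ := ih
      exact ⟨v, hv, n + 1, by rw [h, List.replicate_succ', List.append_assoc]⟩
    · exact ⟨w ++ [b], by simpa [endsOff] using h, 0, by simp⟩

/-- A shuffle character is determined by its values on the letter `τ` and on the words that do not
end in `τ`. -/
lemma character_ext {τ : α} {I J : WordSpace α →ₗ[ℚ] ℂ}
    (hI : ∀ u v, I (shuffleWords u v) = I (word u) * I (word v))
    (hJ : ∀ u v, J (shuffleWords u v) = J (word u) * J (word v))
    (h : ∀ w ∈ endsOff τ, I (word w) = J (word w)) (hτ : I (word [τ]) = J (word [τ])) :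
    I = J := by
  -- Induction on the number of trailing `τ`: multiplying by the letter `τ` expresses `n + 1` times
  -- a word with `n + 1` trailing `τ` through that product and words with only `n` of them.
  have key : ∀ n : ℕ, ∀ v ∈ endsOff τ, I (word (v ++ List.replicate n τ)) =
      J (word (v ++ List.replicate n τ)) := by
    intro n
    induction n with
    | zero => intro v hv; simpa using h v hv
    | succ n ih =>
      intro v hv
      have hn : ((n : ℚ) + 1) ≠ 0 := by positivity
      suffices hs : I (((n : ℚ) + 1) • word (v ++ List.replicate (n + 1) τ)) =
          J (((n : ℚ) + 1) • word (v ++ List.replicate (n + 1) τ)) by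
        rw [map_smul, map_smul] at hs
        exact smul_right_injective ℂ hn hs
      have hprod : I (shL (word [τ]) (word (v ++ List.replicate n τ))) =
          J (shL (word [τ]) (word (v ++ List.replicate n τ))) := by
        rw [shL_word, hI, hJ, hτ, ih v hv]
      by_cases hvn : v = []
      · subst hvn
        have h2 := shL_rep_rep τ 1 n
        rw [show rep τ 1 = word [τ] from rfl, Nat.choose_one_right, add_comm 1 n] at h2
        rw [List.nil_append, h2] at hprod
        simpa using hprod
      · have h3 := eq_of_mem_supported (f := I) (g := J)
          (by rintro _ ⟨v', -, hv', rfl⟩; exact ih v' hv')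
          (shL_letter_append_replicate τ hvn hv n)
        rw [map_sub, map_sub, hprod] at h3
        exact sub_right_injective h3
  refine wordSpace_hom_ext fun w => ?_
  obtain ⟨v, hv, n, rfl⟩ := exists_eq_append_replicate τ w
  exact key n v hv

end Algebra

/-! ### Analytic continuation along paths, primitives and monodromy -/

section Continuation

/-- The function elements `F t`, `t ∈ X`, are analytic at `γ t` and locally compatible. -/
structure ContOn (γ : ℝ → ℂ) (F : ℝ → ℂ → ℂ) (X : Set ℝ) : Prop where
  analytic : ∀ t ∈ X, AnalyticAt ℂ (F t) (γ t)
  compatible : ∀ t ∈ X, ∀ᶠ s in 𝓝[X] t, F s =ᶠ[𝓝 (γ s)] F t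

lemma exists_ball_analyticOnNhd {f : ℂ → ℂ} {c : ℂ} (h : AnalyticAt ℂ f c) :
    ∃ r > 0, AnalyticOnNhd ℂ f (Metric.ball c r) := by
  obtain ⟨r, hr, h'⟩ := Metric.eventually_nhds_iff_ball.1 h.eventually_analyticAt
  exact ⟨r, hr, fun p hp => h' p hp⟩

lemma eventuallyEq_of_analyticOnNhd {f g : ℂ → ℂ} {U : Set ℂ} (hU : IsOpen U)
    (hc : IsPreconnected U) (hf : AnalyticOnNhd ℂ f U) (hg : AnalyticOnNhd ℂ g U) {p q : ℂ}
    (hp : p ∈ U) (hq : q ∈ U) (h : f =ᶠ[𝓝 p] g) : f =ᶠ[𝓝 q] g :=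
  (hf.eqOn_of_preconnected_of_eventuallyEq hg hc hp h).eventuallyEq_of_mem (hU.mem_nhds hq)

variable {γ : ℝ → ℂ} {F G : ℝ → ℂ → ℂ} {X : Set ℝ}

lemma tendsto_eventuallyEq {f g : ℂ → ℂ} {t : ℝ} (hγ : ContinuousWithinAt γ X t)
    (h : f =ᶠ[𝓝 (γ t)] g) : ∀ᶠ s in 𝓝[X] t, f =ᶠ[𝓝 (γ s)] g :=
  hγ.eventually h.eventuallyEq_nhds

lemma ContOn.mono {Y : Set ℝ} (h : ContOn γ F Y) (hXY : X ⊆ Y) : ContOn γ F X :=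
  ⟨fun t ht => h.analytic t (hXY ht),
    fun t ht => (h.compatible t (hXY ht)).filter_mono (nhdsWithin_mono _ hXY)⟩

lemma ContOn.const {f : ℂ → ℂ} (h : ∀ t ∈ X, AnalyticAt ℂ f (γ t)) : ContOn γ (fun _ => f) X :=
  ⟨h, fun _ _ => Eventually.of_forall fun _ => EventuallyEq.rfl⟩

lemma ContOn.congr_path {γ' : ℝ → ℂ} (h : ContOn γ F X) (h' : ∀ t ∈ X, γ' t = γ t) :
    ContOn γ' F X := by
  refine ⟨fun t ht => by rw [h' t ht]; exact h.analytic t ht, fun t ht => ?_⟩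
  filter_upwards [h.compatible t ht, self_mem_nhdsWithin] with s hs hsX
  rwa [h' s hsX]

/-- By the identity theorem on a small disc about `γ t`, agreement of the two germs at `t` is
equivalent to agreement at all nearby parameters; connectedness of `X` does the rest. -/
lemma ContOn.unique (hX : IsPreconnected X) (hγ : ContinuousOn γ X) (hF : ContOn γ F X)
    (hG : ContOn γ G X) {t₀ : ℝ} (ht₀ : t₀ ∈ X) (h : F t₀ =ᶠ[𝓝 (γ t₀)] G t₀) {t : ℝ}
    (ht : t ∈ X) : F t =ᶠ[𝓝 (γ t)] G t := by
  refine hX.induction₂' (fun s t => F s =ᶠ[𝓝 (γ s)] G s → F t =ᶠ[𝓝 (γ t)] G t) (fun t ht => ?_)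
    (fun _ _ _ _ _ _ h1 h2 h => h2 (h1 h)) ht₀ ht h
  obtain ⟨r₁, hr₁, h₁⟩ := exists_ball_analyticOnNhd (hF.analytic t ht)
  obtain ⟨r₂, hr₂, h₂⟩ := exists_ball_analyticOnNhd (hG.analytic t ht)
  set r := min r₁ r₂
  have hr : 0 < r := lt_min hr₁ hr₂
  have h₁' : AnalyticOnNhd ℂ (F t) (Metric.ball (γ t) r) :=
    h₁.mono (Metric.ball_subset_ball (min_le_left _ _))
  have h₂' : AnalyticOnNhd ℂ (G t) (Metric.ball (γ t) r) :=
    h₂.mono (Metric.ball_subset_ball (min_le_right _ _))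
  have hmem : ∀ᶠ s in 𝓝[X] t, γ s ∈ Metric.ball (γ t) r :=
    (hγ t ht) (Metric.ball_mem_nhds _ hr)
  have hpc : IsPreconnected (Metric.ball (γ t) r) := (convex_ball _ _).isPreconnected
  filter_upwards [hF.compatible t ht, hG.compatible t ht, hmem] with s hFs hGs hs
  constructor
  · intro h
    have := eventuallyEq_of_analyticOnNhd Metric.isOpen_ball hpc h₁' h₂'
      (Metric.mem_ball_self hr) hs h
    exact (hFs.trans this).trans hGs.symm
  · intro h
    exact eventuallyEq_of_analyticOnNhd Metric.isOpen_ball hpc h₁' h₂' hs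
      (Metric.mem_ball_self hr) ((hFs.symm.trans h).trans hGs)

lemma ContOn.glue {a b c : ℝ} (hab : a ≤ b) (hbc : b ≤ c) (hγ : ContinuousOn γ (Icc a c))
    (hF : ContOn γ F (Icc a b)) (hG : ContOn γ G (Icc b c)) (h : F b =ᶠ[𝓝 (γ b)] G b) :
    ContOn γ (fun t => if t ≤ b then F t else G t) (Icc a c) := by
  constructor
  · intro t ht
    by_cases htb : t ≤ b
    · simpa only [htb, if_true] using hF.analytic t ⟨ht.1, htb⟩
    · simpa only [htb, if_false] using hG.analytic t ⟨(not_le.1 htb).le, ht.2⟩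
  · intro t ht
    rcases lt_trichotomy t b with htb | rfl | htb
    · have h1 : ∀ᶠ s in 𝓝[Icc a c] t, s < b :=
        (eventually_lt_nhds htb).filter_mono nhdsWithin_le_nhds
      have h2 := hF.compatible t ⟨ht.1, htb.le⟩
      rw [eventually_nhdsWithin_iff] at h2 h1 ⊢
      filter_upwards [h1, h2] with s hs1 hs2 hs
      simpa only [(hs1 hs).le, htb.le, if_true] using hs2 ⟨hs.1, (hs1 hs).le⟩
    · have h1 := hF.compatible t ⟨hab, le_rfl⟩
      have h2 := hG.compatible t ⟨le_rfl, hbc⟩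
      have h3 := tendsto_eventuallyEq (hγ t ht) h
      rw [eventually_nhdsWithin_iff] at h1 h2 h3 ⊢
      filter_upwards [h1, h2, h3] with s hs1 hs2 hs3 hs
      by_cases hst : s ≤ t
      · simpa only [hst, le_rfl, if_true] using hs1 ⟨hs.1, hst⟩
      · simpa only [hst, le_rfl, if_true, if_false] using
          (hs2 ⟨(not_le.1 hst).le, hs.2⟩).trans (hs3 hs).symm
    · have h1 : ∀ᶠ s in 𝓝[Icc a c] t, b < s :=
        (eventually_gt_nhds htb).filter_mono nhdsWithin_le_nhds
      have h2 := hG.compatible t ⟨htb.le, ht.2⟩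
      rw [eventually_nhdsWithin_iff] at h2 h1 ⊢
      filter_upwards [h1, h2] with s hs1 hs2 hs
      simpa only [not_le.2 (hs1 hs), not_le.2 htb, if_false] using hs2 ⟨(hs1 hs).le, hs.2⟩

lemma ContOn.comp {φ : ℝ → ℝ} {Y : Set ℝ} (h : ContOn γ F Y) (hφ : ContinuousOn φ X)
    (hm : MapsTo φ X Y) : ContOn (γ ∘ φ) (F ∘ φ) X :=
  ⟨fun _ ht => h.analytic _ (hm ht), fun _ ht =>
    (hφ.continuousWithinAt ht).tendsto_nhdsWithin hm |>.eventually (h.compatible _ (hm ht))⟩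

lemma ContOn.mul (hF : ContOn γ F X) (hG : ContOn γ G X) :
    ContOn γ (fun t p => F t p * G t p) X :=
  ⟨fun t ht => (hF.analytic t ht).mul (hG.analytic t ht), fun t ht => by
    filter_upwards [hF.compatible t ht, hG.compatible t ht] with s h1 h2 using h1.mul h2⟩

lemma ContOn.sum {ι : Type*} (s : Finset ι) {F : ι → ℝ → ℂ → ℂ}
    (h : ∀ i ∈ s, ContOn γ (F i) X) : ContOn γ (fun t p => ∑ i ∈ s, F i t p) X :=
  ⟨fun t ht => Finset.analyticAt_fun_sum _ fun i hi => (h i hi).analytic t ht, fun t ht => by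
    have : ∀ᶠ r in 𝓝[X] t, ∀ i ∈ s, F i r =ᶠ[𝓝 (γ r)] F i t :=
      (Finset.eventually_all s).2 fun i hi => (h i hi).compatible t ht
    filter_upwards [this] with r hr
    have := (Finset.eventually_all s).2 hr
    filter_upwards [this] with p hp using Finset.sum_congr rfl hp⟩

lemma ContOn.const_mul (c : ℂ) (hF : ContOn γ F X) : ContOn γ (fun t p => c * F t p) X :=
  (ContOn.const fun _ _ => analyticAt_const (v := c)).mul hF

lemma ContOn.deriv (hF : ContOn γ F X) : ContOn γ (fun t => deriv (F t)) X :=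
  ⟨fun t ht => (hF.analytic t ht).deriv, fun t ht => by
    filter_upwards [hF.compatible t ht] with s h1 using h1.deriv⟩

lemma ContOn.continuousOn_apply (hγ : ContinuousOn γ X) (hF : ContOn γ F X) :
    ContinuousOn (fun t => F t (γ t)) X := by
  intro t ht
  have h1 : ContinuousWithinAt (fun s => F t (γ s)) X t :=
    (hF.analytic t ht).continuousAt.comp_continuousWithinAt (hγ t ht)
  refine h1.congr_of_eventuallyEq ?_ rfl
  filter_upwards [hF.compatible t ht] with s hs using hs.eq_of_nhds

lemma exists_eventuallyEq_add_const {f g : ℂ → ℂ} {c : ℂ} (hf : AnalyticAt ℂ f c)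
    (hg : AnalyticAt ℂ g c) (h : deriv f =ᶠ[𝓝 c] deriv g) :
    ∃ k : ℂ, f =ᶠ[𝓝 c] fun p => g p + k := by
  obtain ⟨r, hr, h'⟩ := Metric.eventually_nhds_iff_ball.1
    ((hf.eventually_analyticAt.and hg.eventually_analyticAt).and h)
  obtain ⟨k, hk⟩ := Metric.isOpen_ball.exists_eq_add_of_deriv_eq (𝕜 := ℂ)
    (convex_ball c r).isPreconnected
    (fun p hp => ((h' p hp).1.1).differentiableAt.differentiableWithinAt)
    (fun p hp => ((h' p hp).1.2).differentiableAt.differentiableWithinAt)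
    (fun p hp => (h' p hp).2)
  exact ⟨k, hk.eventuallyEq_of_mem (Metric.ball_mem_nhds _ hr)⟩

lemma exists_uniform_nhds {a b T : ℝ} {p : ℝ → Prop} (h : ∀ᶠ s in 𝓝[Icc a b] T, p s) :
    ∃ η > 0, ∀ s ∈ Ioo (T - η) (T + η), s ∈ Icc a b → p s := by
  obtain ⟨η, hη, h'⟩ := Metric.mem_nhdsWithin_iff.1 h
  exact ⟨η, hη, fun s hs hs' => h' ⟨by rwa [Real.ball_eq_Ioo], hs'⟩⟩

/-- Induction along an interval, for a property that is inherited by smaller parameters. -/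
lemma interval_extension {a b : ℝ} (hab : a ≤ b) (C : ℝ → Prop) (ha : C a)
    (hmono : ∀ s t, a ≤ s → s ≤ t → t ≤ b → C t → C s)
    (hext : ∀ T ∈ Icc a b, ∃ η > 0, ∀ s t, s ∈ Ioo (T - η) (T + η) → t ∈ Ioo (T - η) (T + η) →
      a ≤ s → s ≤ t → t ≤ b → C s → C t) : C b := by
  refine (isPreconnected_Icc (a := a) (b := b)).induction₂' (fun s t => C s → C t)
    (fun T hT => ?_) (fun _ _ _ _ _ _ h1 h2 h => h2 (h1 h)) ⟨le_rfl, hab⟩ ⟨hab, le_rfl⟩ ha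
  obtain ⟨η, hη, h⟩ := hext T hT
  have hn : ∀ᶠ s in 𝓝[Icc a b] T, s ∈ Ioo (T - η) (T + η) :=
    mem_nhdsWithin_of_mem_nhds (Ioo_mem_nhds (by linarith) (by linarith))
  have hTm : T ∈ Ioo (T - η) (T + η) := ⟨by linarith, by linarith⟩
  filter_upwards [hn, self_mem_nhdsWithin] with s hs hs'
  rcases le_total s T with hsT | hsT
  · exact ⟨hmono s T hs'.1 hsT hT.2, h s T hs hTm hs'.1 hsT hT.2⟩
  · exact ⟨h T s hTm hs hT.1 hsT hs'.2, hmono T s hT.1 hsT hs'.2⟩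

/-- Along a path, a compatible family of function elements has a compatible family of
primitives. -/
lemma ContOn.exists_primitive {a b : ℝ} (hab : a ≤ b) (hγ : ContinuousOn γ (Icc a b))
    (hG : ContOn γ G (Icc a b)) {f : ℂ → ℂ} (hf : AnalyticAt ℂ f (γ a))
    (hfG : _root_.deriv f =ᶠ[𝓝 (γ a)] G a) :
    ∃ F : ℝ → ℂ → ℂ, F a = f ∧ ContOn γ F (Icc a b) ∧
      ∀ t ∈ Icc a b, _root_.deriv (F t) =ᶠ[𝓝 (γ t)] G t := by
  refine interval_extension hab (fun T => ∃ F : ℝ → ℂ → ℂ, F a = f ∧ ContOn γ F (Icc a T) ∧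
      ∀ t ∈ Icc a T, _root_.deriv (F t) =ᶠ[𝓝 (γ t)] G t) ?_ ?_ ?_
  · refine ⟨fun _ => f, rfl, ContOn.const fun t ht => ?_, fun t ht => ?_⟩ <;>
      rw [Icc_self, mem_singleton_iff] at ht <;> subst ht
    exacts [hf, hfG]
  · rintro s t _ hst _ ⟨F, h1, h2, h3⟩
    exact ⟨F, h1, h2.mono (Icc_subset_Icc_right hst), fun r hr => h3 r ⟨hr.1, hr.2.trans hst⟩⟩
  · intro T hT
    obtain ⟨r, hr, hr'⟩ := exists_ball_analyticOnNhd (hG.analytic T hT)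
    obtain ⟨P, hP⟩ := hr'.differentiableOn.isExactOn_ball
    have hPan : AnalyticOnNhd ℂ P (Metric.ball (γ T) r) :=
      DifferentiableOn.analyticOnNhd (fun p hp => (hP p hp).differentiableAt.differentiableWithinAt)
        Metric.isOpen_ball
    have hPd : ∀ p ∈ Metric.ball (γ T) r, _root_.deriv P =ᶠ[𝓝 p] G T := fun p hp =>
      eventuallyEq_of_mem (Metric.isOpen_ball.mem_nhds hp) fun q hq => (hP q hq).deriv
    have hmem : ∀ᶠ s in 𝓝[Icc a b] T, γ s ∈ Metric.ball (γ T) r :=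
      (hγ T hT) (Metric.ball_mem_nhds _ hr)
    obtain ⟨η, hη, hN⟩ := exists_uniform_nhds ((hG.compatible T hT).and hmem)
    refine ⟨η, hη, ?_⟩
    rintro s t hs ht has hst htb ⟨F, h1, h2, h3⟩
    have hsN := hN s hs ⟨has, hst.trans htb⟩
    -- The primitive `P` on the disc is shifted by a constant to match the primitive already found
    -- up to `s`.
    obtain ⟨k, hk⟩ := exists_eventuallyEq_add_const (h2.analytic s ⟨has, le_rfl⟩)
      (hPan _ hsN.2) (((h3 s ⟨has, le_rfl⟩).trans hsN.1).trans (hPd _ hsN.2).symm)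
    have hN' : ∀ q ∈ Icc s t, G q =ᶠ[𝓝 (γ q)] G T ∧ γ q ∈ Metric.ball (γ T) r := fun q hq =>
      hN q ⟨hs.1.trans_le hq.1, hq.2.trans_lt ht.2⟩ ⟨has.trans hq.1, hq.2.trans htb⟩
    refine ⟨fun q => if q ≤ s then F q else fun p => P p + k, by simp [has, h1],
      ContOn.glue has hst (hγ.mono (Icc_subset_Icc_right htb)) h2 (ContOn.const fun q hq =>
        (hPan _ (hN' q hq).2).add analyticAt_const) hk, fun q hq => ?_⟩
    by_cases hqs : q ≤ s
    · simpa only [hqs, if_true] using h3 q ⟨hq.1, hqs⟩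
    · have hq' := hN' q ⟨(not_le.1 hqs).le, hq.2⟩
      simp only [hqs, if_false]
      have : _root_.deriv (fun p => P p + k) = _root_.deriv P := by
        ext p; exact deriv_add_const k
      rw [this]
      exact (hPd _ hq'.2).trans hq'.1.symm

/-- A compatible family of function elements along a path serves all nearby paths. -/
lemma ContOn.exists_stable {a b : ℝ} (hab : a ≤ b) (hγ : ContinuousOn γ (Icc a b))
    (hF : ContOn γ F (Icc a b)) :
    ∃ r > 0, ∃ F' : ℝ → ℂ → ℂ, F' a = F a ∧ ∀ β : ℝ → ℂ, ContinuousOn β (Icc a b) →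
      (∀ t ∈ Icc a b, dist (β t) (γ t) < r) → ContOn β F' (Icc a b) := by
  refine interval_extension hab (fun T => ∃ r > 0, ∃ F' : ℝ → ℂ → ℂ, F' a = F a ∧
    ∀ β : ℝ → ℂ, ContinuousOn β (Icc a T) →
      (∀ t ∈ Icc a T, dist (β t) (γ t) < r) → ContOn β F' (Icc a T)) ?_ ?_ ?_
  · obtain ⟨r, hr, hr'⟩ := exists_ball_analyticOnNhd (hF.analytic a ⟨le_rfl, hab⟩)
    refine ⟨r, hr, fun _ => F a, rfl, fun β _ hβ => ContOn.const fun t ht => ?_⟩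
    have h := hβ t ht
    rw [Icc_self, mem_singleton_iff] at ht
    subst ht
    exact hr' _ h
  · rintro s t has hst _ ⟨r, hr, F', h1, h2⟩
    refine ⟨r, hr, F', h1, fun β hβ hβ' => ?_⟩
    -- Beyond `s` the path `β` is prolonged parallel to `γ`, so its distance from `γ` stays the same
    -- and the hypothesis on the longer interval applies.
    have hext : ContinuousOn (fun q => β (min q s) + (γ q - γ (min q s))) (Icc a t) := by
      have hm : ContinuousOn (fun q : ℝ => min q s) (Icc a t) := by fun_prop
      have hm1 : MapsTo (fun q : ℝ => min q s) (Icc a t) (Icc a s) := fun q hq =>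
        ⟨le_min hq.1 has, min_le_right _ _⟩
      have hγt : ContinuousOn γ (Icc a t) := hγ.mono (Icc_subset_Icc_right ‹t ≤ b›)
      have hm2 : MapsTo (fun q : ℝ => min q s) (Icc a t) (Icc a t) := fun q hq =>
        ⟨le_min hq.1 has, (min_le_left _ _).trans hq.2⟩
      exact (hβ.comp hm hm1).add (hγt.sub (hγt.comp hm hm2))
    have h3 := h2 _ hext fun q hq => by
      have := hβ' (min q s) ⟨le_min hq.1 has, min_le_right _ _⟩
      rw [dist_eq_norm] at this ⊢
      convert this using 2; ring
    refine (h3.mono (Icc_subset_Icc_right hst)).congr_path fun q hq => ?_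
    simp [min_eq_left hq.2]
  · intro T hT
    obtain ⟨r, hr, hr'⟩ := exists_ball_analyticOnNhd (hF.analytic T hT)
    have hmem : ∀ᶠ s in 𝓝[Icc a b] T, γ s ∈ Metric.ball (γ T) (r / 2) :=
      (hγ T hT) (Metric.ball_mem_nhds _ (half_pos hr))
    obtain ⟨η, hη, hN⟩ := exists_uniform_nhds ((hF.compatible T hT).and hmem)
    refine ⟨η, hη, ?_⟩
    rintro s t hs ht has hst htb ⟨r₁, hr₁, F', h1, h2⟩
    have hγs : ContinuousOn γ (Icc a s) := hγ.mono (Icc_subset_Icc_right (hst.trans htb))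
    have h3 : F' s =ᶠ[𝓝 (γ s)] F s :=
      ContOn.unique isPreconnected_Icc hγs (h2 γ hγs fun q _ => by simpa using hr₁)
        (hF.mono (Icc_subset_Icc_right (hst.trans htb))) (t₀ := a) ⟨le_rfl, has⟩ (by rw [h1])
        ⟨has, le_rfl⟩
    obtain ⟨r₂, hr₂, h4⟩ := Metric.eventually_nhds_iff_ball.1
      (h3.trans (hN s hs ⟨has, hst.trans htb⟩).1)
    -- `r₁` serves the part before `s`, `r₂` makes the two elements agree at `β s`, and `r / 2`
    -- keeps `β` in the disc of analyticity of `F T`.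
    refine ⟨min r₁ (min r₂ (r / 2)), by positivity, fun q => if q ≤ s then F' q else F T,
      by simp [has, h1], fun β hβ hβ' => ?_⟩
    refine ContOn.glue has hst hβ (h2 β (hβ.mono (Icc_subset_Icc_right hst)) fun q hq =>
      (hβ' q ⟨hq.1, hq.2.trans hst⟩).trans_le (min_le_left _ _)) (ContOn.const fun q hq => ?_) ?_
    · refine hr' _ ?_
      have e1 := (hβ' q ⟨has.trans hq.1, hq.2⟩).trans_le
        ((min_le_right _ _).trans (min_le_right _ _))
      have e2 := (hN q ⟨hs.1.trans_le hq.1, hq.2.trans_lt ht.2⟩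
        ⟨has.trans hq.1, hq.2.trans htb⟩).2
      rw [Metric.mem_ball] at e2 ⊢
      linarith [dist_triangle (β q) (γ q) (γ T)]
    · have e1 := (hβ' s ⟨has, hst⟩).trans_le ((min_le_right _ _).trans (min_le_left _ _))
      exact eventuallyEq_of_mem (Metric.isOpen_ball.mem_nhds e1) h4

/-- Monodromy: the continuations of a germ along the paths of a homotopy with fixed end points have
the same final germ. -/
lemma monodromy {H : ℝ × ℝ → ℂ} (hH : ContinuousOn H (Icc 0 1 ×ˢ Icc 0 1)) {a z : ℂ}
    (ha : ∀ s ∈ Icc (0 : ℝ) 1, H (s, 0) = a) (hz : ∀ s ∈ Icc (0 : ℝ) 1, H (s, 1) = z) {f : ℂ → ℂ}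
    {Φ : ℝ → ℝ → ℂ → ℂ}
    (hΦ : ∀ s ∈ Icc (0 : ℝ) 1, ContOn (fun t => H (s, t)) (Φ s) (Icc 0 1))
    (hΦ0 : ∀ s ∈ Icc (0 : ℝ) 1, Φ s 0 =ᶠ[𝓝 a] f) : Φ 0 1 =ᶠ[𝓝 z] Φ 1 1 := by
  have h0 : (0 : ℝ) ∈ Icc (0 : ℝ) 1 := ⟨le_rfl, zero_le_one⟩
  have h1 : (1 : ℝ) ∈ Icc (0 : ℝ) 1 := ⟨zero_le_one, le_rfl⟩
  refine (isPreconnected_Icc (a := (0 : ℝ)) (b := 1)).induction₂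
    (fun s t => Φ s 1 =ᶠ[𝓝 z] Φ t 1) (fun s hs => ?_) (fun _ _ _ _ _ _ h1 h2 => h1.trans h2)
    (fun _ _ _ _ h => h.symm) h0 h1
  have hcont : ∀ s ∈ Icc (0 : ℝ) 1, ContinuousOn (fun t => H (s, t)) (Icc 0 1) := fun s hs =>
    hH.comp (by fun_prop) fun t ht => ⟨hs, ht⟩
  obtain ⟨r, hr, F', hF'0, hF'⟩ := (hΦ s hs).exists_stable zero_le_one (hcont s hs)
  have huc := (isCompact_Icc.prod isCompact_Icc).uniformContinuousOn_of_continuous hH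
  obtain ⟨η, hη, hη'⟩ := Metric.uniformContinuousOn_iff.1 huc r hr
  -- One family `F'` continues the germ along all neighbouring paths of the homotopy, so the final
  -- germ is locally constant in the homotopy parameter.
  have hfin : ∀ s' ∈ Icc (0 : ℝ) 1, dist s' s < η → F' 1 =ᶠ[𝓝 z] Φ s' 1 := by
    intro s' hs' hd
    have h2 : ContOn (fun t => H (s', t)) F' (Icc 0 1) := hF' _ (hcont s' hs') fun t ht =>
      hη' _ ⟨hs', ht⟩ _ ⟨hs, ht⟩ (by simpa [Prod.dist_eq, hη] using hd)
    have h3 := ContOn.unique isPreconnected_Icc (hcont s' hs') h2 (hΦ s' hs') h0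
      (by simp only [ha s' hs', hF'0]; exact (hΦ0 s hs).trans (hΦ0 s' hs').symm) h1
    simpa only [hz s' hs'] using h3
  have hs0 := hfin s hs (by simpa using hη)
  filter_upwards [self_mem_nhdsWithin, mem_nhdsWithin_of_mem_nhds (Metric.ball_mem_nhds s hη)]
    with s' hs' hd
  exact hs0.symm.trans (hfin s' hs' hd)

/-- Continuation of a solution of `f' = g / (p - σ)` along a path that avoids `σ` after its
start. -/
lemma ContOn.exists_solution {a b : ℝ} (hab : a ≤ b) (hγ : ContinuousOn γ (Icc a b)) {σ : ℂ}
    (hσ : ∀ t ∈ Ioc a b, γ t ≠ σ) (hG : ContOn γ G (Icc a b)) {f : ℂ → ℂ}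
    (hf : AnalyticAt ℂ f (γ a))
    (hfG : ∀ᶠ p in 𝓝 (γ a), p ≠ σ → _root_.deriv f p = G a p / (p - σ)) :
    ∃ F : ℝ → ℂ → ℂ, F a = f ∧ ContOn γ F (Icc a b) ∧
      ∀ t ∈ Ioc a b, ∀ᶠ p in 𝓝 (γ t), HasDerivAt (F t) (G t p / (p - σ)) p := by
  -- The path may start at `σ`, where the quotient has a removable singularity; `deriv f` supplies
  -- the analytic element there.
  set D : ℝ → ℂ → ℂ := fun t => if t = a then _root_.deriv f else fun p => G t p / (p - σ) with hD
  have hDa : D a = _root_.deriv f := by simp [hD]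
  have hDt : ∀ t, t ≠ a → D t = fun p => G t p / (p - σ) := fun t ht => by simp [hD, ht]
  have hne : ∀ t ∈ Ioc a b, ∀ᶠ p in 𝓝 (γ t), p ≠ σ := fun t ht =>
    isOpen_ne.eventually_mem (hσ t ht)
  have hDc : ContOn γ D (Icc a b) := by
    constructor
    · intro t ht
      rcases eq_or_ne t a with rfl | hta
      · rw [hDa]; exact hf.deriv
      · rw [hDt t hta]
        exact (hG.analytic t ht).div (analyticAt_id.sub analyticAt_const)
          (sub_ne_zero.2 (hσ t ⟨lt_of_le_of_ne ht.1 hta.symm, ht.2⟩))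
    · intro t ht
      rcases eq_or_ne t a with rfl | hta
      · filter_upwards [hG.compatible t ht, self_mem_nhdsWithin,
          (hγ t ht).eventually hfG.eventually_nhds] with s hs hsX hs'
        rcases eq_or_ne s t with rfl | hst
        · rfl
        · rw [hDa, hDt s hst]
          filter_upwards [hs, hs', hne s ⟨lt_of_le_of_ne hsX.1 hst.symm, hsX.2⟩] with p h1 h2 h3
          rw [h1, h2 h3]
      · have hta' : a < t := lt_of_le_of_ne ht.1 hta.symm
        filter_upwards [hG.compatible t ht,
          mem_nhdsWithin_of_mem_nhds (eventually_gt_nhds hta')] with s hs hs'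
        rw [hDt t hta, hDt s hs'.ne']
        filter_upwards [hs] with p hp
        rw [hp]
  obtain ⟨F, h1, h2, h3⟩ := hDc.exists_primitive hab hγ hf (by rw [hDa])
  refine ⟨F, h1, h2, fun t ht => ?_⟩
  have h4 := h3 t ⟨ht.1.le, ht.2⟩
  rw [hDt t ht.1.ne'] at h4
  filter_upwards [h4, (h2.analytic t ⟨ht.1.le, ht.2⟩).eventually_analyticAt] with p hp hp'
  rw [← hp]
  exact hp'.differentiableAt.hasDerivAt

end Continuation

/-! ### Iterated integrals as values of continuations -/

/-- Iterated integrals along a `C¹` path are the values of continuations of iterated primitives. -/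
lemma iterInt_cons_eq {δ : ℝ → ℂ} (hδ : ContDiffOn ℝ 1 δ (Icc 0 1)) {w : List ℂ} {σ : ℂ}
    {F G : ℝ → ℂ → ℂ} (hF : ContOn δ F (Icc 0 1))
    (hFG : ∀ t ∈ Ioc (0 : ℝ) 1, ∀ᶠ p in 𝓝 (δ t), HasDerivAt (F t) (G t p / (p - σ)) p)
    (hF0 : F 0 (δ 0) = 0) (hG : ∀ t ∈ Icc (0 : ℝ) 1, iterInt δ w t = G t (δ t)) :
    ∀ t ∈ Icc (0 : ℝ) 1, iterInt δ (σ :: w) t = F t (δ t) := by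
  intro t ht
  have hδc := hδ.continuousOn
  rw [iterInt]
  have hder : ∀ s ∈ Ioo (0 : ℝ) 1, HasDerivAt δ (derivWithin δ (Icc 0 1) s) s := fun s hs => by
    have h1 := ((hδ.differentiableOn one_ne_zero) s (Ioo_subset_Icc_self hs)).hasDerivWithinAt
    exact h1.hasDerivAt (Icc_mem_nhds hs.1 hs.2)
  have hFc := hF.continuousOn_apply hδc
  have hdF := hF.deriv.continuousOn_apply hδc
  -- Written with `deriv (F s)` and `derivWithin`, the integrand is continuous up to both ends, even
  -- if `δ 0 = σ`. It agrees with the defining one on the open interval, which is enough.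
  have hinteg : ContinuousOn (fun s => derivWithin δ (Icc 0 1) s * deriv (F s) (δ s))
      (Icc 0 1) :=
    (hδ.continuousOn_derivWithin (uniqueDiffOn_Icc zero_lt_one) le_rfl).mul hdF
  have hsub : Icc 0 t ⊆ Icc (0 : ℝ) 1 := Icc_subset_Icc_right ht.2
  have key : ∫ s in (0 : ℝ)..t, derivWithin δ (Icc 0 1) s * deriv (F s) (δ s) =
      F t (δ t) - F 0 (δ 0) := by
    refine intervalIntegral.integral_eq_sub_of_hasDerivAt_of_le (f := fun s => F s (δ s)) ht.1
      (hFc.mono hsub) (fun s hs => ?_) ?_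
    · have hs1 : s ∈ Ioo (0 : ℝ) 1 := ⟨hs.1, hs.2.trans_le ht.2⟩
      have h1 := (hF.analytic s (Ioo_subset_Icc_self hs1)).differentiableAt.hasDerivAt
      have h2 := h1.comp_of_eq s (hder s hs1) rfl
      rw [mul_comm]
      refine h2.congr_of_eventuallyEq ?_
      have h3 := hF.compatible s (Ioo_subset_Icc_self hs1)
      rw [nhdsWithin_eq_nhds.2 (Icc_mem_nhds hs1.1 hs1.2)] at h3
      filter_upwards [h3] with r hr using hr.eq_of_nhds
    · exact (hinteg.mono (by rw [uIcc_of_le ht.1]; exact hsub)).intervalIntegrable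
  rw [hF0, sub_zero] at key
  rw [← key]
  refine intervalIntegral.integral_congr_ae ?_
  have hne : ∀ᵐ s : ℝ, s ≠ 1 := MeasureTheory.Measure.ae_ne _ 1
  filter_upwards [hne] with s hs1 hs
  rw [uIoc_of_le ht.1] at hs
  have hs' : s ∈ Ioo (0 : ℝ) 1 := ⟨hs.1, lt_of_le_of_ne (hs.2.trans ht.2) hs1⟩
  rw [hG s (Ioo_subset_Icc_self hs'), (hder s hs').deriv,
    (hFG s (Ioo_subset_Ioc_self hs')).self_of_nhds.deriv]
  ring

/-! ### Polynomials in a logarithm and their primitives -/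

section LogPoly

/-- Polynomials of degree at most `n` in the function `K`, with coefficients that are analytic on
the disc of radius `r` about `c`. -/
def IsLogPoly (c : ℂ) (r : ℝ) (K : ℂ → ℂ) (n : ℕ) (f : ℂ → ℂ) : Prop :=
  ∃ e : ℕ → ℂ → ℂ, (∀ j, AnalyticOnNhd ℂ (e j) (Metric.ball c r)) ∧
    f = fun p => ∑ j ∈ Finset.range (n + 1), K p ^ j * e j p

/-- Polynomials in `K` all of whose coefficients vanish at `c`. -/
def IsSmallLogPoly (c : ℂ) (r : ℝ) (K : ℂ → ℂ) (n : ℕ) (f : ℂ → ℂ) : Prop :=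
  ∃ g, IsLogPoly c r K n g ∧ f = fun p => (p - c) * g p

variable {c : ℂ} {r : ℝ} {K : ℂ → ℂ} {Ω : Set ℂ} {m n : ℕ} {f g : ℂ → ℂ}

lemma IsLogPoly.add (hf : IsLogPoly c r K n f) (hg : IsLogPoly c r K n g) :
    IsLogPoly c r K n (fun p => f p + g p) := by
  obtain ⟨e, he, rfl⟩ := hf
  obtain ⟨e', he', rfl⟩ := hg
  refine ⟨fun j p => e j p + e' j p, fun j => (he j).add (he' j), ?_⟩
  ext p
  rw [← Finset.sum_add_distrib]
  exact Finset.sum_congr rfl fun j _ => by ring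

lemma IsLogPoly.mul_analytic {b : ℂ → ℂ} (hf : IsLogPoly c r K n f)
    (hb : AnalyticOnNhd ℂ b (Metric.ball c r)) : IsLogPoly c r K n (fun p => f p * b p) := by
  obtain ⟨e, he, rfl⟩ := hf
  refine ⟨fun j p => e j p * b p, fun j => (he j).mul hb, ?_⟩
  ext p
  rw [Finset.sum_mul]
  exact Finset.sum_congr rfl fun j _ => by ring

lemma isLogPoly_pow_mul {b : ℂ → ℂ} (hb : AnalyticOnNhd ℂ b (Metric.ball c r)) {j : ℕ}
    (hj : j ≤ n) : IsLogPoly c r K n (fun p => K p ^ j * b p) := by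
  classical
  refine ⟨fun i => if i = j then b else fun _ => 0, fun i => ?_, ?_⟩
  · by_cases h : i = j
    · simpa [h] using hb
    · simpa [h] using analyticOnNhd_const
  · ext p
    rw [Finset.sum_eq_single j]
    · simp
    · intro i _ hi; simp [hi]
    · intro h; simp at h; omega

lemma IsLogPoly.mono (hf : IsLogPoly c r K n f) (h : n ≤ m) : IsLogPoly c r K m f := by
  classical
  obtain ⟨e, he, rfl⟩ := hf
  refine ⟨fun i => if i ≤ n then e i else fun _ => 0, fun i => ?_, ?_⟩
  · by_cases h : i ≤ n
    · simpa [h] using he i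
    · simpa [h] using analyticOnNhd_const
  · ext p
    refine Finset.sum_subset_zero_on_sdiff (fun i hi => by simp at hi ⊢; omega)
      (fun i hi => ?_) (fun i hi => ?_)
    · simp only [Finset.mem_sdiff, Finset.mem_range, not_lt] at hi
      have : ¬ i ≤ n := by omega
      simp [this]
    · simp only [Finset.mem_range] at hi
      have : i ≤ n := by omega
      simp [this]

lemma isLogPoly_sum {s : Finset ℕ} {f : ℕ → ℂ → ℂ} (h : ∀ j ∈ s, IsLogPoly c r K n (f j)) :
    IsLogPoly c r K n (fun p => ∑ j ∈ s, f j p) := by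
  classical
  induction s using Finset.induction_on with
  | empty =>
    simpa using isLogPoly_pow_mul (K := K) (b := fun _ => 0) (c := c) (r := r)
      analyticOnNhd_const (Nat.zero_le n)
  | insert a s ha ih =>
    simp only [Finset.sum_insert ha]
    exact (h a (by simp)).add (ih fun j hj => h j (by simp [hj]))

lemma IsSmallLogPoly.isLogPoly (hf : IsSmallLogPoly c r K n f) : IsLogPoly c r K n f := by
  obtain ⟨g, hg, rfl⟩ := hf
  simpa only [mul_comm] using hg.mul_analytic (b := fun p => p - c)
    (analyticOnNhd_id.sub analyticOnNhd_const)

lemma analyticOnNhd_dslope {b : ℂ → ℂ} {U : Set ℂ} (hU : IsOpen U) (hc : c ∈ U)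
    (hb : AnalyticOnNhd ℂ b U) : AnalyticOnNhd ℂ (dslope b c) U :=
  ((Complex.differentiableOn_dslope (hU.mem_nhds hc)).2 hb.differentiableOn).analyticOnNhd hU

lemma exists_primitive_vanishing (hr : 0 < r) {b : ℂ → ℂ}
    (hb : AnalyticOnNhd ℂ b (Metric.ball c r)) :
    ∃ e, AnalyticOnNhd ℂ e (Metric.ball c r) ∧
      ∀ p ∈ Metric.ball c r, HasDerivAt (fun p => (p - c) * e p) (b p) p := by
  obtain ⟨P, hP0, hP⟩ := (hb.differentiableOn.isExactOn_ball).with_val_at c 0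
  have hPan : AnalyticOnNhd ℂ P (Metric.ball c r) :=
    DifferentiableOn.analyticOnNhd (fun p hp => (hP p hp).differentiableAt.differentiableWithinAt)
      Metric.isOpen_ball
  refine ⟨dslope P c, analyticOnNhd_dslope Metric.isOpen_ball (Metric.mem_ball_self hr) hPan,
    fun p hp => ?_⟩
  have : (fun p => (p - c) * dslope P c p) = P := by
    ext p; simpa [hP0] using sub_smul_dslope P c p
  rw [this]
  exact hP p hp

/-- Integration by parts: if `(p - c) e` is a primitive of `b`, the factor `p - c` cancels `K' = 1 /
(p - c)`, leaving a multiple of `K^j e` to be integrated. -/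
lemma exists_primitive_pow_mul (hr : 0 < r) (hcΩ : c ∉ Ω)
    (hK : ∀ p ∈ Ω, HasDerivAt K (1 / (p - c)) p) (j : ℕ) {b : ℂ → ℂ} (hb : AnalyticOnNhd ℂ b (Metric.ball c r)) :
    ∃ f, IsSmallLogPoly c r K j f ∧
      ∀ p ∈ Metric.ball c r ∩ Ω, HasDerivAt f (K p ^ j * b p) p := by
  induction j generalizing b with
  | zero =>
    obtain ⟨e, he, he'⟩ := exists_primitive_vanishing hr hb
    refine ⟨fun p => (p - c) * e p, ⟨e, ?_, rfl⟩, fun p hp => by simpa using he' p hp.1⟩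
    simpa using isLogPoly_pow_mul (K := K) he le_rfl (j := 0)
  | succ j ih =>
    obtain ⟨e, he, he'⟩ := exists_primitive_vanishing hr hb
    obtain ⟨_, ⟨g, hg, rfl⟩, hg'⟩ := ih he
    refine ⟨fun p => (p - c) * (K p ^ (j + 1) * e p + g p * (-((j : ℂ) + 1))), ⟨_,
      (isLogPoly_pow_mul he le_rfl).add
        ((hg.mono (Nat.le_succ j)).mul_analytic analyticOnNhd_const), rfl⟩, fun p hp => ?_⟩
    have hpc : p - c ≠ 0 := sub_ne_zero.2 fun h => hcΩ (h ▸ hp.2)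
    have h1 := (((hK p hp.2).fun_pow (j + 1)).fun_mul (he' p hp.1)).fun_add
      ((hg' p hp).const_mul (-((j : ℂ) + 1)))
    refine (h1.congr_of_eventuallyEq (Eventually.of_forall fun q => by ring)).congr_deriv ?_
    push_cast
    field_simp
    ring

/-- Polynomials in `K` have primitives that vanish at `c`. -/
lemma IsLogPoly.exists_primitive (hf : IsLogPoly c r K n f) (hr : 0 < r) (hcΩ : c ∉ Ω)
    (hK : ∀ p ∈ Ω, HasDerivAt K (1 / (p - c)) p) :
    ∃ F, IsSmallLogPoly c r K n F ∧ ∀ p ∈ Metric.ball c r ∩ Ω, HasDerivAt F (f p) p := by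
  obtain ⟨e, he, rfl⟩ := hf
  choose F hF hF' using fun j => exists_primitive_pow_mul hr hcΩ hK j (he j)
  choose g hg hg' using hF
  refine ⟨fun p => ∑ j ∈ Finset.range (n + 1), F j p, ⟨fun p => ∑ j ∈ Finset.range (n + 1), g j p,
    isLogPoly_sum fun j hj => (hg j).mono (by simp at hj; omega), ?_⟩, fun p hp => ?_⟩
  · ext p
    rw [Finset.mul_sum]
    exact Finset.sum_congr rfl fun j _ => by rw [hg' j]
  · exact HasDerivAt.fun_sum fun j _ => hF' j p hp

/-- Each coefficient is split as its value at `c` plus `p - c` times its difference quotient. The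
constants integrate to the next power of `K`, which is why the degree can rise; the rest has no
pole. -/
lemma IsLogPoly.exists_primitive_div (hf : IsLogPoly c r K n f) (hr : 0 < r) (hcΩ : c ∉ Ω)
    (hK : ∀ p ∈ Ω, HasDerivAt K (1 / (p - c)) p) :
    ∃ F, IsLogPoly c r K (n + 1) F ∧
      ∀ p ∈ Metric.ball c r ∩ Ω, HasDerivAt F (f p / (p - c)) p := by
  obtain ⟨e, he, rfl⟩ := hf
  have hd : IsLogPoly c r K n (fun p => ∑ j ∈ Finset.range (n + 1), K p ^ j * dslope (e j) c p) :=
    ⟨_, fun j => analyticOnNhd_dslope Metric.isOpen_ball (Metric.mem_ball_self hr) (he j), rfl⟩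
  obtain ⟨G, hG, hG'⟩ := hd.exists_primitive hr hcΩ hK
  refine ⟨fun p => (∑ j ∈ Finset.range (n + 1), K p ^ (j + 1) * (e j c / ((j : ℂ) + 1))) + G p,
    IsLogPoly.add (isLogPoly_sum fun j hj => isLogPoly_pow_mul analyticOnNhd_const
      (by simp at hj; omega)) (hG.isLogPoly.mono (Nat.le_succ n)), fun p hp => ?_⟩
  have hpc : p - c ≠ 0 := sub_ne_zero.2 fun h => hcΩ (h ▸ hp.2)
  have h1 := (HasDerivAt.fun_sum (u := Finset.range (n + 1)) fun j _ =>
    ((hK p hp.2).fun_pow (j + 1)).mul_const (e j c / ((j : ℂ) + 1))).fun_add (hG' p hp)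
  refine h1.congr_deriv (Eq.symm ?_)
  rw [Finset.sum_div, ← Finset.sum_add_distrib]
  refine Finset.sum_congr rfl fun j _ => ?_
  have h2 : (p - c) * dslope (e j) c p = e j p - e j c := sub_smul_dslope (e j) c p
  have h3 : e j p = (p - c) * dslope (e j) c p + e j c := by rw [h2]; ring
  have h4 : (j : ℂ) + 1 ≠ 0 := by exact_mod_cast Nat.succ_ne_zero j
  rw [h3]
  push_cast
  field_simp
  ring

/-- Used with `φ = p - c` for limits at the letter and with `φ = sqrtDist` for integrability up to
it. -/
lemma IsLogPoly.tendsto {l : Filter ℂ} {φ : ℂ → ℂ} (hr : 0 < r) (hl : l ≤ 𝓝 c)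
    (hφ : ∀ j, Tendsto (fun p => K p ^ j * φ p) l (𝓝 0)) (hf : IsLogPoly c r K n f) (k : ℕ) :
    Tendsto (fun p => K p ^ k * (φ p * f p)) l (𝓝 0) := by
  obtain ⟨e, he, rfl⟩ := hf
  have h1 : (fun p => K p ^ k * (φ p * ∑ j ∈ Finset.range (n + 1), K p ^ j * e j p)) =
      fun p => ∑ j ∈ Finset.range (n + 1), (K p ^ (k + j) * φ p) * e j p := by
    ext p
    rw [Finset.mul_sum, Finset.mul_sum]
    exact Finset.sum_congr rfl fun j _ => by ring
  rw [h1, show (0 : ℂ) = ∑ j ∈ Finset.range (n + 1), 0 * e j c by simp]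
  refine tendsto_finsetSum _ fun j _ => (hφ _).mul ?_
  exact ((he j c (Metric.mem_ball_self hr)).continuousAt.tendsto).mono_left hl

lemma IsSmallLogPoly.tendsto {l : Filter ℂ} (hr : 0 < r) (hl : l ≤ 𝓝 c)
    (hφ : ∀ j, Tendsto (fun p => K p ^ j * (p - c)) l (𝓝 0)) (hf : IsSmallLogPoly c r K n f)
    (k : ℕ) : Tendsto (fun p => K p ^ k * f p) l (𝓝 0) := by
  obtain ⟨g, hg, rfl⟩ := hf
  exact hg.tendsto hr hl hφ k

end LogPoly

/-! ### Iterated primitives with tangential base point `τ` -/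

section IteratedPrimitives

/-- Dependent choice along words: `Good` carries what the next step needs, `R` records the
differential equation. -/
lemma exists_list_recursion {α β : Type*} (Good : List α → β → Prop) (R : α → List α → β → β → Prop)
    (f₀ : β) (h0 : Good [] f₀)
    (hstep : ∀ σ u f, Good u f → ∃ F, Good (σ :: u) F ∧ R σ u f F) :
    ∃ E : List α → β, E [] = f₀ ∧ (∀ u, Good u (E u)) ∧ ∀ σ u, R σ u (E u) (E (σ :: u)) := by
  choose! next hnext hR using hstep
  let E : List α → β := fun u => u.rec f₀ fun σ u f => next σ u f
  have hE : ∀ u, Good u (E u) := fun u => by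
    induction u with
    | nil => exact h0
    | cons σ u ih => exact hnext σ u _ ih
  exact ⟨E, rfl, hE, fun σ u => hR σ u _ (hE u)⟩

variable {S : Finset ℂ} {τ : S} {r : ℝ} {K : ℂ → ℂ} {Ω : Set ℂ}

/-- The shape of the iterated primitives based at the letter `τ`. -/
def IsTangential (τ : S) (r : ℝ) (K : ℂ → ℂ) (u : List S) (f : ℂ → ℂ) : Prop :=
  ((∀ ρ ∈ u, ρ = τ) ∧ f = fun p => K p ^ u.length / (u.length.factorial : ℂ)) ∨
  ((¬ ∀ ρ ∈ u, ρ = τ) ∧ ∃ n, (u ∈ endsOff τ → n = 0) ∧ IsSmallLogPoly (τ : ℂ) r K n f)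

lemma analyticOnNhd_one_div_sub {U : Set ℂ} {σ : ℂ} (h : σ ∉ U) :
    AnalyticOnNhd ℂ (fun p => 1 / (p - σ)) U := fun p hp =>
  analyticAt_const.div (analyticAt_id.sub analyticAt_const)
    (sub_ne_zero.2 fun h' => h (by rw [← show p = σ from h']; exact hp))

/-- The only step with a genuine pole is `τ` in front of a power of `τ`, where the primitive is the
next divided power of `K`. For other tails the pole is absorbed by the factor `p - τ` of a small
polynomial. -/
lemma exists_tangential_step (hr : 0 < r) (hcΩ : (τ : ℂ) ∉ Ω)
    (hK : ∀ p ∈ Ω, HasDerivAt K (1 / (p - τ)) p)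
    (hS : ∀ σ : S, σ ≠ τ → (σ : ℂ) ∉ Metric.ball (τ : ℂ) r) (σ : S) (u : List S) (f : ℂ → ℂ)
    (hf : IsTangential τ r K u f) :
    ∃ F, IsTangential τ r K (σ :: u) F ∧
      ∀ p ∈ Metric.ball (τ : ℂ) r ∩ Ω, HasDerivAt F (f p / (p - σ)) p := by
  rcases hf with ⟨hu, rfl⟩ | ⟨hu, n, hn, hf⟩
  · by_cases hσ : σ = τ
    · subst hσ
      refine ⟨_, Or.inl ⟨by simpa using hu, rfl⟩, fun p hp => ?_⟩
      have h1 := ((hK p hp.2).fun_pow (u.length + 1)).div_const ((u.length + 1).factorial : ℂ)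
      have h2 : (u.length.factorial : ℂ) ≠ 0 := by exact_mod_cast u.length.factorial_ne_zero
      have h3 : (u.length : ℂ) + 1 ≠ 0 := by exact_mod_cast Nat.succ_ne_zero u.length
      refine h1.congr_deriv ?_
      rw [Nat.factorial_succ]
      push_cast
      field_simp
    · obtain ⟨F, hF, hF'⟩ := (isLogPoly_pow_mul (K := K) ((analyticOnNhd_const
        (v := 1 / (u.length.factorial : ℂ))).mul (analyticOnNhd_one_div_sub (hS σ hσ)))
        (le_refl u.length)).exists_primitive hr hcΩ hK
      refine ⟨F, Or.inr ⟨fun h => hσ (h σ (by simp)), u.length, fun h => ?_, hF⟩, fun p hp => ?_⟩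
      -- Here `u` is a power of `τ`; if the whole word does not end in `τ` it must be empty, so the
      -- degree `u.length` is zero.
      · cases u with
        | nil => rfl
        | cons b u =>
          have h2 := tail_mem_endsOff h
          obtain ⟨x, hx⟩ := Option.isSome_iff_exists.1
            (List.getLast?_isSome.2 (List.cons_ne_nil b u))
          exact (h2 (by rw [hx, hu x (List.mem_of_getLast? hx)]; rfl)).elim
      · convert hF' p hp using 1
        simp; ring
  · have hune : u ≠ [] := by rintro rfl; simp at hu
    have hu' : ¬ ∀ ρ ∈ σ :: u, ρ = τ := fun h => hu fun ρ hρ => h ρ (by simp [hρ])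
    by_cases hσ : σ = τ
    · subst hσ
      obtain ⟨g, hg, rfl⟩ := hf
      obtain ⟨F, hF, hF'⟩ := hg.exists_primitive hr hcΩ hK
      refine ⟨F, Or.inr ⟨hu', n, fun h => hn (tail_mem_endsOff h), hF⟩, fun p hp => ?_⟩
      have hpc : p - σ ≠ 0 := sub_ne_zero.2 fun h => hcΩ (h ▸ hp.2)
      convert hF' p hp using 1
      field_simp
    · obtain ⟨F, hF, hF'⟩ := (hf.isLogPoly.mul_analytic
        (analyticOnNhd_one_div_sub (hS σ hσ))).exists_primitive hr hcΩ hK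
      refine ⟨F, Or.inr ⟨hu', n, fun h => hn (tail_mem_endsOff h), hF⟩, fun p hp => ?_⟩
      convert hF' p hp using 1
      ring

/-- Iterated primitives based at the letter `τ`, with the logarithm `K`. -/
lemma exists_tangential (hr : 0 < r) (hcΩ : (τ : ℂ) ∉ Ω)
    (hK : ∀ p ∈ Ω, HasDerivAt K (1 / (p - τ)) p)
    (hS : ∀ σ : S, σ ≠ τ → (σ : ℂ) ∉ Metric.ball (τ : ℂ) r) :
    ∃ E : List S → ℂ → ℂ, (E [] = fun _ => 1) ∧ (∀ u, IsTangential τ r K u (E u)) ∧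
      ∀ σ u, ∀ p ∈ Metric.ball (τ : ℂ) r ∩ Ω, HasDerivAt (E (σ :: u)) (E u p / (p - σ)) p :=
  exists_list_recursion (IsTangential τ r K)
    (fun σ _ f F => ∀ p ∈ Metric.ball (τ : ℂ) r ∩ Ω, HasDerivAt F (f p / (p - σ)) p)
    (fun _ => 1) (Or.inl ⟨by simp, by simp⟩) (exists_tangential_step hr hcΩ hK hS)

end IteratedPrimitives

/-! ### Solution systems that are shuffle characters -/

section ShuffleSystems

variable {S : Finset ℂ}

/-- The linear extension of a family of functions indexed by words. -/
def evalLin (Y : List S → ℂ → ℂ) (p : ℂ) : WordSpace S →ₗ[ℚ] ℂ :=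
  Finsupp.linearCombination ℚ fun w => Y w p

lemma evalLin_word (Y : List S → ℂ → ℂ) (p : ℂ) (w : List S) : evalLin Y p (word w) = Y w p := by
  simp [evalLin]

lemma evalLin_apply (Y : List S → ℂ → ℂ) (p : ℂ) (x : WordSpace S) :
    evalLin Y p x = ∑ w ∈ x.support, ((x w : ℚ) : ℂ) * Y w p := by
  simp only [evalLin, Finsupp.linearCombination_apply, Finsupp.sum, Rat.smul_def]

lemma evalLin_mapDomain (Y : List S → ℂ → ℂ) (p : ℂ) (σ : S) (x : WordSpace S) :
    evalLin Y p (x.mapDomain (σ :: ·)) = evalLin (fun u => Y (σ :: u)) p x := by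
  simp only [evalLin, Finsupp.linearCombination_mapDomain]
  rfl

lemma hasDerivAt_evalLin {Y : List S → ℂ → ℂ} {Y' : List S → ℂ} {p : ℂ} {P : Set (List S)}
    (h : ∀ w ∈ P, HasDerivAt (Y w) (Y' w) p) {x : WordSpace S}
    (hx : x ∈ Finsupp.supported ℚ ℚ P) :
    HasDerivAt (fun q => evalLin Y q x) (evalLin (fun w _ => Y' w) p x) p := by
  simp only [evalLin_apply]
  exact HasDerivAt.fun_sum fun w hw => (h w (hx hw)).const_mul _

lemma evalLin_div (Y : List S → ℂ → ℂ) (p a : ℂ) (x : WordSpace S) :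
    evalLin (fun w _ => Y w p / a) p x = evalLin Y p x / a := by
  simp only [evalLin_apply, Finset.sum_div, mul_div_assoc]

/-- A system of iterated primitives that is asymptotically compatible with the shuffle product is
compatible with the shuffle product. -/
lemma evalLin_shuffleWords_of_ode {Y : List S → ℂ → ℂ} {P : Set (List S)} {U : Set ℂ}
    {l : Filter ℂ} [l.NeBot] (hU : IsOpen U) (hUc : IsPreconnected U) (hlU : U ∈ l)
    (hPt : ∀ σ u, σ :: u ∈ P → u ∈ P) (hPc : ∀ σ u, u ≠ [] → u ∈ P → σ :: u ∈ P)
    (hPs : ∀ u ∈ P, ∀ v ∈ P, shuffleWords u v ∈ Finsupp.supported ℚ ℚ P)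
    (hY0 : ∀ p ∈ U, Y [] p = 1)
    (hY : ∀ σ u, σ :: u ∈ P → ∀ p ∈ U, HasDerivAt (Y (σ :: u)) (Y u p / (p - σ)) p)
    (hlim : ∀ u ∈ P, ∀ v ∈ P, u ≠ [] → v ≠ [] →
      Tendsto (fun p => Y u p * Y v p - evalLin Y p (shuffleWords u v)) l (𝓝 0)) :
    ∀ u ∈ P, ∀ v ∈ P, ∀ p ∈ U, evalLin Y p (shuffleWords u v) = Y u p * Y v p := by
  have hmem : ∀ (σ : S) (u v : List S), u ∈ P → v ∈ P → 0 < u.length + v.length →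
      shuffleWords u v ∈ Finsupp.supported ℚ ℚ {x | σ :: x ∈ P} := by
    intro σ u v hu hv hlen x hx
    refine hPc σ x (fun h => ?_) (hPs u hu v hv hx)
    have := shuffleWords_mem_length u v hx
    simp [h] at this
    omega
  intro u
  induction u with
  | nil => intro _ v _ p hp; rw [shuffleWords_nil_left, evalLin_word, hY0 p hp, one_mul]
  | cons σ u ihu =>
    intro hu v
    induction v with
    | nil => intro _ p hp; rw [shuffleWords_nil_right, evalLin_word, hY0 p hp, mul_one]
    | cons ρ v ihv =>
      intro hv
      -- The product rule mirrors the recursion of the shuffle product, so by induction the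
      -- difference has derivative zero; the limit along `l` identifies the constant.
      have hd : ∀ p ∈ U, HasDerivAt (fun p => Y (σ :: u) p * Y (ρ :: v) p -
          evalLin Y p (shuffleWords (σ :: u) (ρ :: v))) 0 p := by
        intro p hp
        have h1 := (hY σ u hu p hp).fun_mul (hY ρ v hv p hp)
        have h2 := hasDerivAt_evalLin (Y := fun x => Y (σ :: x)) (Y' := fun x => Y x p / (p - σ))
          (fun x hx => hY σ x hx p hp) (hmem σ u (ρ :: v) (hPt _ _ hu) hv (by simp))
        have h3 := hasDerivAt_evalLin (Y := fun x => Y (ρ :: x)) (Y' := fun x => Y x p / (p - ρ))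
          (fun x hx => hY ρ x hx p hp) (hmem ρ (σ :: u) v hu (hPt _ _ hv) (by simp))
        rw [evalLin_div, ihu (hPt _ _ hu) _ hv p hp] at h2
        rw [evalLin_div, ihv (hPt _ _ hv) p hp] at h3
        simp only [shuffleWords_cons_cons, map_add, evalLin_mapDomain]
        refine (h1.fun_sub (h2.fun_add h3)).congr_deriv ?_
        ring
      obtain ⟨k, hk⟩ := hU.exists_is_const_of_deriv_eq_zero hUc
        (fun p hp => (hd p hp).differentiableAt.differentiableWithinAt)
        (fun p hp => (hd p hp).deriv)
      have hk0 : k = 0 := by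
        refine tendsto_nhds_unique (Tendsto.congr' ?_ tendsto_const_nhds)
          (hlim _ hu _ hv (by simp) (by simp))
        filter_upwards [hlU] with p hp using (hk p hp).symm
      intro p hp
      exact (sub_eq_zero.1 ((hk p hp).trans hk0)).symm

lemma evalLin_shL {Y : List S → ℂ → ℂ} {P : Set (List S)} {p : ℂ}
    (h : ∀ u ∈ P, ∀ v ∈ P, evalLin Y p (shuffleWords u v) = Y u p * Y v p) {x y : WordSpace S}
    (hx : x ∈ Finsupp.supported ℚ ℚ P) (hy : y ∈ Finsupp.supported ℚ ℚ P) :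
    evalLin Y p (shL x y) = evalLin Y p x * evalLin Y p y := by
  have h1 : ∀ u ∈ P, evalLin Y p (shL (word u) y) = evalLin Y p (word u) * evalLin Y p y :=
    fun u hu => eq_of_mem_supported (f := (evalLin Y p).comp (shL (word u)))
      (g := (LinearMap.mul ℚ ℂ (evalLin Y p (word u))).comp (evalLin Y p))
      (fun v hv => by simp [shL_word, h u hu v hv, evalLin_word]) hy
  exact eq_of_mem_supported (f := (evalLin Y p).comp (shL.flip y))
    (g := ((LinearMap.mul ℚ ℂ).flip (evalLin Y p y)).comp (evalLin Y p))
    (fun u hu => by simpa [mul_comm] using h1 u hu) hx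

end ShuffleSystems

/-! ### Hyperlogarithms near the origin -/

section HyperlogNearOrigin

variable {S : Finset ℂ} {o : S} {V : Set ℂ}

/-- The hyperlogarithm of a word over `S`. -/
abbrev hlog (w : List S) : ℂ → ℂ := hyperlog (w.map Subtype.val)

lemma exists_ne_of_mem_endsOff {a : S} {w : List S} (hw : w ∈ endsOff a) (hne : w ≠ []) :
    ∃ ρ ∈ w, ρ ≠ a := by
  obtain ⟨x, hx⟩ := Option.isSome_iff_exists.1 (List.getLast?_isSome.2 hne)
  exact ⟨x, List.mem_of_getLast? hx, fun h => hw (by rw [hx, h]; rfl)⟩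

lemma hlog_cons (ho : (o : ℂ) = 0) {σ : S} {u : List S} (h : σ :: u ∈ endsOff o) (p : ℂ) :
    hlog (σ :: u) p = ∫ s in (0 : ℝ)..1, p / (s * p - σ) * hlog u (s * p) := by
  obtain ⟨ρ, hρ, hρo⟩ := exists_ne_of_mem_endsOff h (List.cons_ne_nil σ u)
  have : ¬ ∀ ρ ∈ (σ : ℂ) :: u.map Subtype.val, ρ = 0 := fun hall => hρo <| Subtype.ext <| by
    rw [ho]
    exact hall ρ (by rw [← List.map_cons]; exact List.mem_map_of_mem hρ)
  rw [hlog, List.map_cons, hyperlog, if_neg this]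

/-- The integrand of a hyperlogarithm is analytic on `V`, up to a removable singularity at `0`. -/
lemma exists_integrand (ho : (o : ℂ) = 0) (hV : IsOpen V) (h0 : (0 : ℂ) ∈ V)
    (hS : ∀ σ : S, σ ≠ o → (σ : ℂ) ∉ V) {σ : S} {u : List S} (h : σ :: u ∈ endsOff o)
    (hu : AnalyticOnNhd ℂ (hlog u) V) (hu0 : u ≠ [] → hlog u 0 = 0) :
    ∃ g, AnalyticOnNhd ℂ g V ∧ ∀ p, (p ≠ 0 ∨ σ ≠ o) → g p = hlog u p / (p - σ) := by
  by_cases hσ : σ = o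
  · subst hσ
    -- A word not ending in `0` is not the single letter `0`, so `hlog u` vanishes at the origin and
    -- its difference quotient removes the pole.
    have hne : u ≠ [] := by rintro rfl; simp [endsOff] at h
    refine ⟨dslope (hlog u) 0, analyticOnNhd_dslope hV h0 hu, fun p hp => ?_⟩
    rw [dslope_of_ne _ (hp.resolve_right fun h => h rfl), slope_def_field, hu0 hne, ho]
    simp
  · exact ⟨fun p => hlog u p / (p - σ), by
      simpa only [mul_one_div] using hu.mul (analyticOnNhd_one_div_sub (hS σ hσ)), fun _ _ => rfl⟩

/-- Hyperlogarithms of words that do not end in `0` are analytic at the origin, and satisfy the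
expected differential equations. -/
lemma hlog_analytic (ho : (o : ℂ) = 0) (hV : IsOpen V) (hVc : Convex ℝ V) (h0 : (0 : ℂ) ∈ V)
    (hS : ∀ σ : S, σ ≠ o → (σ : ℂ) ∉ V) (w : List S) (hw : w ∈ endsOff o) :
    AnalyticOnNhd ℂ (hlog w) V ∧ (w ≠ [] → hlog w 0 = 0) ∧
      ∀ σ u, w = σ :: u → ∀ p ∈ V, (p ≠ 0 ∨ σ ≠ o) →
        HasDerivAt (hlog w) (hlog u p / (p - σ)) p := by
  induction w with
  | nil =>
    refine ⟨?_, fun h => (h rfl).elim, fun σ u h => by simp at h⟩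
    have : hlog ([] : List S) = fun _ => 1 := by
      ext p; change hyperlog [] p = 1; rw [hyperlog]
    rw [this]; exact analyticOnNhd_const
  | cons σ u ih =>
    obtain ⟨hu, hu0, -⟩ := ih (tail_mem_endsOff hw)
    obtain ⟨g, hg, hg'⟩ := exists_integrand ho hV h0 hS hw hu hu0
    obtain ⟨Q, hQ⟩ := hVc.exists_forall_hasDerivWithinAt hg.differentiableOn
    have hQ' : ∀ p ∈ V, HasDerivAt Q (g p) p := fun p hp => (hQ p hp).hasDerivAt (hV.mem_nhds hp)
    have hseg : ∀ p ∈ V, ∀ s ∈ Icc (0 : ℝ) 1, (s : ℂ) * p ∈ V := fun p hp s hs => by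
      have := hVc.smul_mem_of_zero_mem h0 hp hs
      simpa using this
    have key : ∀ p ∈ V, hlog (σ :: u) p = Q p - Q 0 := by
      intro p hp
      have h1 : ∫ s in (0 : ℝ)..1, p * g (s * p) = Q ((1 : ℝ) * p) - Q ((0 : ℝ) * p) := by
        refine intervalIntegral.integral_eq_sub_of_hasDerivAt (f := fun s : ℝ => Q (s * p))
          (fun s hs => ?_) ?_
        · rw [uIcc_of_le zero_le_one] at hs
          have h2 : HasDerivAt (fun s : ℝ => (s : ℂ) * p) p s := by
            simpa using (Complex.ofRealCLM.hasDerivAt (x := s)).mul_const p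
          have := (hQ' _ (hseg p hp s hs)).comp s h2
          rwa [mul_comm] at this
        · refine ContinuousOn.intervalIntegrable ?_
          rw [uIcc_of_le zero_le_one]
          exact continuousOn_const.mul (hg.continuousOn.comp (by fun_prop) (hseg p hp))
      rw [hlog_cons ho hw]
      simp only [Complex.ofReal_one, one_mul, Complex.ofReal_zero, zero_mul] at h1
      rw [← h1]
      refine intervalIntegral.integral_congr_ae ?_
      filter_upwards [MeasureTheory.Measure.ae_ne MeasureTheory.volume (0 : ℝ)] with s hs _
      rcases eq_or_ne p 0 with rfl | hp0
      · simp
      · rw [hg' _ (Or.inl (mul_ne_zero (by exact_mod_cast hs) hp0))]; ring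
    have hd : ∀ p ∈ V, HasDerivAt (hlog (σ :: u)) (g p) p := fun p hp =>
      ((hQ' p hp).sub_const (Q 0)).congr_of_eventuallyEq
        (eventuallyEq_of_mem (hV.mem_nhds hp) key)
    refine ⟨DifferentiableOn.analyticOnNhd (fun p hp =>
      (hd p hp).differentiableAt.differentiableWithinAt) hV, fun _ => ?_, ?_⟩
    · rw [key 0 h0, sub_self]
    · rintro σ' u' h p hp hp0
      obtain ⟨rfl, rfl⟩ := List.cons.inj h
      rw [← hg' p hp0]
      exact hd p hp

end HyperlogNearOrigin

/-! ### The setting on the segment from `0` to `τ` -/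

/-- The local data at the smallest positive letter `τ = t`: a convex neighbourhood `V` of `[0, t)`
without nonzero letters, a disc of radius `r` about `τ` without other letters, and a branch `K` of
`log (1 - p / τ)` on a set `Ω` that contains `V`. -/
structure LocalData (S : Finset ℂ) (o τ : S) (t r : ℝ) (V Ω : Set ℂ) (K : ℂ → ℂ) : Prop where
  coe_o : (o : ℂ) = 0
  coe_τ : (τ : ℂ) = t
  t_pos : 0 < t
  r_pos : 0 < r
  r_lt : r < t
  isOpen_V : IsOpen V
  convex_V : Convex ℝ V
  zero_mem : (0 : ℂ) ∈ V
  notMem_V : ∀ σ : S, σ ≠ o → (σ : ℂ) ∉ V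
  segment_mem : ∀ s ∈ Ico (0 : ℝ) 1, (s : ℂ) * t ∈ V
  notMem_ball : ∀ σ : S, σ ≠ τ → (σ : ℂ) ∉ Metric.ball (τ : ℂ) r
  isOpen_Ω : IsOpen Ω
  V_subset : V ⊆ Ω
  notMem_Ω : (τ : ℂ) ∉ Ω
  hasDerivAt : ∀ p ∈ Ω, HasDerivAt K (1 / (p - τ)) p
  K_segment : ∀ s ∈ Ico (0 : ℝ) 1, K ((s : ℂ) * t) = (Real.log (1 - s) : ℂ)
  preconnected : IsPreconnected (Metric.ball (τ : ℂ) r ∩ Ω)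

namespace LocalData

variable {S : Finset ℂ} {o τ : S} {t r : ℝ} {V Ω : Set ℂ} {K : ℂ → ℂ}

/-- Approach to the letter `τ = t` along the segment from `0`. -/
def toLetter (t : ℝ) : Filter ℂ := map (fun s : ℝ => (s : ℂ) * t) (𝓝[<] (1 : ℝ))

/-- Departure from `0` along the segment to `t`. -/
def fromZero (t : ℝ) : Filter ℂ := map (fun s : ℝ => (s : ℂ) * t) (𝓝[>] (0 : ℝ))

instance (t : ℝ) : (toLetter t).NeBot := by unfold toLetter; infer_instance

instance (t : ℝ) : (fromZero t).NeBot := by unfold fromZero; infer_instance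

lemma toLetter_le (D : LocalData S o τ t r V Ω K) : toLetter t ≤ 𝓝 (τ : ℂ) := by
  have h : Continuous fun s : ℝ => (s : ℂ) * t := by fun_prop
  have := (h.tendsto 1).mono_left (nhdsWithin_le_nhds (s := Iio 1))
  simpa [toLetter, D.coe_τ, Tendsto] using this

lemma fromZero_le (t : ℝ) : fromZero t ≤ 𝓝 0 := by
  have h : Continuous fun s : ℝ => (s : ℂ) * t := by fun_prop
  have := (h.tendsto 0).mono_left (nhdsWithin_le_nhds (s := Ioi 0))
  simpa [fromZero, Tendsto] using this

lemma eventually_toLetter {p : ℂ → Prop} (h : ∀ᶠ s : ℝ in 𝓝[<] (1 : ℝ), p ((s : ℂ) * t)) :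
    ∀ᶠ q in toLetter t, p q := h

lemma Ioo_mem : ∀ᶠ s in 𝓝[<] (1 : ℝ), s ∈ Ioo (0 : ℝ) 1 := Ioo_mem_nhdsLT zero_lt_one

lemma V_mem_toLetter (D : LocalData S o τ t r V Ω K) : V ∈ toLetter t := by
  refine eventually_toLetter (p := fun q => q ∈ V) ?_
  filter_upwards [Ioo_mem] with s hs using D.segment_mem s (Ioo_subset_Ico_self hs)

lemma overlap_mem (D : LocalData S o τ t r V Ω K) : V ∩ Metric.ball (τ : ℂ) r ∈ toLetter t :=
  inter_mem D.V_mem_toLetter (D.toLetter_le (Metric.ball_mem_nhds _ D.r_pos))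

/-- The exponent `1/2` is a compromise: it beats all powers of the logarithm, its inverse is
integrable, and its square is the full distance. -/
lemma tendsto_log_pow_mul (j : ℕ) :
    Tendsto (fun s : ℝ => Real.log (1 - s) ^ j * (1 - s) ^ (1 / 2 : ℝ)) (𝓝[<] 1) (𝓝 0) := by
  have h1 : Tendsto (fun x : ℝ => Real.log x ^ j * x ^ (1 / 2 : ℝ)) (𝓝[>] 0) (𝓝 0) := by
    have h2 := (isLittleO_abs_log_rpow_rpow_nhdsGT_zero (j : ℝ)
      (show (-(1 / 2) : ℝ) < 0 by norm_num)).tendsto_div_nhds_zero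
    refine squeeze_zero_norm' ?_ h2
    filter_upwards [self_mem_nhdsWithin] with x hx
    have hx : 0 < x := hx
    rw [Real.rpow_natCast, Real.rpow_neg hx.le, div_inv_eq_mul, norm_mul, norm_pow,
      Real.norm_eq_abs, Real.norm_of_nonneg (Real.rpow_nonneg hx.le _)]
  refine h1.comp (tendsto_nhdsWithin_iff.2 ⟨?_, ?_⟩)
  · have : Continuous fun s : ℝ => 1 - s := by fun_prop
    simpa using (this.tendsto 1).mono_left (nhdsWithin_le_nhds (s := Iio 1))
  · filter_upwards [self_mem_nhdsWithin] with s hs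
    simpa using hs

/-- The square root of the relative distance to `τ` along the segment. -/
def sqrtDist (t : ℝ) (p : ℂ) : ℂ := (((1 - p.re / t) ^ (1 / 2 : ℝ) : ℝ) : ℂ)

lemma sqrtDist_segment (ht : 0 < t) (s : ℝ) :
    sqrtDist t ((s : ℂ) * t) = (((1 - s) ^ (1 / 2 : ℝ) : ℝ) : ℂ) := by
  have : ((s : ℂ) * t).re / t = s := by simp [ht.ne']
  rw [sqrtDist, this]

lemma tendsto_pow_mul_sqrtDist (D : LocalData S o τ t r V Ω K) (j : ℕ) :
    Tendsto (fun p => K p ^ j * sqrtDist t p) (toLetter t) (𝓝 0) := by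
  refine tendsto_map'_iff.2 ?_
  have h := (Complex.continuous_ofReal.tendsto 0).comp (tendsto_log_pow_mul j)
  rw [Complex.ofReal_zero] at h
  refine h.congr' ?_
  filter_upwards [Ioo_mem] with s hs
  simp only [Function.comp_apply]
  rw [D.K_segment s (Ioo_subset_Ico_self hs), sqrtDist_segment D.t_pos]
  push_cast
  rfl

lemma tendsto_pow_mul_sub (D : LocalData S o τ t r V Ω K) (j : ℕ) :
    Tendsto (fun p => K p ^ j * (p - τ)) (toLetter t) (𝓝 0) := by
  have h := ((D.tendsto_pow_mul_sqrtDist j).mul (D.tendsto_pow_mul_sqrtDist 0)).const_mul (-t : ℂ)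
  simp only [mul_zero] at h
  refine h.congr' (eventually_toLetter ?_)
  filter_upwards [Ioo_mem] with s hs
  have h1 : ((1 - s) ^ (1 / 2 : ℝ) : ℝ) * ((1 - s) ^ (1 / 2 : ℝ) : ℝ) = 1 - s := by
    rw [← Real.rpow_add (by linarith [hs.2])]; norm_num
  have h2 : (((1 - s) ^ (1 / 2 : ℝ) : ℝ) : ℂ) * (((1 - s) ^ (1 / 2 : ℝ) : ℝ) : ℂ) = 1 - s := by
    exact_mod_cast h1
  rw [sqrtDist_segment D.t_pos, D.coe_τ, pow_zero, one_mul, mul_assoc (K _ ^ j), h2]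
  ring

/-- The part of `V` in the right half plane. -/
def right (V : Set ℂ) : Set ℂ := V ∩ {p | 0 < p.re}

lemma isOpen_right (D : LocalData S o τ t r V Ω K) : IsOpen (right V) :=
  D.isOpen_V.inter (isOpen_lt continuous_const Complex.continuous_re)

lemma preconnected_right (D : LocalData S o τ t r V Ω K) : IsPreconnected (right V) :=
  (D.convex_V.inter (convex_halfSpace_re_gt 0)).isPreconnected

lemma ne_zero_of_mem_right {p : ℂ} (hp : p ∈ right V) : p ≠ 0 := by
  rintro rfl
  have h : (0 : ℝ) < (0 : ℂ).re := hp.2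
  simp at h

lemma right_mem_fromZero (D : LocalData S o τ t r V Ω K) : right V ∈ fromZero t := by
  have : ∀ᶠ s in 𝓝[>] (0 : ℝ), s ∈ Ioo (0 : ℝ) 1 := Ioo_mem_nhdsGT zero_lt_one
  change ∀ᶠ s : ℝ in 𝓝[>] (0 : ℝ), (s : ℂ) * t ∈ right V
  filter_upwards [this] with s hs
  refine ⟨D.segment_mem s (Ioo_subset_Ico_self hs), ?_⟩
  simpa using mul_pos hs.1 D.t_pos

lemma overlap_subset_right (D : LocalData S o τ t r V Ω K) :
    V ∩ Metric.ball (τ : ℂ) r ⊆ right V := by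
  rintro p ⟨hpV, hp⟩
  refine ⟨hpV, ?_⟩
  rw [Metric.mem_ball, dist_eq_norm, D.coe_τ] at hp
  have h1 := Complex.abs_re_le_norm (p - t)
  have h2 := abs_le.1 (h1.trans hp.le)
  have h3 := D.r_lt
  simp only [Complex.sub_re, Complex.ofReal_re] at h2
  have : |(p - t).re| < r := h1.trans_lt hp
  have h4 := (abs_lt.1 this).1
  simp only [Complex.sub_re, Complex.ofReal_re] at h4
  change 0 < p.re
  linarith

lemma analyticOnNhd_hlog (D : LocalData S o τ t r V Ω K) {w : List S} (hw : w ∈ endsOff o) :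
    AnalyticOnNhd ℂ (hlog w) V :=
  (hlog_analytic D.coe_o D.isOpen_V D.convex_V D.zero_mem D.notMem_V w hw).1

lemma hlog_zero (D : LocalData S o τ t r V Ω K) {w : List S} (hw : w ∈ endsOff o) (hne : w ≠ []) :
    hlog w 0 = 0 :=
  (hlog_analytic D.coe_o D.isOpen_V D.convex_V D.zero_mem D.notMem_V w hw).2.1 hne

lemma hasDerivAt_hlog (D : LocalData S o τ t r V Ω K) {σ : S} {u : List S}
    (hw : σ :: u ∈ endsOff o) {p : ℂ} (hp : p ∈ V) (hp0 : p ≠ 0) :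
    HasDerivAt (hlog (σ :: u)) (hlog u p / (p - σ)) p :=
  (hlog_analytic D.coe_o D.isOpen_V D.convex_V D.zero_mem D.notMem_V _ hw).2.2 σ u rfl p hp
    (Or.inl hp0)

lemma hlog_nil (p : ℂ) : hlog ([] : List S) p = 1 := by
  change hyperlog [] p = 1; rw [hyperlog]

lemma tendsto_hlog_fromZero (D : LocalData S o τ t r V Ω K) {w : List S} (hw : w ∈ endsOff o)
    (hne : w ≠ []) : Tendsto (hlog w) (fromZero t) (𝓝 0) := by
  have h := (D.analyticOnNhd_hlog hw 0 D.zero_mem).continuousAt.tendsto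
  rw [D.hlog_zero hw hne] at h
  exact h.mono_left (fromZero_le t)

lemma tendsto_evalLin {Y : List S → ℂ → ℂ} {l : Filter ℂ} {x : WordSpace S}
    (h : ∀ w ∈ x.support, Tendsto (Y w) l (𝓝 0)) : Tendsto (fun p => evalLin Y p x) l (𝓝 0) := by
  simp only [evalLin_apply]
  rw [show (0 : ℂ) = ∑ w ∈ x.support, ((x w : ℚ) : ℂ) * 0 by simp]
  exact tendsto_finsetSum _ fun w hw => (h w hw).const_mul _

lemma ne_nil_of_mem_support_shuffleWords {u v x : List S} (hu : u ≠ [])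
    (hx : x ∈ (shuffleWords u v).support) : x ≠ [] := by
  rintro rfl
  have := shuffleWords_mem_length u v hx
  have hu' := List.length_pos_iff.2 hu
  simp at this
  omega

/-- Hyperlogarithms are compatible with the shuffle product. -/
lemma evalLin_hlog_shuffleWords (D : LocalData S o τ t r V Ω K) :
    ∀ u ∈ endsOff o, ∀ v ∈ endsOff o, ∀ p ∈ right V,
      evalLin hlog p (shuffleWords u v) = hlog u p * hlog v p := by
  refine evalLin_shuffleWords_of_ode (l := fromZero t) D.isOpen_right D.preconnected_right
    D.right_mem_fromZero (fun _ _ h => tail_mem_endsOff h) (fun _ _ h h' => cons_mem_endsOff h h')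
    (fun u hu v hv => shuffleWords_mem_endsOff hu hv) (fun p _ => hlog_nil p)
    (fun σ u h p hp => D.hasDerivAt_hlog h hp.1 (ne_zero_of_mem_right hp)) ?_
  intro u hu v hv hu' hv'
  rw [show (0 : ℂ) = 0 * 0 - 0 by simp]
  refine ((D.tendsto_hlog_fromZero hu hu').mul (D.tendsto_hlog_fromZero hv hv')).sub
    (tendsto_evalLin fun w hw => D.tendsto_hlog_fromZero (shuffleWords_mem_endsOff hu hv hw)
      (ne_nil_of_mem_support_shuffleWords hu' hw))

lemma o_ne_τ (D : LocalData S o τ t r V Ω K) : τ ≠ o := by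
  intro h
  have := D.coe_τ
  rw [h, D.coe_o] at this
  exact D.t_pos.ne (by exact_mod_cast this)

/-- Both sides have the same derivative and tend to zero at the origin, since `K 0 = 0`. -/
lemma hlog_replicate (D : LocalData S o τ t r V Ω K) (n : ℕ) {p : ℂ} (hp : p ∈ right V) :
    hlog (List.replicate n τ) p = K p ^ n / (n.factorial : ℂ) := by
  induction n generalizing p with
  | zero => simpa using hlog_nil p
  | succ n ih =>
    have hw := replicate_mem_endsOff D.o_ne_τ (n + 1)
    have hwc : τ :: List.replicate n τ ∈ endsOff o := hw
    have hK1 : ∀ p ∈ right V, HasDerivAt (fun p => K p ^ (n + 1) / ((n + 1).factorial : ℂ))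
        (K p ^ n / (n.factorial : ℂ) / (p - τ)) p := by
      intro p hp
      have h1 := ((D.hasDerivAt p (D.V_subset hp.1)).fun_pow (n + 1)).div_const
        ((n + 1).factorial : ℂ)
      have h2 : (n.factorial : ℂ) ≠ 0 := by exact_mod_cast n.factorial_ne_zero
      have h3 : (n : ℂ) + 1 ≠ 0 := by exact_mod_cast Nat.succ_ne_zero n
      refine h1.congr_deriv ?_
      rw [Nat.factorial_succ]
      push_cast
      field_simp
    have hL1 : ∀ p ∈ right V, HasDerivAt (hlog (List.replicate (n + 1) τ))
        (K p ^ n / (n.factorial : ℂ) / (p - τ)) p := by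
      intro p hp
      have := D.hasDerivAt_hlog hwc hp.1 (ne_zero_of_mem_right hp)
      rwa [ih hp] at this
    obtain ⟨k, hk⟩ := D.isOpen_right.exists_eq_add_of_deriv_eq D.preconnected_right
      (fun p hp => (hL1 p hp).differentiableAt.differentiableWithinAt)
      (fun p hp => (hK1 p hp).differentiableAt.differentiableWithinAt)
      (fun p hp => (hL1 p hp).deriv.trans (hK1 p hp).deriv.symm)
    have hK0 : K 0 = 0 := by simpa using D.K_segment 0 ⟨le_rfl, zero_lt_one⟩
    have hKc : Tendsto K (fromZero t) (𝓝 0) := by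
      have := (D.hasDerivAt 0 (D.V_subset D.zero_mem)).continuousAt.tendsto
      rw [hK0] at this
      exact this.mono_left (fromZero_le t)
    have hk0 : k = 0 := by
      have h1 : Tendsto (fun p => hlog (List.replicate (n + 1) τ) p -
          K p ^ (n + 1) / ((n + 1).factorial : ℂ)) (fromZero t) (𝓝 0) := by
        have := (D.tendsto_hlog_fromZero hw (by simp)).sub
          ((hKc.pow (n + 1)).div_const ((n + 1).factorial : ℂ))
        simpa using this
      refine tendsto_nhds_unique (Tendsto.congr' ?_ tendsto_const_nhds) h1
      filter_upwards [D.right_mem_fromZero] with q hq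
      rw [hk hq]; ring
    rw [hk hp, hk0]
    exact add_zero _

end LocalData

/-! ### Asymptotics of hyperlogarithms at `τ` and regularized values -/

namespace LocalData

variable {S : Finset ℂ} {o τ : S} {t r : ℝ} {V Ω : Set ℂ} {K : ℂ → ℂ}

lemma isOpen_overlap (D : LocalData S o τ t r V Ω K) : IsOpen (V ∩ Metric.ball (τ : ℂ) r) :=
  D.isOpen_V.inter Metric.isOpen_ball

lemma preconnected_overlap (D : LocalData S o τ t r V Ω K) :
    IsPreconnected (V ∩ Metric.ball (τ : ℂ) r) :=
  (D.convex_V.inter (convex_ball _ _)).isPreconnected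

lemma overlap_subset (D : LocalData S o τ t r V Ω K) :
    V ∩ Metric.ball (τ : ℂ) r ⊆ Metric.ball (τ : ℂ) r ∩ Ω := fun _ hp => ⟨hp.2, D.V_subset hp.1⟩

lemma hlog_eq_add_const (D : LocalData S o τ t r V Ω K) {σ : S} {u : List S}
    (hw : σ :: u ∈ endsOff o) {F : ℂ → ℂ}
    (hF : ∀ p ∈ V ∩ Metric.ball (τ : ℂ) r, HasDerivAt F (hlog u p / (p - σ)) p) :
    ∃ k, EqOn (hlog (σ :: u)) (fun p => F p + k) (V ∩ Metric.ball (τ : ℂ) r) := by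
  have hL : ∀ p ∈ V ∩ Metric.ball (τ : ℂ) r, HasDerivAt (hlog (σ :: u)) (hlog u p / (p - σ)) p :=
    fun p hp => D.hasDerivAt_hlog hw hp.1 (ne_zero_of_mem_right (D.overlap_subset_right hp))
  exact D.isOpen_overlap.exists_eq_add_of_deriv_eq D.preconnected_overlap
    (fun p hp => (hL p hp).differentiableAt.differentiableWithinAt)
    (fun p hp => (hF p hp).differentiableAt.differentiableWithinAt)
    (fun p hp => (hL p hp).deriv.trans (hF p hp).deriv.symm)

/-- Near `τ`, hyperlogarithms are polynomials in `K` with analytic coefficients. -/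
lemma hlog_isLogPoly (D : LocalData S o τ t r V Ω K) {w : List S} (hw : w ∈ endsOff o) :
    (∃ n f, IsLogPoly (τ : ℂ) r K n f ∧ EqOn (hlog w) f (V ∩ Metric.ball (τ : ℂ) r)) ∧
    (τ ∉ w.head? → ∃ n f k, IsSmallLogPoly (τ : ℂ) r K n f ∧
      EqOn (hlog w) (fun p => f p + k) (V ∩ Metric.ball (τ : ℂ) r)) := by
  induction w with
  | nil =>
    refine ⟨⟨0, fun _ => 1, ?_, fun p _ => hlog_nil p⟩, fun _ => ⟨0, fun _ => 0, 1, ?_, ?_⟩⟩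
    · simpa using isLogPoly_pow_mul (K := K) (c := (τ : ℂ)) (r := r) (b := fun _ => 1)
        analyticOnNhd_const (le_refl 0)
    · refine ⟨fun _ => 0, ?_, by simp⟩
      simpa using isLogPoly_pow_mul (K := K) (c := (τ : ℂ)) (r := r) (b := fun _ => 0)
        analyticOnNhd_const (le_refl 0)
    · intro p _
      simpa using hlog_nil p
  | cons σ u ih =>
    obtain ⟨⟨n, f, hf, hfL⟩, -⟩ := ih (tail_mem_endsOff hw)
    by_cases hσ : σ = τ
    · subst hσ
      obtain ⟨F, hF, hF'⟩ := hf.exists_primitive_div D.r_pos D.notMem_Ω D.hasDerivAt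
      obtain ⟨k, hk⟩ := D.hlog_eq_add_const hw (F := F) fun p hp => by
        rw [hfL hp]; exact hF' p (D.overlap_subset hp)
      refine ⟨⟨n + 1, _, hF.add ?_, hk⟩, fun h => by simp at h⟩
      simpa using isLogPoly_pow_mul (K := K) (c := (σ : ℂ)) (r := r) (b := fun _ => k)
        analyticOnNhd_const (Nat.zero_le (n + 1))
    · obtain ⟨F, hF, hF'⟩ := (hf.mul_analytic (analyticOnNhd_one_div_sub
        (D.notMem_ball σ hσ))).exists_primitive D.r_pos D.notMem_Ω D.hasDerivAt
      obtain ⟨k, hk⟩ := D.hlog_eq_add_const hw (F := F) fun p hp => by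
        rw [hfL hp, ← mul_one_div]; exact hF' p (D.overlap_subset hp)
      refine ⟨⟨n, _, hF.isLogPoly.add ?_, hk⟩, fun _ => ⟨n, F, k, hF, hk⟩⟩
      simpa using isLogPoly_pow_mul (K := K) (c := (τ : ℂ)) (r := r) (b := fun _ => k)
        analyticOnNhd_const (Nat.zero_le n)

/-- `q` is the integrable function `(1 - s)^(-1/2)` times a function that becomes continuous on the
closed interval when given the value `0` at `1`. -/
lemma intervalIntegrable_of_sqrt_mul {q : ℝ → ℂ} (hq : ContinuousOn q (Ico 0 1))
    (hlim : Tendsto (fun s : ℝ => (((1 - s) ^ (1 / 2 : ℝ) : ℝ) : ℂ) * q s) (𝓝[<] 1) (𝓝 0)) :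
    IntervalIntegrable q MeasureTheory.volume 0 1 := by
  set ψ : ℝ → ℂ := Function.update (fun s => (((1 - s) ^ (1 / 2 : ℝ) : ℝ) : ℂ) * q s) 1 0 with hψ
  have hψc : ContinuousOn ψ (Icc 0 1) := by
    rw [hψ, continuousOn_update_iff, Icc_sdiff_right]
    refine ⟨ContinuousOn.mul ?_ hq, fun _ => hlim.mono_left (nhdsWithin_mono _ fun s hs => hs.2)⟩
    refine Complex.continuous_ofReal.comp_continuousOn ?_
    exact ContinuousOn.rpow_const (by fun_prop) fun s _ => Or.inr (by norm_num)
  have h1 : IntervalIntegrable (fun s : ℝ => (((1 - s) ^ (-(1 / 2) : ℝ) : ℝ) : ℂ))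
      MeasureTheory.volume 0 1 := by
    have h2 := (intervalIntegral.intervalIntegrable_rpow' (a := 0) (b := 1)
      (show (-1 : ℝ) < -(1 / 2) by norm_num)).comp_sub_left 1
    rw [sub_self, sub_zero] at h2
    exact ⟨h2.symm.1.ofReal, h2.symm.2.ofReal⟩
  have h3 := h1.mul_continuousOn (g := ψ) (by rwa [uIcc_of_le zero_le_one])
  refine h3.congr_uIoo fun s hs => ?_
  rw [uIoo_of_le zero_le_one] at hs
  have h4 : ((1 - s) ^ (-(1 / 2) : ℝ) : ℝ) * ((1 - s) ^ (1 / 2 : ℝ) : ℝ) = 1 := by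
    rw [← Real.rpow_add (by linarith [hs.2])]; norm_num
  have h5 : (((1 - s) ^ (-(1 / 2) : ℝ) : ℝ) : ℂ) * (((1 - s) ^ (1 / 2 : ℝ) : ℝ) : ℂ) = 1 := by
    exact_mod_cast h4
  simp only [hψ, Function.update_of_ne hs.2.ne]
  rw [← mul_assoc, h5, one_mul]

/-- The hyperlogarithm of a word that does not begin with `τ` is continuous at `τ` along the
segment from `0`. -/
lemma hlog_letter (D : LocalData S o τ t r V Ω K) {w : List S} (hw : w ∈ endsOff o)
    (hh : τ ∉ w.head?) :
    ∃ n f, IsSmallLogPoly (τ : ℂ) r K n f ∧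
      EqOn (hlog w) (fun p => f p + hlog w τ) (V ∩ Metric.ball (τ : ℂ) r) := by
  obtain ⟨n, f, k, hf, hk⟩ := (D.hlog_isLogPoly hw).2 hh
  suffices hlog w τ = k from ⟨n, f, hf, by rwa [this]⟩
  cases w with
  | nil =>
    rw [hlog_nil]
    have h1 := hf.tendsto D.r_pos D.toLetter_le D.tendsto_pow_mul_sub 0
    have h2 : Tendsto (fun _ : ℂ => (1 : ℂ)) (toLetter t) (𝓝 k) := by
      have h3 := h1.add_const k
      rw [zero_add] at h3
      refine h3.congr' ?_
      filter_upwards [D.overlap_mem] with p hp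
      rw [pow_zero, one_mul, ← hlog_nil (S := S) p, hk hp]
    exact tendsto_nhds_unique tendsto_const_nhds h2
  | cons σ u =>
    have hσ : σ ≠ τ := by simpa using hh
    have hu := tail_mem_endsOff hw
    obtain ⟨g, hg, hg'⟩ := exists_integrand D.coe_o D.isOpen_V D.zero_mem D.notMem_V hw
      (D.analyticOnNhd_hlog hu) (D.hlog_zero hu)
    obtain ⟨m, f', hf', hfL⟩ := (D.hlog_isLogPoly hu).1
    have ht0 : (t : ℂ) ≠ 0 := by exact_mod_cast D.t_pos.ne'
    have hqi : IntervalIntegrable (fun s : ℝ => g ((s : ℂ) * t)) MeasureTheory.volume 0 1 := by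
      refine intervalIntegrable_of_sqrt_mul
        (hg.continuousOn.comp (by fun_prop) D.segment_mem) ?_
      have h1 := (hf'.mul_analytic (analyticOnNhd_one_div_sub (D.notMem_ball σ hσ))).tendsto
        D.r_pos D.toLetter_le D.tendsto_pow_mul_sqrtDist 0
      have h2 : Tendsto (fun p => sqrtDist t p * g p) (toLetter t) (𝓝 0) := by
        refine h1.congr' ?_
        filter_upwards [D.overlap_mem] with p hp
        rw [hg' p (Or.inl (ne_zero_of_mem_right (D.overlap_subset_right hp))), hfL hp]
        ring
      have h3 := tendsto_map'_iff.1 h2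
      refine h3.congr fun s => ?_
      simp only [Function.comp_apply]
      rw [sqrtDist_segment D.t_pos]
    -- The value at `τ` is by definition an integral whose integrand may be singular at the end
    -- point; the fundamental theorem with one-sided limits equates it with the limit `k`.
    have hinteg : ∫ s in (0 : ℝ)..1, (t : ℂ) * g ((s : ℂ) * t) = k - 0 := by
      refine intervalIntegral.integral_eq_sub_of_hasDerivAt_of_tendsto zero_lt_one
        (f := fun s : ℝ => hlog (σ :: u) ((s : ℂ) * t)) (fun s hs => ?_) (hqi.const_mul _) ?_ ?_
      · have h2 : HasDerivAt (fun s : ℝ => (s : ℂ) * t) t s := by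
          simpa using (Complex.ofRealCLM.hasDerivAt (x := s)).mul_const (t : ℂ)
        have hs0 : (s : ℂ) * t ≠ 0 := mul_ne_zero (by exact_mod_cast hs.1.ne') ht0
        have h3 := (D.hasDerivAt_hlog hw (D.segment_mem s (Ioo_subset_Ico_self hs)) hs0).comp s h2
        rw [← hg' _ (Or.inl hs0), mul_comm] at h3
        exact h3
      · exact tendsto_map'_iff.1 (D.tendsto_hlog_fromZero hw (by simp))
      · have h1 := hf.tendsto D.r_pos D.toLetter_le D.tendsto_pow_mul_sub 0
        have h2 : Tendsto (hlog (σ :: u)) (toLetter t) (𝓝 k) := by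
          have h3 := h1.add_const k
          rw [zero_add] at h3
          refine h3.congr' ?_
          filter_upwards [D.overlap_mem] with p hp
          rw [pow_zero, one_mul, hk hp]
        exact tendsto_map'_iff.1 h2
    rw [hlog_cons D.coe_o hw, ← sub_zero k, ← hinteg, D.coe_τ]
    refine intervalIntegral.integral_congr_ae ?_
    filter_upwards [MeasureTheory.Measure.ae_ne MeasureTheory.volume (0 : ℝ)] with s hs _
    rw [hg' _ (Or.inl (mul_ne_zero (by exact_mod_cast hs) ht0))]; ring

/-- The regularized value of a hyperlogarithm at `τ`. -/
def regValue (τ : S) (v : List S) : ℂ := evalLin hlog (τ : ℂ) (delReg τ (word v))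

/-- The weight `K^k` is essential: it lets regularized coefficients be replaced by their limits even
in front of a diverging power of `K`. -/
lemma tendsto_evalLin_delReg (D : LocalData S o τ t r V Ω K) {v : List S} (hv : v ∈ endsOff o)
    (k : ℕ) : Tendsto (fun p => K p ^ k * (evalLin hlog p (delReg τ (word v)) - regValue τ v))
      (toLetter t) (𝓝 0) := by
  have h1 : ∀ x ∈ (delReg τ (word v)).support,
      Tendsto (fun p => K p ^ k * (hlog x p - hlog x τ)) (toLetter t) (𝓝 0) := by
    intro x hx
    obtain ⟨n, f, hf, hfe⟩ := D.hlog_letter (delReg_word_mem_endsOff D.o_ne_τ hv hx)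
      (mem_supported_of_del_eq_zero (del_delReg τ (word v)) hx)
    refine (hf.tendsto D.r_pos D.toLetter_le D.tendsto_pow_mul_sub k).congr' ?_
    filter_upwards [D.overlap_mem] with p hp
    rw [hfe hp]
    simp
  have h2 := tendsto_evalLin (Y := fun x p => K p ^ k * (hlog x p - hlog x τ)) h1
  refine h2.congr fun p => ?_
  simp only [regValue, evalLin_apply]
  rw [← Finset.sum_sub_distrib, Finset.mul_sum]
  exact Finset.sum_congr rfl fun x _ => by ring

lemma drop_mem_endsOff {a : S} {w : List S} (hw : w ∈ endsOff a) (k : ℕ) :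
    w.drop k ∈ endsOff a := by
  intro h
  rw [List.getLast?_drop] at h
  split_ifs at h with h'
  · simp at h
  · exact hw h

/-- The Taylor formula `word_eq_sum_shL_delReg` under the character `hlog`, for which `rep τ k`
becomes `K^k / k!`. -/
lemma hlog_eq_sum_delReg (D : LocalData S o τ t r V Ω K) {w : List S} (hw : w ∈ endsOff o) {p : ℂ}
    (hp : p ∈ right V) :
    hlog w p = ∑ k ∈ Finset.range (w.length + 1), K p ^ k / (k.factorial : ℂ) *
      evalLin hlog p (delReg τ ((del τ ^ k) (word w))) := by
  rw [← evalLin_word hlog p w]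
  conv_lhs => rw [word_eq_sum_shL_delReg τ w (Nat.lt_succ_self _)]
  rw [map_sum]
  refine Finset.sum_congr rfl fun k hk => ?_
  have hmem : delReg τ ((del τ ^ k) (word w)) ∈ Finsupp.supported ℚ ℚ (endsOff o) := by
    classical
    rw [del_pow_word τ w k (by simp at hk; omega)]
    split_ifs
    · refine delReg_word_mem_endsOff D.o_ne_τ ?_
      exact drop_mem_endsOff hw k
    · rw [map_zero]; exact Submodule.zero_mem _
  rw [evalLin_shL (fun u hu v hv => D.evalLin_hlog_shuffleWords u hu v hv p hp)
    (Finsupp.single_mem_supported _ _ (replicate_mem_endsOff D.o_ne_τ k)) hmem, evalLin_word,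
    D.hlog_replicate k hp]

end LocalData

/-! ### The connection formula in a neighbourhood of `τ` -/

/-- Iterated primitives at the letter `τ`, on the slit disc. -/
structure TangentialSystem (S : Finset ℂ) (τ : S) (r : ℝ) (Ω : Set ℂ) (K : ℂ → ℂ)
    (E : List S → ℂ → ℂ) : Prop where
  nil : E [] = fun _ => 1
  shape : ∀ u, IsTangential τ r K u (E u)
  ode : ∀ σ u, ∀ p ∈ Metric.ball (τ : ℂ) r ∩ Ω, HasDerivAt (E (σ :: u)) (E u p / (p - σ)) p

namespace LocalData

variable {S : Finset ℂ} {o τ : S} {t r : ℝ} {V Ω : Set ℂ} {K : ℂ → ℂ} {E : List S → ℂ → ℂ}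

lemma exists_tangentialSystem (D : LocalData S o τ t r V Ω K) :
    ∃ E, TangentialSystem S τ r Ω K E := by
  obtain ⟨E, h1, h2, h3⟩ := exists_tangential D.r_pos D.notMem_Ω D.hasDerivAt D.notMem_ball
  exact ⟨E, h1, h2, h3⟩

lemma _root_.Hyperlogs.TangentialSystem.replicate (T : TangentialSystem S τ r Ω K E) (n : ℕ) :
    E (List.replicate n τ) = fun p => K p ^ n / (n.factorial : ℂ) := by
  rcases T.shape (List.replicate n τ) with ⟨-, h⟩ | ⟨h, -⟩
  · simpa using h
  · exact (h fun ρ hρ => List.eq_of_mem_replicate hρ).elim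

lemma tendsto_pow_mul_tangential (D : LocalData S o τ t r V Ω K)
    (T : TangentialSystem S τ r Ω K E) {u : List S} (hu : ¬ ∀ ρ ∈ u, ρ = τ) (k : ℕ) :
    Tendsto (fun p => K p ^ k * E u p) (toLetter t) (𝓝 0) := by
  rcases T.shape u with ⟨h, -⟩ | ⟨-, n, -, h⟩
  · exact (hu h).elim
  · exact h.tendsto D.r_pos D.toLetter_le D.tendsto_pow_mul_sub k

lemma tendsto_tangential (D : LocalData S o τ t r V Ω K)
    (T : TangentialSystem S τ r Ω K E) {u : List S} (hu : ¬ ∀ ρ ∈ u, ρ = τ) :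
    Tendsto (E u) (toLetter t) (𝓝 0) := by
  simpa using D.tendsto_pow_mul_tangential T hu 0

lemma tendsto_tangential_mul (D : LocalData S o τ t r V Ω K)
    (T : TangentialSystem S τ r Ω K E) {u : List S} (hu : ¬ ∀ ρ ∈ u, ρ = τ) (v : List S) :
    Tendsto (fun p => E u p * E v p) (toLetter t) (𝓝 0) := by
  by_cases hv : ∀ ρ ∈ v, ρ = τ
  · rw [List.eq_replicate_of_mem hv, T.replicate]
    have := (D.tendsto_pow_mul_tangential T hu v.length).div_const (v.length.factorial : ℂ)
    rw [zero_div] at this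
    exact this.congr fun p => by ring
  · simpa using (D.tendsto_tangential T hu).mul (D.tendsto_tangential T hv)

/-- The iterated primitives at `τ` are compatible with the shuffle product. -/
lemma evalLin_tangential_shuffleWords (D : LocalData S o τ t r V Ω K)
    (T : TangentialSystem S τ r Ω K E) (u v : List S) {p : ℂ}
    (hp : p ∈ Metric.ball (τ : ℂ) r ∩ Ω) :
    evalLin E p (shuffleWords u v) = E u p * E v p := by
  refine evalLin_shuffleWords_of_ode (P := univ) (l := toLetter t)
    (Metric.isOpen_ball.inter D.isOpen_Ω) D.preconnected
    (mem_of_superset D.overlap_mem D.overlap_subset) (fun _ _ _ => mem_univ _)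
    (fun _ _ _ _ => mem_univ _) (fun u _ v _ x _ => mem_univ x) (fun p _ => by rw [T.nil])
    (fun σ u _ p hp => T.ode σ u p hp) ?_ u (mem_univ _) v (mem_univ _) p hp
  rintro u - v - - -
  -- For two powers of `τ` the identity is exact, by divided powers. Otherwise a letter other than
  -- `τ` occurs in every term, so the product and the shuffle both tend to zero.
  by_cases hu : (∀ ρ ∈ u, ρ = τ) ∧ (∀ ρ ∈ v, ρ = τ)
  · have h1 : ∀ p, E u p * E v p - evalLin E p (shuffleWords u v) = 0 := by
      intro p
      rw [List.eq_replicate_of_mem hu.1, List.eq_replicate_of_mem hu.2, ← shL_word, shL_rep_rep,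
        map_smul, evalLin_word, T.replicate, T.replicate, T.replicate, Rat.smul_def]
      dsimp only
      rw [pow_add]
      set m := u.length
      set n := v.length
      have h2 : (m.factorial : ℂ) ≠ 0 := by exact_mod_cast m.factorial_ne_zero
      have h3 : (n.factorial : ℂ) ≠ 0 := by exact_mod_cast n.factorial_ne_zero
      have h4 : ((m + n).factorial : ℂ) ≠ 0 := by exact_mod_cast (m + n).factorial_ne_zero
      have h5 : (((m + n).choose m : ℕ) : ℂ) * m.factorial * n.factorial =
          (m + n).factorial := by
        rw [Nat.choose_symm_add]
        exact_mod_cast Nat.add_choose_mul_factorial_mul_factorial m n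
      rw [← h5] at h4 ⊢
      have h6 : (((m + n).choose m : ℕ) : ℂ) ≠ 0 := fun h => h4 (by rw [h]; ring)
      push_cast
      field_simp
      ring
    simp only [h1]
    exact tendsto_const_nhds
  · have h1 : Tendsto (fun p => E u p * E v p) (toLetter t) (𝓝 0) := by
      by_cases h : ∀ ρ ∈ u, ρ = τ
      · have h2 : ¬ ∀ ρ ∈ v, ρ = τ := fun h' => hu ⟨h, h'⟩
        exact (D.tendsto_tangential_mul T h2 u).congr fun p => mul_comm _ _
      · exact D.tendsto_tangential_mul T h v
    have h2 := h1.sub (tendsto_evalLin (Y := E) (x := shuffleWords u v) fun x hx =>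
      D.tendsto_tangential T fun hall => hu ?_)
    · simpa using h2
    · have hperm := shuffleWords_mem_perm u v hx
      exact ⟨fun ρ hρ => hall ρ (hperm.mem_iff.2 (by simp [hρ])),
        fun ρ hρ => hall ρ (hperm.mem_iff.2 (by simp [hρ]))⟩

/-- Comparison with `hlog_eq_sum_delReg` term by term: if `w` begins with `τ^k` both terms carry
`K^k / k!`, and otherwise the Taylor term is zero while `E (w.take k)` tends to zero. -/
lemma tendsto_hlog_sub_sum (D : LocalData S o τ t r V Ω K) (T : TangentialSystem S τ r Ω K E)
    {w : List S} (hw : w ∈ endsOff o) :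
    Tendsto (fun p => hlog w p - ∑ k ∈ Finset.range (w.length + 1),
      E (w.take k) p * regValue τ (w.drop k)) (toLetter t) (𝓝 0) := by
  classical
  have h1 : Tendsto (fun p => ∑ k ∈ Finset.range (w.length + 1), (K p ^ k / (k.factorial : ℂ) *
      evalLin hlog p (delReg τ ((del τ ^ k) (word w))) -
        E (w.take k) p * regValue τ (w.drop k))) (toLetter t) (𝓝 0) := by
    rw [show (0 : ℂ) = ∑ k ∈ Finset.range (w.length + 1), 0 by simp]
    refine tendsto_finsetSum _ fun k hk => ?_
    have hk : k ≤ w.length := by simp at hk; omega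
    rw [del_pow_word τ w k hk]
    split_ifs with h
    · have h2 := (D.tendsto_evalLin_delReg (drop_mem_endsOff hw k) k).div_const (k.factorial : ℂ)
      rw [zero_div] at h2
      refine h2.congr fun p => ?_
      rw [h, T.replicate]
      ring
    · have h2 : ¬ ∀ ρ ∈ w.take k, ρ = τ := fun hall => h <| by
        rw [List.eq_replicate_of_mem hall, List.length_take, min_eq_left hk]
      have h3 := (D.tendsto_tangential T h2).mul_const (regValue τ (w.drop k))
      rw [zero_mul] at h3
      simpa using h3.neg
  refine h1.congr' ?_
  filter_upwards [D.overlap_mem] with p hp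
  rw [D.hlog_eq_sum_delReg hw (D.overlap_subset_right hp), Finset.sum_sub_distrib]

/-- The expansion of hyperlogarithms in the iterated primitives at `τ`. -/
lemma hlog_eq_sum (D : LocalData S o τ t r V Ω K) (T : TangentialSystem S τ r Ω K E)
    {w : List S} (hw : w ∈ endsOff o) {p : ℂ} (hp : p ∈ V ∩ Metric.ball (τ : ℂ) r) :
    hlog w p = ∑ k ∈ Finset.range (w.length + 1), E (w.take k) p * regValue τ (w.drop k) := by
  induction w generalizing p with
  | nil =>
    simp [T.nil, regValue, delReg_of_del_eq_zero τ [] (del_nil τ), evalLin_word, hlog_nil]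
  | cons σ u ih =>
    have hL : ∀ p ∈ V ∩ Metric.ball (τ : ℂ) r, HasDerivAt (fun p => ∑ k ∈
        Finset.range ((σ :: u).length + 1), E ((σ :: u).take k) p * regValue τ ((σ :: u).drop k))
        (hlog u p / (p - σ)) p := by
      intro p hp
      rw [ih (tail_mem_endsOff hw) hp]
      -- The term `k = 0` is constant; differentiating the others strips `σ` and reproduces the
      -- formula for `u`.
      simp only [List.length_cons, Finset.sum_range_succ' _ (u.length + 1), List.take_succ_cons,
        List.drop_succ_cons, List.take_zero, T.nil, List.drop_zero]
      refine ((HasDerivAt.fun_sum fun k _ => (T.ode σ (u.take k) p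
        (D.overlap_subset hp)).mul_const (regValue τ (u.drop k))).add_const _).congr_deriv ?_
      rw [Finset.sum_div]
      exact Finset.sum_congr rfl fun k _ => by ring
    obtain ⟨c, hc⟩ := D.hlog_eq_add_const hw hL
    have hc0 : c = 0 := by
      refine tendsto_nhds_unique (Tendsto.congr' ?_ tendsto_const_nhds)
        (D.tendsto_hlog_sub_sum T hw)
      filter_upwards [D.overlap_mem] with q hq
      rw [hc hq]; ring
    rw [hc hp, hc0]
    exact add_zero _

end LocalData

/-! ### Continuation of whole systems of iterated primitives -/

section Systems

variable {S : Finset ℂ}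

/-- Continuation of a system of iterated primitives along a path that avoids the letters after its
start. -/
lemma exists_system {γ : ℝ → ℂ} {a b : ℝ} (hab : a ≤ b) (hγ : ContinuousOn γ (Icc a b))
    (hγS : ∀ t ∈ Ioc a b, γ t ∉ S) {P : Set (List S)} (hP : ∀ σ u, σ :: u ∈ P → u ∈ P)
    {Y : List S → ℂ → ℂ} (hY0 : Y [] = fun _ => 1)
    (hYan : ∀ u ∈ P, AnalyticAt ℂ (Y u) (γ a))
    (hY : ∀ σ u, σ :: u ∈ P → ∀ᶠ p : ℂ in 𝓝 (γ a), p ≠ σ → deriv (Y (σ :: u)) p = Y u p / (p - σ)) :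
    ∃ Φ : List S → ℝ → ℂ → ℂ, (Φ [] = fun _ _ => 1) ∧
      (∀ u ∈ P, Φ u a = Y u ∧ ContOn γ (Φ u) (Icc a b)) ∧
      ∀ σ u, σ :: u ∈ P → ∀ t ∈ Ioc a b, ∀ᶠ p in 𝓝 (γ t),
        HasDerivAt (Φ (σ :: u) t) (Φ u t p / (p - σ)) p := by
  -- Membership in `P` is a premise inside the predicates, so words outside `P` may receive the zero
  -- function.
  refine exists_list_recursion
    (fun u F => u ∈ P → F a = Y u ∧ ContOn γ F (Icc a b))
    (fun σ u G F => σ :: u ∈ P → ∀ t ∈ Ioc a b, ∀ᶠ p in 𝓝 (γ t),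
      HasDerivAt (F t) (G t p / (p - σ)) p) (fun _ _ => 1) ?_ ?_
  · exact fun _ => ⟨hY0.symm, ContOn.const fun _ _ => analyticAt_const⟩
  · intro σ u G hG
    by_cases h : σ :: u ∈ P
    · obtain ⟨hG0, hGc⟩ := hG (hP σ u h)
      obtain ⟨F, h1, h2, h3⟩ := ContOn.exists_solution hab hγ (σ := (σ : ℂ))
        (fun t ht h' => hγS t ht (h' ▸ σ.2)) hGc (hYan _ h) (by rw [hG0]; exact hY σ u h)
      exact ⟨F, fun _ => ⟨h1, h2⟩, fun _ => h3⟩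
    · exact ⟨fun _ _ => 0, fun h' => (h h').elim, fun h' => (h h').elim⟩

/-- The germ of `f` at `a` can be continued along all paths that avoid `S` after their start. -/
def IsContinuable (S : Finset ℂ) (a : ℂ) (f : ℂ → ℂ) : Prop :=
  ∀ γ : ℝ → ℂ, ContinuousOn γ (Icc 0 1) → γ 0 = a → (∀ t ∈ Ioc (0 : ℝ) 1, γ t ∉ S) →
    ∃ F : ℝ → ℂ → ℂ, F 0 = f ∧ ContOn γ F (Icc 0 1)

lemma isContinuable_of_system {a : ℂ} {P : Set (List S)} (hP : ∀ σ u, σ :: u ∈ P → u ∈ P)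
    {Y : List S → ℂ → ℂ} (hY0 : Y [] = fun _ => 1) (hYan : ∀ u ∈ P, AnalyticAt ℂ (Y u) a)
    (hY : ∀ σ u, σ :: u ∈ P → ∀ᶠ p : ℂ in 𝓝 a, p ≠ σ → deriv (Y (σ :: u)) p = Y u p / (p - σ))
    {u : List S} (hu : u ∈ P) : IsContinuable S a (Y u) := by
  intro γ hγ hγ0 hγS
  subst hγ0
  obtain ⟨Φ, -, h, -⟩ := exists_system zero_le_one hγ hγS hP hY0 hYan hY
  exact ⟨Φ u, h u hu⟩

end Systems

namespace LocalData

variable {S : Finset ℂ} {o τ : S} {t r : ℝ} {V Ω : Set ℂ} {K : ℂ → ℂ} {E : List S → ℂ → ℂ}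

lemma isContinuable_hlog (D : LocalData S o τ t r V Ω K) {w : List S} (hw : w ∈ endsOff o) :
    IsContinuable S 0 (hlog w) := by
  refine isContinuable_of_system (P := endsOff o) (fun _ _ h => tail_mem_endsOff h)
    (Y := hlog) (funext hlog_nil) (fun u hu => D.analyticOnNhd_hlog hu 0 D.zero_mem) ?_ hw
  intro σ u h
  filter_upwards [D.isOpen_V.mem_nhds D.zero_mem] with p hp hpσ
  refine ((hlog_analytic D.coe_o D.isOpen_V D.convex_V D.zero_mem D.notMem_V _ h).2.2 σ u rfl p hp
    ?_).deriv
  by_contra! h'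
  exact hpσ (by rw [h'.1, h'.2, D.coe_o])

/-- For words not ending in `τ` the polynomial in `K` has degree zero, so no logarithm is left and
the function extends across the cut to the whole disc. -/
lemma tangential_analytic (T : TangentialSystem S τ r Ω K E)
    {u : List S} (hu : u ∈ endsOff τ) : AnalyticOnNhd ℂ (E u) (Metric.ball (τ : ℂ) r) ∧
      (u ≠ [] → E u τ = 0) := by
  by_cases hne : u = []
  · subst hne
    rw [T.nil]
    exact ⟨analyticOnNhd_const, fun h => (h rfl).elim⟩
  · obtain ⟨ρ, hρ, hρτ⟩ := exists_ne_of_mem_endsOff hu hne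
    rcases T.shape u with ⟨h, -⟩ | ⟨-, n, hn, g, ⟨e, he, rfl⟩, hE⟩
    · exact (hρτ (h ρ hρ)).elim
    · rw [hE, hn hu]
      refine ⟨?_, fun _ => by simp⟩
      simp only [zero_add, Finset.range_one, Finset.sum_singleton, pow_zero, one_mul]
      exact (analyticOnNhd_id.sub analyticOnNhd_const).mul (he 0)

/-- The equation is known off the cut; multiplied by `p - σ` it is an identity between analytic
functions on the disc and spreads by the identity theorem. -/
lemma tangential_deriv (D : LocalData S o τ t r V Ω K) (T : TangentialSystem S τ r Ω K E)
    {σ : S} {u : List S} (hu : σ :: u ∈ endsOff τ) {p : ℂ} (hp : p ∈ Metric.ball (τ : ℂ) r)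
    (hpσ : p ≠ σ) : deriv (E (σ :: u)) p = E u p / (p - σ) := by
  obtain ⟨q, hq⟩ := Filter.nonempty_of_mem D.overlap_mem
  have hqB := D.overlap_subset hq
  have h1 : EqOn (fun p => (p - σ) * deriv (E (σ :: u)) p) (E u) (Metric.ball (τ : ℂ) r) := by
    refine AnalyticOnNhd.eqOn_of_preconnected_of_eventuallyEq (𝕜 := ℂ)
      ((analyticOnNhd_id.sub analyticOnNhd_const).mul (tangential_analytic T hu).1.deriv)
      (tangential_analytic T (tail_mem_endsOff hu)).1 (convex_ball _ _).isPreconnected hqB.1 ?_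
    filter_upwards [(Metric.isOpen_ball.inter D.isOpen_Ω).mem_nhds hqB] with p hp
    have hpσ : p - σ ≠ 0 := by
      rw [sub_ne_zero]
      rintro rfl
      by_cases h : σ = τ
      · exact D.notMem_Ω (h ▸ hp.2)
      · exact D.notMem_ball σ h hp.1
    rw [(T.ode σ u p hp).deriv]
    field_simp
  rw [eq_div_iff (sub_ne_zero.2 hpσ), ← h1 hp]
  ring

lemma isContinuable_tangential (D : LocalData S o τ t r V Ω K) (T : TangentialSystem S τ r Ω K E)
    {u : List S} (hu : u ∈ endsOff τ) : IsContinuable S τ (E u) := by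
  have hmem := Metric.mem_ball_self (x := (τ : ℂ)) D.r_pos
  refine isContinuable_of_system (P := endsOff τ) (fun _ _ h => tail_mem_endsOff h) T.nil
    (fun u hu => (tangential_analytic T hu).1 _ hmem) (fun σ u h => ?_) hu
  filter_upwards [Metric.isOpen_ball.mem_nhds hmem] with p hp hpσ
  exact D.tangential_deriv T h hp hpσ

/-- Iterated integrals from the letter `τ` are the continuations of the iterated primitives. -/
lemma exists_continuation_iterInt (D : LocalData S o τ t r V Ω K)
    (T : TangentialSystem S τ r Ω K E) {δ : ℝ → ℂ} (hδ : ContDiffOn ℝ 1 δ (Icc 0 1))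
    (hδ0 : δ 0 = τ) (hδS : ∀ s ∈ Ioc (0 : ℝ) 1, δ s ∉ S) {u : List S} (hu : u ∈ endsOff τ) :
    ∃ F : ℝ → ℂ → ℂ, F 0 = E u ∧ ContOn δ F (Icc 0 1) ∧
      iterInt δ (u.map Subtype.val) 1 = F 1 (δ 1) := by
  have hmem := Metric.mem_ball_self (x := (τ : ℂ)) D.r_pos
  obtain ⟨Φ, hΦ0, hΦ, hΦd⟩ := exists_system (S := S) zero_le_one hδ.continuousOn hδS
    (P := endsOff τ) (fun _ _ h => tail_mem_endsOff h) T.nil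
    (fun u hu => by rw [hδ0]; exact (tangential_analytic T hu).1 _ hmem) (fun σ u h => by
      rw [hδ0]
      filter_upwards [Metric.isOpen_ball.mem_nhds hmem] with p hp hpσ
      exact D.tangential_deriv T h hp hpσ)
  refine ⟨Φ u, (hΦ u hu).1, (hΦ u hu).2, ?_⟩
  have key : ∀ u ∈ endsOff τ, ∀ s ∈ Icc (0 : ℝ) 1,
      iterInt δ (u.map Subtype.val) s = Φ u s (δ s) := by
    intro u
    induction u with
    | nil => intro _ s _; rw [List.map_nil, iterInt, hΦ0]
    | cons σ u ih =>
      intro hu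
      refine iterInt_cons_eq hδ (hΦ _ hu).2 (hΦd σ u hu) ?_ (ih (tail_mem_endsOff hu))
      rw [(hΦ _ hu).1, hδ0]
      exact (tangential_analytic T hu).2 (by simp)
  exact key u hu 1 ⟨zero_le_one, le_rfl⟩

end LocalData

/-! ### Deformed segments and graphs of height functions -/

section Graphs

/-- The height `y` over the real point `x` is on the prescribed side of all letters with real
part `x`. -/
def Admissible (S : Finset ℂ) (above : Set ℝ) (x y : ℝ) : Prop :=
  ∀ σ ∈ S, σ.re = x → (0 < σ.im → y < σ.im) ∧ (σ.im < 0 → σ.im < y) ∧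
    (σ.im = 0 → (x ∈ above → 0 < y) ∧ (x ∉ above → y < 0))

variable {S : Finset ℂ} {above : Set ℝ} {x y y' : ℝ}

lemma Admissible.notMem (h : Admissible S above x y) : (⟨x, y⟩ : ℂ) ∉ S := by
  intro hS
  obtain ⟨h1, h2, h3⟩ := h _ hS rfl
  rcases lt_trichotomy y 0 with hy | hy | hy
  · exact lt_irrefl _ (h2 hy)
  · by_cases hx : x ∈ above
    · exact ((h3 hy).1 hx).ne' hy
    · exact ((h3 hy).2 hx).ne hy
  · exact lt_irrefl _ (h1 hy)

/-- Over a fixed `x` every condition is a half-line, so the vertical straight-line homotopy between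
two admissible graphs avoids the letters. -/
lemma Admissible.convex (h : Admissible S above x y) (h' : Admissible S above x y') {s : ℝ}
    (hs : s ∈ Icc (0 : ℝ) 1) : Admissible S above x ((1 - s) * y + s * y') := by
  have key : ∀ c d : ℝ, 0 < c → 0 < d → 0 < (1 - s) * c + s * d := fun c d hc hd => by
    rcases eq_or_lt_of_le hs.1 with h0 | h0
    · rw [← h0]; linarith
    · nlinarith [mul_nonneg (sub_nonneg.2 hs.2) hc.le, mul_pos h0 hd]
  intro σ hσ hx
  obtain ⟨a1, a2, a3⟩ := h σ hσ hx
  obtain ⟨b1, b2, b3⟩ := h' σ hσ hx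
  refine ⟨fun hi => ?_, fun hi => ?_, fun hi => ⟨fun hxa => ?_, fun hxa => ?_⟩⟩
  · nlinarith [key _ _ (sub_pos.2 (a1 hi)) (sub_pos.2 (b1 hi))]
  · nlinarith [key _ _ (sub_pos.2 (a2 hi)) (sub_pos.2 (b2 hi))]
  · exact key _ _ ((a3 hi).1 hxa) ((b3 hi).1 hxa)
  · nlinarith [key _ _ (neg_pos.2 ((a3 hi).2 hxa)) (neg_pos.2 ((b3 hi).2 hxa))]

lemma Admissible.smul (h : Admissible S above x y) {s : ℝ} (hs : s ∈ Ioc (0 : ℝ) 1) :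
    Admissible S above x (s * y) := by
  intro σ hσ hx
  obtain ⟨a1, a2, a3⟩ := h σ hσ hx
  obtain ⟨hs0, hs1⟩ := hs
  refine ⟨fun hi => ?_, fun hi => ?_, fun hi => ⟨fun hxa => ?_, fun hxa => ?_⟩⟩
  · nlinarith [mul_pos hs0 (sub_pos.2 (a1 hi)), mul_nonneg (sub_nonneg.2 hs1) hi.le]
  · nlinarith [mul_pos hs0 (sub_pos.2 (a2 hi)), mul_nonneg (sub_nonneg.2 hs1) (neg_pos.2 hi).le]
  · exact mul_pos hs0 ((a3 hi).1 hxa)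
  · nlinarith [mul_pos hs0 (neg_pos.2 ((a3 hi).2 hxa))]

/-- The graph of a height function, as a path in the plane. -/
def graph (M : ℝ → ℝ) (x : ℝ) : ℂ := ⟨x, M x⟩

lemma continuousOn_mk {α : Type*} [TopologicalSpace α] {X : Set α} {f g : α → ℝ}
    (hf : ContinuousOn f X) (hg : ContinuousOn g X) :
    ContinuousOn (fun x => (⟨f x, g x⟩ : ℂ)) X := by
  have : (fun x => (⟨f x, g x⟩ : ℂ)) = fun x => (f x : ℂ) + (g x : ℂ) * Complex.I := by
    funext x
    apply Complex.ext <;> simp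
  rw [this]
  exact (Complex.continuous_ofReal.comp_continuousOn hf).add
    ((Complex.continuous_ofReal.comp_continuousOn hg).mul continuousOn_const)

/-- Height functions over `[a, z]` whose graphs pass the letters on the prescribed sides. -/
structure IsHeight (S : Finset ℂ) (above : Set ℝ) (a z : ℝ) (M : ℝ → ℝ) : Prop where
  continuousOn : ContinuousOn M (Icc a z)
  left : M a = 0
  right : M z = 0
  admissible : ∀ x ∈ Ioc a z, Admissible S above x (M x)

lemma IsHeight.continuousOn_graph {a z : ℝ} {M : ℝ → ℝ} (h : IsHeight S above a z M) :
    ContinuousOn (graph M) (Icc a z) := continuousOn_mk continuousOn_id h.continuousOn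

lemma IsDeformedSegment.exists_height {a z : ℝ} (haz : a < z) {γ : ℝ → ℂ}
    (hγ : IsDeformedSegment S above a z γ) :
    ∃ (M : ℝ → ℝ) (H : ℝ × ℝ → ℂ), IsHeight S above a z M ∧
      ContinuousOn H (Icc 0 1 ×ˢ Icc 0 1) ∧ (∀ t ∈ Icc (0 : ℝ) 1, H (0, t) = γ t) ∧
      (∀ t ∈ Icc (0 : ℝ) 1, H (1, t) = graph M (a + t * (z - a))) ∧
      (∀ s ∈ Icc (0 : ℝ) 1, H (s, 0) = a ∧ H (s, 1) = z) ∧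
      (∀ s ∈ Icc (0 : ℝ) 1, ∀ t ∈ Ioc (0 : ℝ) 1, H (s, t) ∉ S) := by
  obtain ⟨h, H, hc, h0, h1, hS, hside, hH, hHγ, hHh, hHe, hHS⟩ := hγ
  have hza : z - a ≠ 0 := (sub_pos.2 haz).ne'
  have hinv : ∀ t, (a + t * (z - a) - a) / (z - a) = t := fun t => by field_simp; ring
  refine ⟨fun x => h ((x - a) / (z - a)), H, ⟨?_, by simp [h0], by simp [div_self hza, h1],
    fun x hx => ?_⟩, hH, hHγ, fun t ht => ?_, hHe, hHS⟩
  · refine hc.comp (by fun_prop) fun x hx => ⟨?_, ?_⟩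
    · exact div_nonneg (sub_nonneg.2 hx.1) (sub_pos.2 haz).le
    · rw [div_le_one (sub_pos.2 haz)]; linarith [hx.2]
  · set t := (x - a) / (z - a) with ht
    have hxt : a + t * (z - a) = x := by rw [ht]; field_simp; ring
    have ht0 : 0 < t := div_pos (sub_pos.2 hx.1) (sub_pos.2 haz)
    have ht1 : t ≤ 1 := by rw [ht, div_le_one (sub_pos.2 haz)]; linarith [hx.2]
    intro σ hσ hre
    have hσe : σ = ⟨x, σ.im⟩ := Complex.ext hre rfl
    have hno : ∀ s ∈ Ioc (0 : ℝ) 1, s * h t ≠ σ.im := fun s hs he => by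
      have := hS s hs t ⟨ht0, ht1⟩
      rw [hxt, he, ← hσe] at this
      exact this hσ
    refine ⟨fun hi => ?_, fun hi => ?_, fun hi => ?_⟩
    · by_contra! hle
      -- If the graph reached or passed `σ`, then `σ` would sit on the graph rescaled by `σ.im / h
      -- t`, which lies in `(0, 1]`.
      have hpos : 0 < h t := hi.trans_le hle
      exact hno (σ.im / h t) ⟨div_pos hi hpos, (div_le_one hpos).2 hle⟩ (by field_simp)
    · by_contra! hle
      have hneg : h t < 0 := hle.trans_lt hi
      exact hno (σ.im / h t) ⟨div_pos_of_neg_of_neg hi hneg, (div_le_one_of_neg hneg).2 hle⟩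
        (by field_simp [hneg.ne])
    -- The end point `z` is not a letter, because the graph avoids `S` at `t = 1`, where its height
    -- is zero.
    · have ht1' : t ≠ 1 := by
        intro he
        have := hno 1 ⟨zero_lt_one, le_rfl⟩
        rw [he, h1, hi] at this
        simp at this
      have hmem : ((a + t * (z - a) : ℝ) : ℂ) ∈ S := by
        have : ((x : ℝ) : ℂ) = σ := by rw [hσe, hi]; rfl
        rw [hxt, this]; exact hσ
      have := hside t ⟨ht0, lt_of_le_of_ne ht1 ht1'⟩ hmem
      rwa [hxt] at this
  · rw [hHh t ht, graph, hinv]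

/-- Continuation along a deformed segment may be computed along the graph of any height function
with the same sides. -/
lemma IsDeformedSegment.transfer {a z : ℝ} (haz : a < z) {γ : ℝ → ℂ}
    (hγ : IsDeformedSegment S above a z γ) {f : ℂ → ℂ} (hf : IsContinuable S a f)
    {F : ℝ → ℂ → ℂ} (hF : ContOn γ F (Icc 0 1)) (hF0 : F 0 =ᶠ[𝓝 (a : ℂ)] f)
    {M' : ℝ → ℝ} (hM' : IsHeight S above a z M') {Φ : ℝ → ℂ → ℂ}
    (hΦ : ContOn (graph M') Φ (Icc a z)) (hΦa : Φ a =ᶠ[𝓝 (a : ℂ)] f) :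
    F 1 =ᶠ[𝓝 (z : ℂ)] Φ z := by
  obtain ⟨M, H, hM, hH, hHγ, hHh, hHe, hHS⟩ := hγ.exists_height haz
  have hI0 : (0 : ℝ) ∈ Icc (0 : ℝ) 1 := ⟨le_rfl, zero_le_one⟩
  have hI1 : (1 : ℝ) ∈ Icc (0 : ℝ) 1 := ⟨zero_le_one, le_rfl⟩
  set ℓ : ℝ → ℝ := fun t => a + t * (z - a) with hℓ
  have hℓm : MapsTo ℓ (Icc 0 1) (Icc a z) := fun t ht =>
    ⟨by simp only [hℓ]; nlinarith [ht.1], by simp only [hℓ]; nlinarith [ht.2]⟩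
  have hℓm' : MapsTo ℓ (Ioc 0 1) (Ioc a z) := fun t ht =>
    ⟨by simp only [hℓ]; nlinarith [ht.1], by simp only [hℓ]; nlinarith [ht.2]⟩
  have hℓc : Continuous ℓ := by fun_prop
  have hℓ0 : ℓ 0 = a := by simp [hℓ]
  have hℓ1 : ℓ 1 = z := by simp [hℓ]
  -- The given homotopy `H` leads from `γ` to the graph of its own height `M`; `H₂` moves that graph
  -- vertically to the one of `M'`.
  set H₂ : ℝ × ℝ → ℂ := fun q => ⟨ℓ q.2, (1 - q.1) * M (ℓ q.2) + q.1 * M' (ℓ q.2)⟩ with hH₂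
  have hH₂c : ContinuousOn H₂ (Icc 0 1 ×ˢ Icc 0 1) := by
    have h1 : MapsTo (fun q : ℝ × ℝ => ℓ q.2) (Icc 0 1 ×ˢ Icc 0 1) (Icc a z) :=
      fun q hq => hℓm hq.2
    have h2 : ContinuousOn (fun q : ℝ × ℝ => ℓ q.2) (Icc 0 1 ×ˢ Icc 0 1) := by fun_prop
    refine continuousOn_mk h2 (ContinuousOn.add (ContinuousOn.mul (by fun_prop) ?_)
      (ContinuousOn.mul (by fun_prop) ?_))
    · exact hM.continuousOn.comp h2 h1
    · exact hM'.continuousOn.comp h2 h1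
  have hH₂S : ∀ s ∈ Icc (0 : ℝ) 1, ∀ t ∈ Ioc (0 : ℝ) 1, H₂ (s, t) ∉ S := fun s hs t ht =>
    ((hM.admissible _ (hℓm' ht)).convex (hM'.admissible _ (hℓm' ht)) hs).notMem
  have hreal : ∀ x : ℝ, (⟨x, 0⟩ : ℂ) = x := fun x => rfl
  have hH₂0 : ∀ s ∈ Icc (0 : ℝ) 1, H₂ (s, 0) = a := fun s _ => by
    simp only [hH₂, hℓ0, hM.left, hM'.left, mul_zero, add_zero, hreal]
  have hH₂1 : ∀ s ∈ Icc (0 : ℝ) 1, H₂ (s, 1) = z := fun s _ => by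
    simp only [hH₂, hℓ1, hM.right, hM'.right, mul_zero, add_zero, hreal]
  have hsl : ∀ {G : ℝ × ℝ → ℂ}, ContinuousOn G (Icc 0 1 ×ˢ Icc 0 1) → ∀ s ∈ Icc (0 : ℝ) 1,
      ContinuousOn (fun t => G (s, t)) (Icc 0 1) := fun hG s hs =>
    hG.comp (by fun_prop) fun t ht => ⟨hs, ht⟩
  choose! Φ₁ hΦ₁0 hΦ₁ using fun s (hs : s ∈ Icc (0 : ℝ) 1) =>
    hf (fun t => H (s, t)) (hsl hH s hs) (hHe s hs).1 (hHS s hs)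
  choose! Φ₂ hΦ₂0 hΦ₂ using fun s (hs : s ∈ Icc (0 : ℝ) 1) =>
    hf (fun t => H₂ (s, t)) (hsl hH₂c s hs) (hH₂0 s hs) (hH₂S s hs)
  have m₁ := monodromy hH (fun s hs => (hHe s hs).1) (fun s hs => (hHe s hs).2) hΦ₁
    (fun s hs => by rw [hΦ₁0 s hs])
  have m₂ := monodromy hH₂c hH₂0 hH₂1 hΦ₂ (fun s hs => by rw [hΦ₂0 s hs])
  have e₁ : F 1 =ᶠ[𝓝 (z : ℂ)] Φ₁ 0 1 := by
    have := ContOn.unique isPreconnected_Icc (hsl hH 0 hI0) (hF.congr_path hHγ) (hΦ₁ 0 hI0)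
      hI0 (by simp only [(hHe 0 hI0).1, hΦ₁0 0 hI0]; exact hF0) hI1
    simpa only [(hHe 0 hI0).2] using this
  have e₂ : Φ₁ 1 1 =ᶠ[𝓝 (z : ℂ)] Φ₂ 0 1 := by
    have := ContOn.unique isPreconnected_Icc (hsl hH 1 hI1) (hΦ₁ 1 hI1)
      ((hΦ₂ 0 hI0).congr_path fun t ht => by rw [hHh t ht]; simp [hH₂, graph, hℓ])
      hI0 (by simp only [hΦ₁0 1 hI1, hΦ₂0 0 hI0]; rfl) hI1
    simpa only [(hHe 1 hI1).2] using this
  have e₃ : Φ₂ 1 1 =ᶠ[𝓝 (z : ℂ)] Φ z := by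
    have h1 : ContOn (graph M' ∘ ℓ) (Φ ∘ ℓ) (Icc 0 1) := hΦ.comp hℓc.continuousOn hℓm
    have := ContOn.unique isPreconnected_Icc (hsl hH₂c 1 hI1) (hΦ₂ 1 hI1)
      (h1.congr_path fun t ht => by simp [hH₂, graph])
      hI0 (by
        simp only [hΦ₂0 1 hI1, hH₂0 1 hI1, Function.comp_apply, hℓ0]; exact hΦa.symm) hI1
    simpa only [hH₂1 1 hI1, Function.comp_apply, hℓ1] using this
  exact (((e₁.trans m₁).trans e₂).trans m₂).trans e₃

end Graphs

/-! ### The cut plane, its logarithm and the cone -/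

section Construction

open Classical in
/-- The sign `+1` if the real point `t` is passed above, and `-1` if it is passed below. -/
def side (above : Set ℝ) (t : ℝ) : ℝ := if t ∈ above then 1 else -1

/-- The plane without the vertical ray that starts at `t` and leaves to the side on which `t` is
not passed. -/
def cutPlane (above : Set ℝ) (t : ℝ) : Set ℂ := {p | 0 < side above t * p.im ∨ p.re ≠ t}

/-- The branch of `log (1 - p / t)` on the cut plane that vanishes at `0`. -/
def cutLog (above : Set ℝ) (t : ℝ) (p : ℂ) : ℂ :=
  Complex.log (side above t * Complex.I * (1 - p / t)) - Complex.log (side above t * Complex.I)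

/-- The open triangle-like neighbourhood of the segment `[0, t)` with vertex `t`. -/
def cone (t r : ℝ) : Set ℂ := {p | ∃ s ∈ Ico (0 : ℝ) 1, ‖p - s * t‖ < (1 - s) * r}

variable {above : Set ℝ} {t r : ℝ}

lemma side_eq (above : Set ℝ) (t : ℝ) : side above t = 1 ∨ side above t = -1 := by
  unfold side; split_ifs <;> simp

lemma side_ne_zero (above : Set ℝ) (t : ℝ) : side above t ≠ 0 := by
  rcases side_eq above t with h | h <;> rw [h] <;> norm_num

lemma side_mul_I_ne_zero (above : Set ℝ) (t : ℝ) : (side above t : ℂ) * Complex.I ≠ 0 :=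
  mul_ne_zero (Complex.ofReal_ne_zero.2 (side_ne_zero above t)) Complex.I_ne_zero

/-- The rotation by `± I` turns the cut of the principal logarithm into the vertical ray on the side
where `t` is not passed. -/
lemma cutPlane_arg_mem (ht : 0 < t) {p : ℂ} (hp : p ∈ cutPlane above t) :
    (side above t : ℂ) * Complex.I * (1 - p / t) ∈ Complex.slitPlane := by
  have h1 : (side above t : ℂ) * Complex.I * (1 - p / t) =
      ⟨side above t * p.im / t, side above t * (1 - p.re / t)⟩ := by
    apply Complex.ext <;> simp [Complex.div_ofReal_re, Complex.div_ofReal_im, mul_div_assoc]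
  rw [h1, Complex.mem_slitPlane_iff]
  rcases hp with hp | hp
  · exact Or.inl (div_pos hp ht)
  · refine Or.inr (mul_ne_zero (side_ne_zero _ _) (sub_ne_zero.2 fun h => hp ?_))
    rw [eq_comm, div_eq_one_iff_eq ht.ne'] at h
    exact h

lemma isOpen_cutPlane (above : Set ℝ) (t : ℝ) : IsOpen (cutPlane above t) :=
  (isOpen_lt continuous_const (continuous_const.mul Complex.continuous_im)).union
    (isOpen_ne_fun Complex.continuous_re continuous_const)

lemma hasDerivAt_cutLog (ht : 0 < t) {p : ℂ} (hp : p ∈ cutPlane above t) :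
    HasDerivAt (cutLog above t) (1 / (p - t)) p := by
  have ht' : (t : ℂ) ≠ 0 := Complex.ofReal_ne_zero.2 ht.ne'
  have hq := side_mul_I_ne_zero above t
  have hm := cutPlane_arg_mem ht hp
  have h0 := Complex.slitPlane_ne_zero hm
  have h1 : p - t ≠ 0 := by
    intro h
    rw [sub_eq_zero.1 h, div_self ht'] at h0
    simp at h0
  have h1' : (t : ℂ) - p ≠ 0 := by rw [← neg_sub]; exact neg_ne_zero.2 h1
  have h2 : HasDerivAt (fun p : ℂ => (side above t : ℂ) * Complex.I * (1 - p / t))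
      ((side above t : ℂ) * Complex.I * (-(1 / t))) p :=
    (((hasDerivAt_id p).div_const (t : ℂ)).const_sub 1).const_mul _
  refine ((h2.clog hm).sub_const _).congr_deriv ?_
  rw [mul_div_mul_left _ _ hq]
  have h3 : (1 : ℂ) - p / t = (t - p) / t := by field_simp
  rw [h3, div_div_eq_mul_div, div_eq_div_iff h1' h1]
  field_simp
  ring

lemma cutLog_of_lt (ht : 0 < t) {s : ℝ} (hs : s < 1) :
    cutLog above t ((s : ℂ) * t) = (Real.log (1 - s) : ℂ) := by
  have ht' : (t : ℂ) ≠ 0 := Complex.ofReal_ne_zero.2 ht.ne'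
  rw [cutLog, mul_div_cancel_right₀ _ ht', mul_comm, ← Complex.ofReal_one, ← Complex.ofReal_sub,
    Complex.log_ofReal_mul (sub_pos.2 hs) (side_mul_I_ne_zero above t), add_sub_cancel_right]

/-- Beyond `t` the number `1 - z/t` is negative, so the argument is a positive multiple of `-(side
above t) * I`; the difference of the logarithms of `± I` gives the term `± iπ`. -/
lemma cutLog_of_gt (ht : 0 < t) {z : ℝ} (hz : t < z) :
    cutLog above t z = branchValue above t z := by
  have ht' : (t : ℂ) ≠ 0 := Complex.ofReal_ne_zero.2 ht.ne'
  have h1 : (side above t : ℂ) * Complex.I * (1 - z / t) =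
      (((z - t) / t : ℝ) : ℂ) * (-(side above t * Complex.I)) := by
    push_cast
    field_simp
    ring
  rw [cutLog, h1, Complex.log_ofReal_mul (div_pos (sub_pos.2 hz) ht)
    (neg_ne_zero.2 (side_mul_I_ne_zero above t)), branchValue]
  unfold side
  split_ifs
  · simp only [Complex.ofReal_one, one_mul, Complex.log_neg_I, Complex.log_I]
    ring
  · simp only [Complex.ofReal_neg, Complex.ofReal_one, one_mul, neg_mul, neg_neg,
      Complex.log_neg_I, Complex.log_I]
    ring

/-- The slit disc is star-shaped about the point halfway from `t` to the boundary circle, opposite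
to the cut. -/
lemma isPreconnected_ball_inter_cutPlane (above : Set ℝ) (t : ℝ) (hr : 0 < r) :
    IsPreconnected (Metric.ball (t : ℂ) r ∩ cutPlane above t) := by
  set e := side above t with he
  have hee : e * e = 1 := by
    rcases side_eq above t with h | h <;> rw [he, h] <;> norm_num
  set c : ℂ := ⟨t, e * (r / 2)⟩ with hc
  have hcb : c ∈ Metric.ball (t : ℂ) r := by
    have h1 : c - t = ((e * (r / 2) : ℝ) : ℂ) * Complex.I := by
      apply Complex.ext <;> simp [hc]
    rw [mem_ball_iff_norm, h1, norm_mul, Complex.norm_I, mul_one, Complex.norm_real, norm_mul,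
      Real.norm_eq_abs e, abs_eq (zero_le_one) |>.2 (by exact side_eq above t), one_mul,
      Real.norm_of_nonneg (by positivity)]
    linarith
  have hcp : c ∈ cutPlane above t := Or.inl (by
    change 0 < e * (e * (r / 2))
    rw [← mul_assoc, hee]; linarith)
  have hstar : StarConvex ℝ c (Metric.ball (t : ℂ) r ∩ cutPlane above t) := by
    refine ((convex_ball _ _).starConvex hcb).inter fun p hp a b ha hb hab => ?_
    rcases eq_or_lt_of_le hb with hb | hb
    · rw [← hb, zero_smul, add_zero, show a = 1 by linarith, one_smul]; exact hcp
    rcases hp with hp | hp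
    · left
      change 0 < e * (a • c + b • p).im
      have h1 : (a • c + b • p).im = a * (e * (r / 2)) + b * p.im := by simp [hc]
      have h2 : e * (a * (e * (r / 2)) + b * p.im) = a * (r / 2) + b * (e * p.im) := by
        linear_combination a * (r / 2) * hee
      rw [h1, h2]
      have : 0 < b * (e * p.im) := mul_pos hb hp
      positivity
    · right
      have h1 : (a • c + b • p).re = a * t + b * p.re := by simp [hc]
      rw [h1]
      intro h
      exact hp (mul_left_cancel₀ hb.ne' (by linear_combination h - t * hab))
  exact (hstar.isPathConnected ⟨hcb, hcp⟩).isConnected.isPreconnected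

lemma isOpen_cone (t r : ℝ) : IsOpen (cone t r) := by
  have : cone t r = ⋃ s ∈ Ico (0 : ℝ) 1, {p : ℂ | ‖p - s * t‖ < (1 - s) * r} := by
    ext p; simp [cone]
  rw [this]
  exact isOpen_biUnion fun s _ => isOpen_lt (by fun_prop) continuous_const

lemma convex_cone (t r : ℝ) : Convex ℝ (cone t r) := by
  rintro p ⟨s, hs, hp⟩ p' ⟨s', hs', hp'⟩ a b ha hb hab
  refine ⟨a * s + b * s', ⟨by have := hs.1; have := hs'.1; positivity, ?_⟩, ?_⟩
  · rcases eq_or_lt_of_le ha with ha' | ha'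
    · rw [← ha', show b = 1 by linarith]; linarith [hs'.2]
    · nlinarith [hs.2, hs'.2]
  · have h1 : a • p + b • p' - ((a * s + b * s' : ℝ) : ℂ) * t =
        a • (p - s * t) + b • (p' - s' * t) := by
      simp only [Complex.real_smul]; push_cast; ring
    rw [h1]
    calc _ ≤ ‖a • (p - s * t)‖ + ‖b • (p' - s' * t)‖ := norm_add_le _ _
      _ = a * ‖p - s * t‖ + b * ‖p' - s' * t‖ := by
        rw [norm_smul, norm_smul, Real.norm_of_nonneg ha, Real.norm_of_nonneg hb]
      _ < a * ((1 - s) * r) + b * ((1 - s') * r) := by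
        rcases eq_or_lt_of_le ha with ha' | ha'
        · rw [← ha', show b = 1 by linarith]; linarith
        · have := mul_lt_mul_of_pos_left hp ha'
          have := mul_le_mul_of_nonneg_left hp'.le hb
          linarith
      _ = _ := by linear_combination r * hab

lemma mul_mem_cone (t : ℝ) (hr : 0 < r) {s : ℝ} (hs : s ∈ Ico (0 : ℝ) 1) :
    (s : ℂ) * t ∈ cone t r :=
  ⟨s, hs, by rw [sub_self, norm_zero]; exact mul_pos (sub_pos.2 hs.2) hr⟩

/-- The discs making up the cone shrink fast enough not to reach the vertical line through the cut.
-/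
lemma re_lt_of_mem_cone (hrt : r ≤ t) {p : ℂ} (hp : p ∈ cone t r) : p.re < t := by
  obtain ⟨s, hs, hp⟩ := hp
  have h1 := (Complex.re_le_norm _).trans_lt hp
  have h2 : (p - s * t).re = p.re - s * t := by simp
  rw [h2] at h1
  nlinarith [hs.2]

lemma mk_mem_cone (ht : 0 < t) (hr : 0 < r) {a x y : ℝ} (hx : x ∈ Icc 0 a) (ha : a < t)
    (hy : |y| < (1 - a / t) * r) : (⟨x, y⟩ : ℂ) ∈ cone t r := by
  have h1 : a / t < 1 := (div_lt_one ht).2 ha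
  have h2 : x / t ≤ a / t := div_le_div_of_nonneg_right hx.2 ht.le
  refine ⟨x / t, ⟨div_nonneg hx.1 ht.le, h2.trans_lt h1⟩, ?_⟩
  have h3 : (⟨x, y⟩ : ℂ) - ((x / t : ℝ) : ℂ) * t = (y : ℂ) * Complex.I := by
    rw [← Complex.ofReal_mul, div_mul_cancel₀ _ ht.ne']
    apply Complex.ext <;> simp
  rw [h3, norm_mul, Complex.norm_I, mul_one, Complex.norm_real, Real.norm_eq_abs]
  nlinarith

lemma mk_mem_cutPlane {S : Finset ℂ} (htS : (t : ℂ) ∈ S) {x y : ℝ}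
    (h : Admissible S above x y) : (⟨x, y⟩ : ℂ) ∈ cutPlane above t := by
  by_cases hx : x = t
  · subst hx
    left
    have h1 := (h _ htS (Complex.ofReal_re _)).2.2 (Complex.ofReal_im _)
    unfold side
    split_ifs with hx
    · simpa using h1.1 hx
    · simpa using h1.2 hx
  · exact Or.inr hx

/-- Letters other than `0` and the least positive letter `t` stay away from the segment
`[0, t]`. -/
lemma exists_distance {S : Finset ℂ} (ht : IsLeast {x : ℝ | (x : ℂ) ∈ S ∧ 0 < x} t) :
    ∃ r, 0 < r ∧ r ≤ t ∧ ∀ σ ∈ S, σ ≠ 0 → σ ≠ t → ∀ s ∈ Icc (0 : ℝ) 1, r ≤ ‖σ - s * t‖ := by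
  have ht0 : 0 < t := ht.1.2
  have h1 : ∀ σ ∈ S, ∀ᶠ r in 𝓝[>] (0 : ℝ), σ ≠ 0 → σ ≠ t →
      ∀ s ∈ Icc (0 : ℝ) 1, r ≤ ‖σ - s * t‖ := by
    intro σ hσ
    by_cases h0 : σ = 0
    · exact .of_forall fun _ h => (h h0).elim
    by_cases hσt : σ = t
    · exact .of_forall fun _ _ h => (h hσt).elim
    have hpos : ∀ s ∈ Icc (0 : ℝ) 1, 0 < ‖σ - s * t‖ := by
      intro s hs
      rw [norm_pos_iff, sub_ne_zero]
      intro h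
      have hs0 : 0 < s := lt_of_le_of_ne hs.1 fun h' => h0 (by rw [h, ← h']; simp)
      -- Minimality of `t` among positive letters excludes further letters on the segment.
      have hle : t ≤ s * t := ht.2 ⟨by push_cast; rw [← h]; exact hσ, mul_pos hs0 ht0⟩
      have hs1 : s = 1 := le_antisymm hs.2 (by nlinarith)
      exact hσt (by rw [h, hs1]; simp)
    obtain ⟨c, hc, hle⟩ := isCompact_Icc.exists_forall_le'
      (f := fun s : ℝ => ‖σ - s * t‖) (by fun_prop) hpos
    filter_upwards [Ioc_mem_nhdsGT hc] with r hr _ _ s hs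
    exact hr.2.trans (hle s hs)
  obtain ⟨r, hr, h2, h3⟩ := (((eventually_all_finset S).2 h1).and
    (Ioc_mem_nhdsGT ht0)).exists.imp fun r h => (⟨h.2.1, h.2.2, h.1⟩ : _ ∧ _ ∧ _)
  exact ⟨r, hr, h2, h3⟩

lemma localData_cone {S : Finset ℂ} (h0 : (0 : ℂ) ∈ S) (ht : (t : ℂ) ∈ S) (ht0 : 0 < t)
    (hr : 0 < r) (hrt : r ≤ t)
    (hS : ∀ σ ∈ S, σ ≠ 0 → σ ≠ t → ∀ s ∈ Icc (0 : ℝ) 1, r ≤ ‖σ - s * t‖) (above : Set ℝ) :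
    LocalData S ⟨0, h0⟩ ⟨t, ht⟩ t (r / 2) (cone t r) (cutPlane above t) (cutLog above t) where
  coe_o := rfl
  coe_τ := rfl
  t_pos := ht0
  r_pos := half_pos hr
  r_lt := by linarith
  isOpen_V := isOpen_cone t r
  convex_V := convex_cone t r
  zero_mem := by simpa using mul_mem_cone t hr (s := 0) ⟨le_rfl, zero_lt_one⟩
  notMem_V σ hσ := by
    rintro ⟨s, hs, h⟩
    have hσ0 : (σ : ℂ) ≠ 0 := fun h' => hσ (Subtype.ext h')
    have hs' : 0 < 1 - s := sub_pos.2 hs.2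
    by_cases hσt : (σ : ℂ) = t
    · have h1 : (σ : ℂ) - s * t = (((1 - s) * t : ℝ) : ℂ) := by rw [hσt]; push_cast; ring
      rw [h1, Complex.norm_real, Real.norm_of_nonneg (by positivity)] at h
      nlinarith
    · nlinarith [hS σ σ.2 hσ0 hσt s ⟨hs.1, hs.2.le⟩, hs.1]
  segment_mem s hs := mul_mem_cone t hr hs
  notMem_ball σ hσ h := by
    have hσt : (σ : ℂ) ≠ t := fun h' => hσ (Subtype.ext h')
    rw [mem_ball_iff_norm] at h
    by_cases hσ0 : (σ : ℂ) = 0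
    · rw [hσ0, zero_sub, norm_neg, Complex.norm_real, Real.norm_of_nonneg ht0.le] at h
      linarith
    · have := hS σ σ.2 hσ0 hσt 1 ⟨zero_le_one, le_rfl⟩
      rw [Complex.ofReal_one, one_mul] at this
      linarith
  isOpen_Ω := isOpen_cutPlane above t
  V_subset p hp := Or.inr (re_lt_of_mem_cone hrt hp).ne
  notMem_Ω := by rintro (h | h) <;> simp at h
  hasDerivAt p hp := hasDerivAt_cutLog ht0 hp
  K_segment s hs := cutLog_of_lt ht0 hs.2
  preconnected := isPreconnected_ball_inter_cutPlane above t (half_pos hr)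

end Construction

/-! ### Adapting a height function to the disc about `τ` -/

section Merging

variable {S : Finset ℂ} {above : Set ℝ}

lemma mk_mem_ball {t r x y : ℝ} (hx : |x - t| ≤ r / 2) (hy : |y| < r / 2) :
    (⟨x, y⟩ : ℂ) ∈ Metric.ball (t : ℂ) r := by
  rw [mem_ball_iff_norm]
  refine (Complex.norm_le_abs_re_add_abs_im _).trans_lt ?_
  simp only [Complex.sub_re, Complex.sub_im, Complex.ofReal_re, Complex.ofReal_im, sub_zero]
  linarith

lemma IsHeight.exists_smul_lt {a z : ℝ} {M : ℝ → ℝ} (hM : IsHeight S above a z M) {ρ : ℝ}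
    (hρ : 0 < ρ) : ∃ ε ∈ Ioc (0 : ℝ) 1, ∀ x ∈ Icc a z, |ε * M x| < ρ := by
  obtain ⟨C, hC⟩ := isCompact_Icc.exists_bound_of_continuousOn hM.continuousOn
  have hC' : 0 < |C| + 1 := by positivity
  refine ⟨min 1 (ρ / (|C| + 1)), ⟨lt_min one_pos (div_pos hρ hC'), min_le_left _ _⟩,
    fun x hx => ?_⟩
  have h1 : 0 ≤ min 1 (ρ / (|C| + 1)) := le_min zero_le_one (div_pos hρ hC').le
  rw [abs_mul, abs_of_nonneg h1]
  have h2 : |M x| < |C| + 1 := ((hC x hx).trans (le_abs_self C)).trans_lt (lt_add_one _)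
  calc _ ≤ ρ / (|C| + 1) * |M x| := mul_le_mul_of_nonneg_right (min_le_right _ _) (abs_nonneg _)
    _ < ρ / (|C| + 1) * (|C| + 1) := mul_lt_mul_of_pos_left h2 (div_pos hρ hC')
    _ = ρ := div_mul_cancel₀ _ hC'.ne'

/-- A height function from `a` can be modified to be small up to `t` and to agree with a given
height function from `t` after some later point. -/
lemma IsHeight.exists_merge {a t b z : ℝ} (hat : a < t) (htb : t < b) (hbz : b ≤ z)
    {M N : ℝ → ℝ} (hM : IsHeight S above a z M) (hN : IsHeight S above t z N) {ρ : ℝ}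
    (hρ : 0 < ρ) : ∃ m : ℝ → ℝ, IsHeight S above a z m ∧ (∀ x ∈ Icc b z, m x = N x) ∧
      (∀ x ∈ Icc a t, |m x| < ρ) ∧
      ∀ x ∈ Icc t b, ∃ s ∈ Icc (0 : ℝ) 1, ∃ y, |y| < ρ ∧ m x = (1 - s) * y + s * N x := by
  obtain ⟨ε, hε, hsmall⟩ := hM.exists_smul_lt hρ
  have hbt : 0 < b - t := sub_pos.2 htb
  -- A cutoff rising from `0` at `t` to `1` at `b`. It interpolates between the flattened height `ε
  -- * M` and `N`, and admissibility survives by convexity; `max x t` keeps `N` on its interval.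
  set χ : ℝ → ℝ := fun x => max 0 (min 1 ((x - t) / (b - t))) with hχ
  have hχc : Continuous χ := by fun_prop
  have hχI : ∀ x, χ x ∈ Icc (0 : ℝ) 1 := fun x =>
    ⟨le_max_left _ _, max_le zero_le_one (min_le_left _ _)⟩
  have hχ0 : ∀ x ≤ t, χ x = 0 := fun x hx =>
    max_eq_left ((min_le_right _ _).trans (div_nonpos_of_nonpos_of_nonneg (by linarith) hbt.le))
  have hχ1 : ∀ x, b ≤ x → χ x = 1 := fun x hx => by
    have : 1 ≤ (x - t) / (b - t) := by rw [one_le_div hbt]; linarith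
    simp only [hχ, min_eq_left this, max_eq_right zero_le_one]
  have hmaxN : ∀ x ∈ Icc t z, N (max x t) = N x := fun x hx => by rw [max_eq_left hx.1]
  refine ⟨fun x => (1 - χ x) * (ε * M x) + χ x * N (max x t), ⟨?_, ?_, ?_, fun x hx => ?_⟩,
    fun x hx => ?_, fun x hx => ?_, fun x hx => ⟨χ x, hχI x, ε * M x, hsmall x ?_, ?_⟩⟩
  · have h1 : ContinuousOn (fun x => N (max x t)) (Icc a z) :=
      hN.continuousOn.comp (by fun_prop) fun x hx =>
        ⟨le_max_right _ _, max_le hx.2 (htb.le.trans hbz)⟩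
    exact ((continuous_const.sub hχc).continuousOn.mul (continuousOn_const.mul hM.continuousOn)).add
      (hχc.continuousOn.mul h1)
  · simp [hχ0 a hat.le, hM.left]
  · have htz : t ≤ z := htb.le.trans hbz
    simp [hχ1 z hbz, max_eq_left htz, hN.right]
  · have h1 := (hM.admissible x hx).smul hε
    rcases le_or_gt x t with hxt | hxt
    · simpa [hχ0 x hxt] using h1
    · rw [hmaxN x ⟨hxt.le, hx.2⟩]
      exact h1.convex (hN.admissible x ⟨hxt, hx.2⟩) (hχI x)
  · simp [hχ1 x hx.1, max_eq_left (htb.le.trans hx.1)]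
  · simpa [hχ0 x hx.2] using hsmall x ⟨hx.1, hx.2.trans (htb.le.trans hbz)⟩
  · exact ⟨hat.le.trans hx.1, hx.2.trans hbz⟩
  · dsimp only
    rw [hmaxN x ⟨hx.1, hx.2.trans hbz⟩]

lemma IsHeight.exists_initial {t z r : ℝ} (htz : t < z) (hr : 0 < r) {N : ℝ → ℝ}
    (hN : IsHeight S above t z N) :
    ∃ b ∈ Ioo t z, b ≤ t + r ∧ ∀ x ∈ Icc t b, |N x| < r := by
  have h1 : Tendsto N (𝓝[Icc t z] t) (𝓝 0) := by
    have := hN.continuousOn t ⟨le_rfl, htz.le⟩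
    rwa [ContinuousWithinAt, hN.left] at this
  have h2 : ∀ᶠ x in 𝓝[Icc t z] t, |N x| < r := by
    simpa using h1.eventually (Metric.ball_mem_nhds 0 hr)
  obtain ⟨e, he, h3⟩ := Metric.mem_nhdsWithin_iff.1 h2
  refine ⟨t + min (e / 2) (min r ((z - t) / 2)), ⟨?_, ?_⟩, ?_, fun x hx => h3 ⟨?_, hx.1, ?_⟩⟩
  · have : 0 < min (e / 2) (min r ((z - t) / 2)) :=
      lt_min (half_pos he) (lt_min hr (half_pos (sub_pos.2 htz)))
    linarith
  · have := (min_le_right (e / 2) (min r ((z - t) / 2))).trans (min_le_right _ _)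
    linarith
  · have := (min_le_right (e / 2) (min r ((z - t) / 2))).trans (min_le_left _ _)
    linarith
  · have := min_le_left (e / 2) (min r ((z - t) / 2))
    rw [Metric.mem_ball, Real.dist_eq, abs_of_nonneg (by linarith [hx.1])]
    linarith [hx.2]
  · have := (min_le_right (e / 2) (min r ((z - t) / 2))).trans (min_le_right _ _)
    linarith [hx.2]

end Merging

section Paths

variable {S : Finset ℂ} {above : Set ℝ} {a z : ℝ} {γ : ℝ → ℂ}

lemma IsDeformedSegment.path (hγ : IsDeformedSegment S above a z γ) :
    ContinuousOn γ (Icc 0 1) ∧ γ 0 = a ∧ γ 1 = z ∧ ∀ t ∈ Ioc (0 : ℝ) 1, γ t ∉ S := by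
  obtain ⟨h, H, -, -, -, -, -, hH, hHγ, -, hHe, hHS⟩ := hγ
  have hI0 : (0 : ℝ) ∈ Icc (0 : ℝ) 1 := ⟨le_rfl, zero_le_one⟩
  have hI1 : (1 : ℝ) ∈ Icc (0 : ℝ) 1 := ⟨zero_le_one, le_rfl⟩
  refine ⟨?_, ?_, ?_, fun t ht => ?_⟩
  · refine ContinuousOn.congr (f := fun t => H (0, t)) ?_ fun t ht => (hHγ t ht).symm
    exact hH.comp (by fun_prop) fun t ht => ⟨hI0, ht⟩
  · rw [← hHγ 0 hI0, (hHe 0 hI0).1]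
  · rw [← hHγ 1 hI1, (hHe 0 hI0).2]
  · rw [← hHγ t ⟨ht.1.le, ht.2⟩]
    exact hHS 0 hI0 t ht

end Paths

/-! ### Continuation of the local expansion to `z` -/

namespace LocalData

variable {S : Finset ℂ} {o τ : S} {t r : ℝ} {V Ω : Set ℂ} {K : ℂ → ℂ} {E : List S → ℂ → ℂ}
  {above : Set ℝ} {z b : ℝ} {N : ℝ → ℝ} {Φ : List S → ℝ → ℂ → ℂ}

lemma analyticAt_tangential (D : LocalData S o τ t r V Ω K) (T : TangentialSystem S τ r Ω K E)
    (u : List S) {p : ℂ} (hp : p ∈ Metric.ball (τ : ℂ) r ∩ Ω) : AnalyticAt ℂ (E u) p := by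
  cases u with
  | nil => rw [T.nil]; exact analyticAt_const
  | cons σ u =>
    exact DifferentiableOn.analyticAt (s := Metric.ball (τ : ℂ) r ∩ Ω)
      (fun q hq => (T.ode σ u q hq).differentiableAt.differentiableWithinAt)
      ((Metric.isOpen_ball.inter D.isOpen_Ω).mem_nhds hp)

/-- Starting at `b` rather than at `τ` makes every `E u` analytic at the start, including those of
words ending in `τ`. -/
lemma exists_continuation (D : LocalData S o τ t r V Ω K) (T : TangentialSystem S τ r Ω K E)
    (hN : IsHeight S above t z N) (hb : b ∈ Ioo t z)
    (hball : graph N b ∈ Metric.ball (τ : ℂ) r ∩ Ω) :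
    ∃ Φ : List S → ℝ → ℂ → ℂ, ∀ u, Φ u b = E u ∧ ContOn (graph N) (Φ u) (Icc b z) := by
  obtain ⟨Φ, -, h, -⟩ := exists_system (S := S) (P := univ) (Y := E) hb.2.le
    (hN.continuousOn_graph.mono (Icc_subset_Icc_left hb.1.le))
    (fun x hx => (hN.admissible x ⟨hb.1.trans hx.1, hx.2⟩).notMem) (fun _ _ _ => mem_univ _) T.nil
    (fun u _ => D.analyticAt_tangential T u hball) (fun σ u _ => by
      filter_upwards [(Metric.isOpen_ball.inter D.isOpen_Ω).mem_nhds hball] with p hp _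
      exact (T.ode σ u p hp).deriv)
  exact ⟨Φ, fun u => h u (mem_univ u)⟩

lemma evalLin_continuation_shuffleWords (D : LocalData S o τ t r V Ω K)
    (T : TangentialSystem S τ r Ω K E) (hN : IsHeight S above t z N) (hb : b ∈ Ioo t z)
    (hball : graph N b ∈ Metric.ball (τ : ℂ) r ∩ Ω)
    (hΦ : ∀ u, Φ u b = E u ∧ ContOn (graph N) (Φ u) (Icc b z)) (u v : List S) :
    evalLin (fun u => Φ u z) z (shuffleWords u v) = Φ u z z * Φ v z z := by
  have h1 : ContOn (graph N) (fun x p => ∑ w ∈ (shuffleWords u v).support,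
      ((shuffleWords u v w : ℚ) : ℂ) * Φ w x p) (Icc b z) :=
    ContOn.sum _ fun w _ => (hΦ w).2.const_mul _
  have h2 := ContOn.unique isPreconnected_Icc
    (hN.continuousOn_graph.mono (Icc_subset_Icc_left hb.1.le)) h1 ((hΦ u).2.mul (hΦ v).2)
    ⟨le_rfl, hb.2.le⟩ (by
      filter_upwards [(Metric.isOpen_ball.inter D.isOpen_Ω).mem_nhds hball] with p hp
      simp only [(hΦ _).1]
      rw [← evalLin_apply E p, D.evalLin_tangential_shuffleWords T u v hp])
    (t := z) ⟨hb.2.le, le_rfl⟩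
  rw [evalLin_apply]
  have h3 : graph N z = z := by rw [graph, hN.right]; rfl
  rw [h3] at h2
  exact h2.self_of_nhds

lemma continuation_letter (D : LocalData S o τ t r V Ω K)
    (T : TangentialSystem S τ r Ω K E) (hN : IsHeight S above t z N) (hb : b ∈ Ioo t z)
    (hΩ : ∀ x ∈ Ioc t z, graph N x ∈ Ω)
    (hΦ : ∀ u, Φ u b = E u ∧ ContOn (graph N) (Φ u) (Icc b z)) : Φ [τ] z z = K z := by
  have h1 : ContOn (graph N) (fun _ => K) (Icc b z) := ContOn.const fun x hx =>
    DifferentiableOn.analyticAt (s := Ω)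
      (fun q hq => (D.hasDerivAt q hq).differentiableAt.differentiableWithinAt)
      (D.isOpen_Ω.mem_nhds (hΩ x ⟨hb.1.trans_le hx.1, hx.2⟩))
  have h2 := ContOn.unique isPreconnected_Icc
    (hN.continuousOn_graph.mono (Icc_subset_Icc_left hb.1.le)) (hΦ [τ]).2 h1
    ⟨le_rfl, hb.2.le⟩ (by
      rw [(hΦ _).1]
      have := T.replicate 1
      simp only [List.replicate_one, pow_one, Nat.factorial_one, Nat.cast_one, div_one] at this
      rw [this]) (t := z) ⟨hb.2.le, le_rfl⟩
  have h3 : graph N z = z := by rw [graph, hN.right]; rfl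
  rw [h3] at h2
  exact h2.self_of_nhds

/-- Off `τ` as last letter, `E u` is a single analytic function on the part of the graph over `[t,
b]`, so the continuation can start at `τ` itself and be compared with that along `δ`. -/
lemma iterInt_eq_continuation (D : LocalData S o τ t r V Ω K)
    (T : TangentialSystem S τ r Ω K E) (hN : IsHeight S above t z N) (hb : b ∈ Ioo t z)
    (hball : ∀ x ∈ Icc t b, graph N x ∈ Metric.ball (τ : ℂ) r)
    (hΦ : ∀ u, Φ u b = E u ∧ ContOn (graph N) (Φ u) (Icc b z)) {δ : ℝ → ℂ}
    (hδ : IsDeformedSegment S above t z δ) (hδ' : ContDiffOn ℝ 1 δ (Icc 0 1)) {u : List S}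
    (hu : u ∈ endsOff τ) : iterInt δ (u.map Subtype.val) 1 = Φ u z z := by
  obtain ⟨-, hδ0, hδ1, hδS⟩ := hδ.path
  obtain ⟨F, hF0, hF, hF1⟩ := D.exists_continuation_iterInt T hδ' (by rw [hδ0, D.coe_τ]) hδS hu
  have h1 : ContOn (graph N) (fun x => if x ≤ b then E u else Φ u x) (Icc t z) :=
    ContOn.glue hb.1.le hb.2.le hN.continuousOn_graph
      (ContOn.const fun x hx => (tangential_analytic T hu).1 _ (hball x hx)) (hΦ u).2
      (by rw [(hΦ u).1])
  have hf : IsContinuable S t (E u) := by rw [← D.coe_τ]; exact D.isContinuable_tangential T hu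
  have h2 := hδ.transfer (hb.1.trans hb.2) hf hF (by rw [hF0]) hN h1 (by rw [if_pos hb.1.le])
  rw [hF1, hδ1, h2.self_of_nhds, if_neg (not_le.2 hb.2)]

lemma continuation_hlog_eq_sum (D : LocalData S o τ t r V Ω K)
    (T : TangentialSystem S τ r Ω K E) (hN : IsHeight S above t z N) (hb : b ∈ Ioo t z)
    (hbr : b ≤ t + r / 2) (hNb : ∀ x ∈ Icc t b, |N x| < r / 2)
    (hΩ : ∀ x y, Admissible S above x y → (⟨x, y⟩ : ℂ) ∈ Ω)
    (hV : ∀ c < t, ∃ η > 0, ∀ x ∈ Icc 0 c, ∀ y, |y| < η → (⟨x, y⟩ : ℂ) ∈ V)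
    (hΦ : ∀ u, Φ u b = E u ∧ ContOn (graph N) (Φ u) (Icc b z)) {γ : ℝ → ℂ}
    (hγ : IsDeformedSegment S above 0 z γ) {w : List S} (hw : w ∈ endsOff o) {F : ℝ → ℂ → ℂ}
    (hF : ContOn γ F (Icc 0 1)) (hF0 : F 0 =ᶠ[𝓝 0] hlog w) :
    F 1 z = ∑ k ∈ Finset.range (w.length + 1), Φ (w.take k) z z * regValue τ (w.drop k) := by
  have hr := D.r_pos
  have ht := D.t_pos
  have hrt := D.r_lt
  have htz : t < z := hb.1.trans hb.2
  obtain ⟨M, -, hM, -⟩ := hγ.exists_height (ht.trans htz)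
  -- Over `c` the flattened graph lies both in `V` and in the disc, so `hlog w` can be exchanged for
  -- its expansion there.
  set c := t - r / 2 with hc
  have hc0 : 0 ≤ c := by linarith
  have hct : c < t := by linarith
  have hcb : c ≤ b := hct.le.trans hb.1.le
  obtain ⟨η, hη, hVη⟩ := hV c hct
  obtain ⟨m, hm, hmN, hmt, hmb⟩ :=
    hM.exists_merge ht hb.1 hb.2.le hN (lt_min hη (half_pos hr))
  have hmΩ : ∀ x ∈ Ioc 0 z, graph m x ∈ Ω := fun x hx => hΩ _ _ (hm.admissible x hx)
  have hmV : ∀ x ∈ Icc 0 c, graph m x ∈ V := fun x hx =>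
    hVη x hx _ ((hmt x ⟨hx.1, hx.2.trans hct.le⟩).trans_le (min_le_left _ _))
  have hmB : ∀ x ∈ Icc c b, graph m x ∈ Metric.ball (τ : ℂ) r := by
    intro x hx
    rw [D.coe_τ]
    have hx' : |x - t| ≤ r / 2 := abs_le.2 ⟨by linarith [hx.1], by linarith [hx.2]⟩
    rcases le_or_gt x t with hxt | hxt
    · exact mk_mem_ball hx' ((hmt x ⟨hc0.trans hx.1, hxt⟩).trans_le (min_le_right _ _))
    · obtain ⟨s, hs, y, hy, he⟩ := hmb x ⟨hxt.le, hx.2⟩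
      refine mk_mem_ball hx' ?_
      have h1 : m x ∈ Metric.ball (0 : ℝ) (r / 2) := by
        rw [he]
        refine convex_ball (0 : ℝ) (r / 2) ?_ ?_ (sub_nonneg.2 hs.2) hs.1 (by ring)
        · simpa using hy.trans_le (min_le_right _ _)
        · simpa using hNb x ⟨hxt.le, hx.2⟩
      simpa using h1
  have hcΩ : ∀ x ∈ Icc c b, graph m x ∈ Metric.ball (τ : ℂ) r ∩ Ω := fun x hx =>
    ⟨hmB x hx, hmΩ x ⟨by linarith [hx.1], hx.2.trans hb.2.le⟩⟩
  set C : ℕ → ℂ := fun k => regValue τ (w.drop k) with hC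
  have h1 : ContOn (graph m) (fun _ => hlog w) (Icc 0 c) :=
    ContOn.const fun x hx => D.analyticOnNhd_hlog hw _ (hmV x hx)
  have h2 : ContOn (graph m) (fun _ p => ∑ k ∈ Finset.range (w.length + 1), C k * E (w.take k) p)
      (Icc c b) :=
    ContOn.sum _ fun k _ => (ContOn.const fun x hx =>
      D.analyticAt_tangential T _ (hcΩ x hx)).const_mul _
  have h3 : ContOn (graph m) (fun x p => ∑ k ∈ Finset.range (w.length + 1),
      C k * Φ (w.take k) x p) (Icc b z) :=
    ContOn.sum _ fun k _ => ((hΦ _).2.congr_path fun x hx => by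
      rw [graph, graph, hmN x hx]).const_mul _
  have hmc := hm.continuousOn_graph
  -- Three pieces are glued: `hlog w` up to `c`, its expansion in `E` up to `b`, and the continued
  -- expansion up to `z`.
  have h4 := ContOn.glue hc0 hcb (hmc.mono (Icc_subset_Icc_right hb.2.le)) h1 h2 (by
    filter_upwards [(D.isOpen_V.inter Metric.isOpen_ball).mem_nhds
      ⟨hmV c ⟨hc0, le_rfl⟩, hmB c ⟨le_rfl, hcb⟩⟩] with p hp
    rw [D.hlog_eq_sum T hw hp]
    exact Finset.sum_congr rfl fun k _ => mul_comm _ _)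
  have h5 := ContOn.glue (hc0.trans hcb) hb.2.le hmc h4 h3 (by
    simp only [(hΦ _).1, if_neg (not_le.2 (hct.trans hb.1))]
    rfl)
  have h6 := hγ.transfer (ht.trans htz) (by simpa using D.isContinuable_hlog hw) hF
    (by simpa using hF0) hm h5 (by simp [hc0.trans hcb, hc0])
  rw [h6.self_of_nhds, if_neg (not_le.2 hb.2)]
  exact Finset.sum_congr rfl fun k _ => mul_comm _ _

end LocalData

lemma hyperlogLin_eq_evalLin {S : Finset ℂ} (x : WordSpace S) (p : ℂ) :
    hyperlogLin x p = evalLin hlog p x := by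
  rw [evalLin_apply]; rfl

lemma IsAnalyticContinuation.contOn {f : ℂ → ℂ} {γ : ℝ → ℂ} {F : ℝ → ℂ → ℂ}
    (h : IsAnalyticContinuation f γ F) : ContOn γ F (Icc 0 1) := ⟨h.analytic, h.compatible⟩

/-! ### Assembly of the connection formula -/

/-- The connection formula, for the extension of the iterated integrals given by continuation. -/
theorem exists_connection {S : Finset ℂ} (h0 : (0 : ℂ) ∈ S) {τ : ℝ}
    (hτ : IsLeast {x : ℝ | (x : ℂ) ∈ S ∧ 0 < x} τ) {z : ℝ} (hz : τ < z) {above : Set ℝ}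
    {δ : ℝ → ℂ} (hδ : IsDeformedSegment S above τ z δ) (hδ' : ContDiffOn ℝ 1 δ (Icc 0 1)) :
    ∃ I : WordSpace S →ₗ[ℚ] ℂ,
      IsExtendedIntegral ⟨(τ : ℂ), hτ.1.1⟩ δ (branchValue above τ z) I ∧
      ∀ γ : ℝ → ℂ, IsDeformedSegment S above 0 z γ → ∀ w ∈ endsOff (⟨0, h0⟩ : S),
        (∃ F, IsAnalyticContinuation (hlog w) γ F) ∧
        ∀ F, IsAnalyticContinuation (hlog w) γ F →
          F 1 z = ∑ k ∈ Finset.range (w.length + 1), I (word (w.take k)) *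
            hyperlogLin (delReg ⟨(τ : ℂ), hτ.1.1⟩ (word (w.drop k))) τ := by
  obtain ⟨r, hr, hrt, hS⟩ := exists_distance hτ
  have D := localData_cone h0 hτ.1.1 hτ.1.2 hr hrt hS above
  obtain ⟨E, T⟩ := D.exists_tangentialSystem
  obtain ⟨N, -, hN, -⟩ := hδ.exists_height hz
  obtain ⟨b, hb, hbr, hNb⟩ := hN.exists_initial hz (half_pos D.r_pos)
  have hΩ : ∀ x y, Admissible S above x y → (⟨x, y⟩ : ℂ) ∈ cutPlane above τ :=
    fun x y h => mk_mem_cutPlane hτ.1.1 h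
  have hNΩ : ∀ x ∈ Ioc τ z, graph N x ∈ cutPlane above τ := fun x hx =>
    hΩ _ _ (hN.admissible x hx)
  have hNB : ∀ x ∈ Icc τ b, graph N x ∈ Metric.ball (τ : ℂ) (r / 2) := fun x hx =>
    mk_mem_ball (abs_le.2 ⟨by linarith [hx.1], by linarith [hx.2]⟩) (hNb x hx)
  have hball : graph N b ∈ Metric.ball (τ : ℂ) (r / 2) ∩ cutPlane above τ :=
    ⟨hNB b ⟨hb.1.le, le_rfl⟩, hNΩ b ⟨hb.1, hb.2.le⟩⟩
  have hV : ∀ c < τ, ∃ η > 0, ∀ x ∈ Icc 0 c, ∀ y, |y| < η → (⟨x, y⟩ : ℂ) ∈ cone τ r :=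
    fun c hc => ⟨(1 - c / τ) * r, mul_pos (sub_pos.2 ((div_lt_one hτ.1.2).2 hc)) hr,
      fun x hx y hy => mk_mem_cone hτ.1.2 hr hx hc hy⟩
  obtain ⟨Φ, hΦ⟩ := D.exists_continuation T hN hb hball
  refine ⟨evalLin (fun u => Φ u z) z, ⟨fun u hu => ?_, fun u v => ?_, ?_⟩,
    fun γ hγ w hw => ⟨?_, fun F hF => ?_⟩⟩
  · rw [evalLin_word, D.iterInt_eq_continuation T hN hb hNB hΦ hδ hδ' hu]
  · rw [evalLin_word, evalLin_word, D.evalLin_continuation_shuffleWords T hN hb hball hΦ]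
  · rw [evalLin_word, D.continuation_letter T hN hb hNΩ hΦ, cutLog_of_gt hτ.1.2 hz]
  · obtain ⟨hγc, hγ0, -, hγS⟩ := hγ.path
    rw [Complex.ofReal_zero] at hγ0
    obtain ⟨F, hF0, hF⟩ := D.isContinuable_hlog hw γ hγc hγ0 hγS
    exact ⟨F, by rw [hF0], hF.analytic, hF.compatible⟩
  · have hF0 := hF.start
    rw [hγ.path.2.1, Complex.ofReal_zero] at hF0
    rw [D.continuation_hlog_eq_sum T hN hb hbr hNb hΩ hV hΦ hγ hw hF.contOn hF0]
    refine Finset.sum_congr rfl fun k _ => ?_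
    rw [evalLin_word, hyperlogLin_eq_evalLin]
    rfl

end Hyperlogs

end

theorem mainTheorem2 (S : Finset ℂ) (h0 : (0 : ℂ) ∈ S) (τ : ℝ)
    (hτ : IsLeast {x : ℝ | (x : ℂ) ∈ S ∧ 0 < x} τ)
    (w : List S) (hw : ∀ σ ∈ w.getLast?, (σ : ℂ) ≠ 0)
    (z : ℝ) (hz : τ < z) (above : Set ℝ)
    (γ : ℝ → ℂ) (hγ : Hyperlogs.IsDeformedSegment S above 0 z γ)
    (δ : ℝ → ℂ) (hδ : Hyperlogs.IsDeformedSegment S above τ z δ)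
    (hδ' : ContDiffOn ℝ 1 δ (Set.Icc 0 1)) :
    (∃! reg, Hyperlogs.IsWordReg ∅ {(⟨(τ : ℂ), hτ.1.1⟩ : S)} reg) ∧
    (∃! I, Hyperlogs.IsExtendedIntegral ⟨(τ : ℂ), hτ.1.1⟩ δ (Hyperlogs.branchValue above τ z) I) ∧
    (∃ F, Hyperlogs.IsAnalyticContinuation (Hyperlogs.hyperlog (w.map Subtype.val)) γ F) ∧
    (∀ G, Hyperlogs.IsAnalyticContinuation (Hyperlogs.hyperlog [(τ : ℂ)]) γ G →
      G 1 (z : ℂ) = Hyperlogs.branchValue above τ z) ∧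
    ∀ reg I F,
      Hyperlogs.IsWordReg ∅ {(⟨(τ : ℂ), hτ.1.1⟩ : S)} reg →
      Hyperlogs.IsExtendedIntegral ⟨(τ : ℂ), hτ.1.1⟩ δ (Hyperlogs.branchValue above τ z) I →
      Hyperlogs.IsAnalyticContinuation (Hyperlogs.hyperlog (w.map Subtype.val)) γ F →
      F 1 (z : ℂ) = ∑ k ∈ Finset.range (w.length + 1),
        I (Hyperlogs.word (w.take k)) *
          Hyperlogs.hyperlogLin (reg (Hyperlogs.word (w.drop k))) (τ : ℂ) := by
  open Hyperlogs in
  obtain ⟨I₀, hI₀, hconn⟩ := exists_connection h0 hτ hz hδ hδ'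
  set τ' : S := ⟨(τ : ℂ), hτ.1.1⟩
  have hreg := isWordReg_delReg τ'
  have huniq : ∀ I, IsExtendedIntegral τ' δ (branchValue above τ z) I → I = I₀ := fun I hI =>
    character_ext (τ := τ') hI.map_shuffle hI₀.map_shuffle
      (fun u hu => by rw [hI.eq_iterInt u hu, hI₀.eq_iterInt u hu])
      (by rw [hI.map_letter, hI₀.map_letter])
  have hwo : w ∈ endsOff (⟨0, h0⟩ : S) := fun h => hw _ h rfl
  refine ⟨⟨delReg τ', hreg, fun reg h => h.eq_delReg⟩, ⟨I₀, hI₀, huniq⟩, (hconn γ hγ w hwo).1,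
    fun G hG => ?_, fun reg I F hr hI hF => ?_⟩
  · have hmem : [τ'] ∈ endsOff (⟨0, h0⟩ : S) := by
      intro h
      have h1 : (⟨0, h0⟩ : S) = τ' := by simpa using h.symm
      exact hτ.1.2.ne (Complex.ofReal_eq_zero.1 (congrArg Subtype.val h1).symm).symm
    -- For the single letter the formula has two terms; the one with `k = 0` vanishes because
    -- `delReg` annihilates `τ`.
    rw [(hconn γ hγ [τ'] hmem).2 G hG]
    have h1 : delReg τ' (word [τ']) = 0 := hreg.map_singular _ (by simp) (Or.inr (by simp))
    have h2 : delReg τ' (word []) = word [] := hreg.map_regular _ (by simp) (by simp)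
    have h3 : I₀ (word [τ']) = branchValue above τ z := hI₀.map_letter
    simp only [List.length_cons, List.length_nil, Finset.sum_range_succ, Finset.range_zero,
      Finset.sum_empty, List.drop_zero, List.take_zero, List.drop_succ_cons, List.take_succ_cons,
      h1, h2, h3, hyperlogLin_eq_evalLin, map_zero, mul_zero, evalLin_word, LocalData.hlog_nil, mul_one,
      zero_add]
  · rw [hr.eq_delReg, huniq I hI]
    exact (hconn γ hγ w hwo).2 F hF
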